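/- Let $\mu,\nu$ be finite positive Borel measures on $\mathbb{R}$ with $\mu(\mathbb{R})=\nu(\mathbb{R})$. Write $\mathrm{Marg}(\mu,\nu)$ for the set of measures on $\mathbb{R}^2$ with marginals $\mu,\nu$, and $F_\gamma^+(t)=\gamma(\{x\in\mathbb{R}: x\le t\})$, $F_\gamma^-(t)=\gamma(\{x\in\mathbb{R}: x<t\})$ for $t\in[-\infty,+\infty]$. **Entropic plans.** For $\varepsilon>0$ let $\pi_\varepsilon\in\mathrm{Marg}(\mu,\nu)$ be the $\varepsilon$-cyclically invariant plan: $\pi_\varepsilon=f\cdot(\mu\otimes\nu)$ for a measurable $f:\mathbb{R}^2\to[0,\infty[$ such that for all $n\ge1$ and $(x_1,y_1),\dots,(x_n,y_n)\in\mathbb{R}^2$, with $y_{n+1}=y_1$, $$\prod_{i=1}^n e^{|y_i-x_i|/\varepsilon}f(x_i,y_i)=\prod_{i=1}^n e^{|y_{i+1}-x_i|/\varepsilon}f(x_i,y_{i+1}).$$ **Components.** Let $E^+=\{F_\mu^+>F_\nu^+\}\cap\{F_\mu^->F_\nu^-\}$ and $E^-=\{F_\mu^+<F_\nu^+\}\cap\{F_\mu^-<F_\nu^-\}$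 (open subsets of $\mathbb{R}$), with connected components $(]a_k^+,b_k^+[)_{k\in\mathcal K^+}$ and $(]a_k^-,b_k^-[)_{k\in\mathcal K^-}$; let $E^==\mathbb{R}\setminus(E^+\cup E^-)$ and let $B\subset\mathbb{R}$ be the set of all finite end points of these components. For $k\in\mathcal K^+$ put $$\mu_k^+=(F_\mu^+-F_\nu^+)(a_k^+)\,\delta_{a_k^+}+\mu|_{]a_k^+,b_k^+[},\qquad \nu_k^+=\nu|_{]a_k^+,b_k^+[}+(F_\mu^--F_\nu^-)(b_k^+)\,\delta_{b_k^+},$$ and for $k\in\mathcal K^-$ put $$\mu_k^-=\mu|_{]a_k^-,b_k^-[}+(F_\nu^--F_\mu^-)(b_k^-)\,\delta_{b_k^-},\qquad \nu_k^-=(F_\nu^+-F_\mu^+)(a_k^-)\,\delta_{a_k^-}+\nu|_{]a_k^-,b_k^-[}$$ (atoms at infinite end points are absent). With $\mu^\pm=\sum_{k\in\mathcal K^\pm}\mu_k^\pm$, let $$\mu^==\mu|_{B^c\cap E^=}+\sum_{x\in B}\big(\mu(\{x\})-\mu^+(\{x\})-\mu^-(\{x\})\big)\delta_x .$$ **Kellerer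 plan.** Let $\mathrm{F}=\{(x,y):x\le y\}$. When it exists and is unique, $\mathcal K_{\mathrm F}(\gamma_1,\gamma_2)$ denotes the element of $\mathrm{Marg}(\gamma_1,\gamma_2)$ of the form $(\eta_1\otimes\eta_2)|_{\mathrm F}$ with $\eta_1,\eta_2$ $\sigma$-finite. With $i(x,y)=(y,x)$, define $$\mathcal K(\mu,\nu)=\sum_{k\in\mathcal K^+}\mathcal K_{\mathrm F}(\mu_k^+,\nu_k^+)+\sum_{k\in\mathcal K^-}i_\#\mathcal K_{\mathrm F}(\nu_k^-,\mu_k^-)+(\mathrm{id},\mathrm{id})_\#\mu^= .$$ **Theorem.** Suppose that $\mu_k^+$ and $\nu_k^+$ are mutually singular for every $k\in\mathcal K^+$, and that $\mu_k^-$ and $\nu_k^-$ are mutually singular for every $k\in\mathcal K^-$. Then the generalized Kellerer plan $\mathcal K(\mu,\nu)$ is a well-defined finite measure, and $\pi_\varepsilon$ converges weakly to $\mathcal K(\mu,\nu)$ as $\varepsilon\to0^+$. -/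

import Mathlib

open MeasureTheory Set Filter Topology
open scoped ENNReal NNReal

namespace EntropicLine

noncomputable section

/-! ### Transport plans and entropic plans -/

/-- `Marg(μ, ν)`: measures on the plane with marginals `μ` and `ν`. -/
def Marg (μ ν : Measure ℝ) : Set (Measure (ℝ × ℝ)) :=
  {π | π.map Prod.fst = μ ∧ π.map Prod.snd = ν}

/-- `π` is an `ε`-cyclically invariant transport plan from `μ` to `ν` for the cost `|y - x|`:
it has a density `f` with respect to `μ ⊗ ν` such that `exp (|y - x| / ε) f (x, y)`, which is
the density of `π` with respect to `exp (-|y - x| / ε) μ(dx) ν(dy)`, has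
cyclically invariant products. Addition in `Fin (n + 1)` is cyclic. -/
def IsCyclicallyInvariant (ε : ℝ) (μ ν : Measure ℝ) (π : Measure (ℝ × ℝ)) : Prop :=
  π ∈ Marg μ ν ∧
    ∃ f : ℝ × ℝ → ℝ≥0, Measurable f ∧
      π = (μ.prod ν).withDensity (fun p => (f p : ℝ≥0∞)) ∧
      ∀ (n : ℕ) (x y : Fin (n + 1) → ℝ),
        ∏ i, Real.exp (|y i - x i| / ε) * (f (x i, y i) : ℝ) =
          ∏ i, Real.exp (|y (i + 1) - x i| / ε) * (f (x i, y (i + 1)) : ℝ)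

/-! ### Components of the real line -/

/-- `E⁺(μ, ν)`: both distribution functions of `μ` (right- and left-continuous) strictly
exceed those of `ν`. -/
def posSet (μ ν : Measure ℝ) : Set ℝ :=
  {t | ν (Iic t) < μ (Iic t) ∧ ν (Iio t) < μ (Iio t)}

/-- `E⁻(μ, ν)`: both distribution functions of `μ` are strictly below those of `ν`. -/
def negSet (μ ν : Measure ℝ) : Set ℝ :=
  {t | μ (Iic t) < ν (Iic t) ∧ μ (Iio t) < ν (Iio t)}

/-- `E⁼(μ, ν)`, the remaining points. -/
def eqSet (μ ν : Measure ℝ) : Set ℝ := (posSet μ ν ∪ negSet μ ν)ᶜ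

/-- The connected components of a set of reals. -/
def components (E : Set ℝ) : Set (Set ℝ) := {I | ∃ x ∈ E, I = connectedComponentIn E x}

/-- Left end point of a component, possibly `-∞`. -/
def leftEnd (I : Set ℝ) : EReal := sInf ((fun x : ℝ => (x : EReal)) '' I)

/-- Right end point of a component, possibly `+∞`. -/
def rightEnd (I : Set ℝ) : EReal := sSup ((fun x : ℝ => (x : EReal)) '' I)

/-- `B(μ, ν)`: the (finite) end points of the components of `E⁺` and of `E⁻`. -/
def boundaryPts (μ ν : Measure ℝ) : Set ℝ :=
  {x | ∃ I ∈ components (posSet μ ν) ∪ components (negSet μ ν),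
    leftEnd I = (x : EReal) ∨ rightEnd I = (x : EReal)}

/-! ### Components of the marginals -/

/-- Right-continuous distribution function `F⁺`, extended to `[-∞, +∞]`. -/
def cdfR (γ : Measure ℝ) (t : EReal) : ℝ≥0∞ := γ {x : ℝ | (x : EReal) ≤ t}

/-- Left-continuous distribution function `F⁻`, extended to `[-∞, +∞]`. At `+∞` it is the
total mass, as `F⁺` is. -/
def cdfL (γ : Measure ℝ) (t : EReal) : ℝ≥0∞ := γ {x : ℝ | (x : EReal) < t}

/-- `μ_k⁺` for the component `I = ]a, b[` of `E⁺`: the mass `F_μ⁺(a) - F_ν⁺(a)` at `a` and the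
restriction of `μ` to `I`. At an infinite end point the mass of the atom is zero. -/
def muPos (μ ν : Measure ℝ) (I : Set ℝ) : Measure ℝ :=
  (cdfR μ (leftEnd I) - cdfR ν (leftEnd I)) • Measure.dirac (leftEnd I).toReal + μ.restrict I

/-- `ν_k⁺` for the component `I = ]a, b[` of `E⁺`. -/
def nuPos (μ ν : Measure ℝ) (I : Set ℝ) : Measure ℝ :=
  ν.restrict I + (cdfL μ (rightEnd I) - cdfL ν (rightEnd I)) • Measure.dirac (rightEnd I).toReal

/-- `μ_k⁻` for the component `I = ]a, b[` of `E⁻`. -/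
def muNeg (μ ν : Measure ℝ) (I : Set ℝ) : Measure ℝ :=
  μ.restrict I + (cdfL ν (rightEnd I) - cdfL μ (rightEnd I)) • Measure.dirac (rightEnd I).toReal

/-- `ν_k⁻` for the component `I = ]a, b[` of `E⁻`. -/
def nuNeg (μ ν : Measure ℝ) (I : Set ℝ) : Measure ℝ :=
  (cdfR ν (leftEnd I) - cdfR μ (leftEnd I)) • Measure.dirac (leftEnd I).toReal + ν.restrict I

/-- `μ⁺`, the sum of the `μ_k⁺`. -/
def muPosTotal (μ ν : Measure ℝ) : Measure ℝ :=
  Measure.sum fun I : components (posSet μ ν) => muPos μ ν I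

/-- `μ⁻`, the sum of the `μ_k⁻`. -/
def muNegTotal (μ ν : Measure ℝ) : Measure ℝ :=
  Measure.sum fun I : components (negSet μ ν) => muNeg μ ν I

/-- `μ⁼ = μ₁⁼ + μ₂⁼`: the restriction of `μ` to `E⁼` off the boundary points, and what the
components leave of the atoms of `μ` at the boundary points. -/
def muEq (μ ν : Measure ℝ) : Measure ℝ :=
  μ.restrict ((boundaryPts μ ν)ᶜ ∩ eqSet μ ν) +
    Measure.sum fun x : boundaryPts μ ν =>
      (μ {(x : ℝ)} - muPosTotal μ ν {(x : ℝ)} - muNegTotal μ ν {(x : ℝ)}) •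
        Measure.dirac (x : ℝ)

/-! ### Kellerer transport plans -/

/-- `π` is (largely) strongly multiplicative: the restriction to `{x ≤ y}` of a product of two
σ-finite measures. -/
def IsStronglyMultiplicative (π : Measure (ℝ × ℝ)) : Prop :=
  ∃ η₁ η₂ : Measure ℝ, SigmaFinite η₁ ∧ SigmaFinite η₂ ∧
    π = (η₁.prod η₂).restrict {p : ℝ × ℝ | p.1 ≤ p.2}

open Classical in
/-- `𝒦_F(γ₁, γ₂)`: the unique strongly multiplicative element of `Marg(γ₁, γ₂)` (and `0` if there
is no such unique element). -/
def kellererF (γ₁ γ₂ : Measure ℝ) : Measure (ℝ × ℝ) :=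
  if h : ∃! π : Measure (ℝ × ℝ), π ∈ Marg γ₁ γ₂ ∧ IsStronglyMultiplicative π then h.choose else 0

/-- The generalized Kellerer transport plan `𝒦(μ, ν)`: the Kellerer plans of the positive
components, the mirrored Kellerer plans of the negative components, and the identical coupling of
the common part. -/
def kellererPlan (μ ν : Measure ℝ) : Measure (ℝ × ℝ) :=
  (Measure.sum fun I : components (posSet μ ν) => kellererF (muPos μ ν I) (nuPos μ ν I)) +
  (Measure.sum fun I : components (negSet μ ν) =>
    (kellererF (nuNeg μ ν I) (muNeg μ ν I)).map Prod.swap) +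
  (muEq μ ν).map (fun x => (x, x))

end

end EntropicLine

namespace EntropicLine

/-! Cyclic invariance makes the plan a product: dπ_ε = e^{-|y-x|/ε} a(x) b(y) dμ dν
(`IsCyclicallyInvariant.exists_entropicFactors`). For x ≤ y the kernel splits as e^{x/ε} e^{-y/ε},
so for s ≤ t the mass carried from ]-∞,s[ to [t,∞[ is a product G_ε(s) H_ε(t). The proof is a study
of these crossing masses as ε → 0.

At s = t, conservation of mass says that the flow to the right minus the flow to the left is D(t) =
F_μ^-(t) - F_ν^-(t). The product of the two flows tends to 0, because re-pairing two opposite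
crossings on their own sides of t shortens the transport. Hence G_ε(t) H_ε(t) → D(t)^+
(`tendsto_cross`). The first marginal condition reads dG_ε = (G_ε/C_ε) dμ with C_ε ≥ D and C_ε → D
wherever D > 0. On a compact part of a component of E^+, D is bounded below, and a Gronwall estimate
that tolerates atoms shows that the ratios G_ε(t)/G_ε(s) converge
(`FlowSolution.exists_tendsto_ratio`). If g is the limit of the normalised G_ε and h = D/g, the
crossing masses tend to g(s) h(t) (`exists_limitFlow`).

The functions g and h are the distribution function and the tail of two σ-finite measures whose
product, restricted to {x ≤ y}, has the marginals μ_k^+ and ν_k^+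
(`LimitFlow.exists_multiplicative`). Thus the existence of the Kellerer plans is drawn from the
entropic plans. For uniqueness, the factors of any such plan solve dg = (g/D) dμ, which fixes
g(t)/g(s) and with it g(s) h(t) (`ComponentMarginals.eq_of_multiplicative`).

A point of [s,t] outside E^+ blocks the flow to the right in the limit (`tendsto_cross_of_notMem`).
So the crossing masses from left to right converge to those of 𝒦(μ,ν) whenever t is not an atom
(`tendsto_cross_sum_kellererF`). Exchanging the coordinates exchanges E^+ and E^- and settles the
other direction.

Counting the atoms at the boundary points shows that 𝒦(μ,ν) has first marginal μ
(`map_fst_kellererPlan`). The first marginal and the crossing masses determine the masses of all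
quadrants, and convergence on quadrants whose corners are not atoms gives weak convergence
(`tendsto_finiteMeasure_of_quadrants`). -/

/-! ### A Gronwall inequality for measures with atoms -/

theorem tendsto_measure_Ioc_nhdsGT (κ : Measure ℝ) [IsFiniteMeasure κ] (t : ℝ) :
    Tendsto (fun r => κ (Ioc t r)) (𝓝[>] t) (𝓝 0) := by
  have h := tendsto_measure_biInter_gt (μ := κ) (s := fun r : ℝ => Ioc t r) (a := t)
    (fun r _ => measurableSet_Ioc.nullMeasurableSet)
    (fun i j _ hij => Ioc_subset_Ioc_right hij) ⟨t + 1, by simp, measure_ne_top _ _⟩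
  have e : (⋂ r > t, Ioc t r) = ∅ := by
    ext x
    simp only [mem_iInter, mem_Ioc, mem_empty_iff_false, iff_false, not_forall]
    by_cases hx : t < x
    · exact ⟨(t + x) / 2, by simp only [gt_iff_lt]; linarith, fun h => by linarith [h.2]⟩
    · exact ⟨t + 1, by simp, fun h => hx h.1⟩
  rw [e, measure_empty] at h
  exact h

theorem tendsto_measure_Ico_nhdsLT (κ : Measure ℝ) [IsFiniteMeasure κ] (t : ℝ) :
    Tendsto (fun r => κ (Ico r t)) (𝓝[<] t) (𝓝 0) := by
  have h := tendsto_measure_Ioc_nhdsGT (κ.map Neg.neg) (-t)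
  have h2 : Tendsto (fun r : ℝ => -r) (𝓝[<] t) (𝓝[>] (-t)) := tendsto_neg_nhdsLT
  refine (h.comp h2).congr fun r => ?_
  rw [Function.comp_apply, Measure.map_apply measurable_neg measurableSet_Ioc]
  congr 1
  ext x
  simp

/-- `C` bounds, up to the factor `δ`, every bounded function `u` on `[s, r]` with
`u ≤ δ + ∫_{[s, ·)} u dκ`. -/
def GronwallBound (κ : Measure ℝ) (s r : ℝ) (C : ℝ≥0∞) : Prop :=
  ∀ (u : ℝ → ℝ≥0∞) (δ : ℝ≥0∞), (∃ B ≠ ∞, ∀ x ∈ Icc s r, u x ≤ B) →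
    (∀ x ∈ Icc s r, u x ≤ δ + ∫⁻ y in Ico s x, u y ∂κ) → ∀ x ∈ Icc s r, u x ≤ C * δ

/-- The atom of κ at `r'` may be large, since `u r'` is already bounded by `C * δ`. On `Ioc r' r`
the supremum satisfies `S ≤ A + S / 2`, whence `S ≤ 2 * A`. -/
theorem GronwallBound.extend {κ : Measure ℝ} {s r' r : ℝ} {C : ℝ≥0∞}
    (h : GronwallBound κ s r' C) (hs : s ≤ r') (hr : r' ≤ r) (hκ : κ (Ioo r' r) ≤ 2⁻¹) :
    GronwallBound κ s r (C + 2 * (1 + C * κ univ)) := by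
  intro u δ hB hu
  obtain ⟨B, hB, huB⟩ := hB
  have h1 : ∀ x ∈ Icc s r', u x ≤ C * δ :=
    h u δ ⟨B, hB, fun x hx => huB x ⟨hx.1, hx.2.trans hr⟩⟩
      fun x hx => hu x ⟨hx.1, hx.2.trans hr⟩
  set S : ℝ≥0∞ := ⨆ x ∈ Ioc r' r, u x with hS
  have hSB : S ≤ B := iSup₂_le fun x hx => huB x ⟨hs.trans hx.1.le, hx.2⟩
  have hSt : S ≠ ∞ := ne_top_of_le_ne_top hB hSB
  set A : ℝ≥0∞ := δ + C * δ * κ univ with hA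
  have hSA : S ≤ A + S * 2⁻¹ := by
    refine iSup₂_le fun x hx => ?_
    have hx' : x ∈ Icc s r := ⟨hs.trans hx.1.le, hx.2⟩
    have hsplit : Ico s x = Icc s r' ∪ Ioo r' x := by
      ext y
      simp only [mem_Ico, mem_union, mem_Icc, mem_Ioo]
      constructor
      · rintro ⟨h1, h2⟩
        rcases le_or_gt y r' with h | h
        · exact Or.inl ⟨h1, h⟩
        · exact Or.inr ⟨h, h2⟩
      · rintro (⟨h1, h2⟩ | ⟨h1, h2⟩)
        · exact ⟨h1, h2.trans_lt hx.1⟩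
        · exact ⟨hs.trans h1.le, h2⟩
    calc u x ≤ δ + ∫⁻ y in Ico s x, u y ∂κ := hu x hx'
      _ ≤ δ + (∫⁻ y in Icc s r', u y ∂κ + ∫⁻ y in Ioo r' x, u y ∂κ) := by
          rw [hsplit]; gcongr; exact lintegral_union_le _ _ _
      _ ≤ δ + (C * δ * κ univ + S * 2⁻¹) := by
          gcongr
          · calc ∫⁻ y in Icc s r', u y ∂κ ≤ ∫⁻ _ in Icc s r', C * δ ∂κ :=
                  setLIntegral_mono' measurableSet_Icc h1
              _ = C * δ * κ (Icc s r') := by simp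
              _ ≤ _ := by gcongr; simp
          · calc ∫⁻ y in Ioo r' x, u y ∂κ ≤ ∫⁻ _ in Ioo r' x, S ∂κ :=
                  setLIntegral_mono' measurableSet_Ioo fun y hy =>
                    le_iSup₂_of_le y ⟨hy.1, hy.2.le.trans hx.2⟩ le_rfl
              _ = S * κ (Ioo r' x) := by simp
              _ ≤ S * κ (Ioo r' r) := by gcongr; exact hx.2
              _ ≤ _ := by gcongr
      _ = A + S * 2⁻¹ := by rw [hA, add_assoc]
  have hS2 : S ≤ 2 * A := by
    have h2 : S * 2⁻¹ + S * 2⁻¹ = S := by rw [← mul_add, ENNReal.inv_two_add_inv_two, mul_one]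
    -- Cancelling needs `S` finite; this is why `GronwallBound` asks for bounded functions.
    have h3 : S * 2⁻¹ ≤ A := by
      have : S * 2⁻¹ + S * 2⁻¹ ≤ A + S * 2⁻¹ := by rwa [h2]
      exact (ENNReal.add_le_add_iff_right (ENNReal.mul_ne_top hSt (by simp))).1 this
    calc S = S * 2⁻¹ + S * 2⁻¹ := h2.symm
      _ ≤ A + A := by gcongr
      _ = 2 * A := (two_mul A).symm
  intro x hx
  rcases le_or_gt x r' with hxr | hxr
  · refine (h1 x ⟨hx.1, hxr⟩).trans ?_
    gcongr
    exact le_self_add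
  · calc u x ≤ S := le_iSup₂_of_le x ⟨hxr, hx.2⟩ le_rfl
      _ ≤ 2 * A := hS2
      _ = 2 * (1 + C * κ univ) * δ := by rw [hA]; ring
      _ ≤ _ := by gcongr; exact le_add_self

/-- A continuation argument: the set of reachable end points contains its supremum, and a supremum
below `t` could be passed. Every point has punctured one-sided neighbourhoods of mass below 1/2, and
`GronwallBound.extend` asks for no more. -/
theorem exists_gronwallBound (κ : Measure ℝ) [IsFiniteMeasure κ] {s t : ℝ} (hst : s ≤ t) :
    ∃ C ≠ ∞, GronwallBound κ s t C := by
  set S : Set ℝ := {r | r ∈ Icc s t ∧ ∃ C ≠ ∞, GronwallBound κ s r C} with hS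
  have hsS : s ∈ S := by
    refine ⟨⟨le_rfl, hst⟩, 1, by simp, fun u δ _ hu x hx => ?_⟩
    obtain rfl : x = s := le_antisymm hx.2 hx.1
    simpa using hu x hx
  have hbdd : BddAbove S := ⟨t, fun r hr => hr.1.2⟩
  have hext : ∀ r' ∈ S, ∀ r, r' ≤ r → r ≤ t → κ (Ioo r' r) ≤ 2⁻¹ → r ∈ S := by
    rintro r' ⟨hr', C, hC, hb⟩ r hr hrt hκ
    refine ⟨⟨hr'.1.trans hr, hrt⟩, _, ?_, hb.extend hr'.1 hr hκ⟩
    finiteness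
  set m := sSup S with hm
  have hsm : s ≤ m := le_csSup hbdd hsS
  have hmt : m ≤ t := csSup_le ⟨s, hsS⟩ fun r hr => hr.1.2
  have hmS : m ∈ S := by
    rcases hsm.eq_or_lt with h | h
    · rwa [← h]
    have h1 : ∀ᶠ r in 𝓝[<] m, κ (Ico r m) < 2⁻¹ :=
      (tendsto_measure_Ico_nhdsLT κ m).eventually_lt_const (by simp)
    have h2 : ∀ᶠ r in 𝓝[<] m, r < m := self_mem_nhdsWithin
    obtain ⟨r0, hr0, hr0m⟩ := (h1.and h2).exists
    obtain ⟨r', hr', hlt⟩ := exists_lt_of_lt_csSup ⟨s, hsS⟩ hr0m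
    refine hext r' hr' m (le_csSup hbdd hr') hmt ?_
    exact (measure_mono fun x (hx : x ∈ Ioo r' m) =>
      (⟨(hlt.trans hx.1).le, hx.2⟩ : x ∈ Ico r0 m)).trans hr0.le
  rcases hmt.eq_or_lt with h | h
  · rw [← h]; exact hmS.2
  exfalso
  have h1 : ∀ᶠ r in 𝓝[>] m, κ (Ioc m r) < 2⁻¹ :=
    (tendsto_measure_Ioc_nhdsGT κ m).eventually_lt_const (by simp)
  have h2 : ∀ᶠ r in 𝓝[>] m, r ∈ Ioc m t := Ioc_mem_nhdsGT h
  obtain ⟨r, hr, hrm, hrt⟩ := (h1.and h2).exists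
  have := le_csSup hbdd (hext m hmS r hrm.le hrt
    ((measure_mono Ioo_subset_Ioc_self).trans hr.le))
  exact absurd hrm (not_lt.2 this)

/-! ### Linear integral equations with respect to a measure with atoms -/

/-- `g` is a positive solution of `dg = (g / c) dμ` on `I`. -/
structure FlowSolution (μ : Measure ℝ) (I : Set ℝ) (g c : ℝ → ℝ) : Prop where
  measurable_left : Measurable g
  measurable_right : Measurable c
  pos : ∀ t ∈ I, 0 < g t
  mono : MonotoneOn g I
  eq : ∀ s ∈ I, ∀ t ∈ I, s ≤ t → g t = g s + ∫ x in Ico s t, g x / c x ∂μ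

theorem FlowSolution.mono_set {μ : Measure ℝ} {I J : Set ℝ} {g c : ℝ → ℝ}
    (h : FlowSolution μ I g c) (hJ : J ⊆ I) : FlowSolution μ J g c where
  measurable_left := h.measurable_left
  measurable_right := h.measurable_right
  pos t ht := h.pos t (hJ ht)
  mono := h.mono.mono hJ
  eq s hs t ht hst := h.eq s (hJ hs) t (hJ ht) hst

/-- Stability of the linear equation, with a constant that depends only on μ, `s`, `t` and `d₀`. The
equation is homogeneous, so only ratios of values of `g` can be controlled by the coefficient. -/
theorem FlowSolution.exists_enorm_sub_le (μ : Measure ℝ) [IsFiniteMeasure μ] {s t d₀ : ℝ}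
    (hst : s ≤ t) (hd₀ : 0 < d₀) :
    ∃ C ≠ ∞, ∀ g₁ c₁ g₂ c₂ : ℝ → ℝ, FlowSolution μ (Icc s t) g₁ c₁ →
      FlowSolution μ (Icc s t) g₂ c₂ → (∀ x ∈ Icc s t, d₀ ≤ c₁ x) →
      (∀ x ∈ Icc s t, d₀ ≤ c₂ x) →
      ‖g₁ t / g₁ s - g₂ t / g₂ s‖ₑ ≤
        C * ∫⁻ x in Ico s t, ‖(c₁ x)⁻¹ - (c₂ x)⁻¹‖ₑ ∂μ := by
  set κ : Measure ℝ := ENNReal.ofReal d₀⁻¹ • μ with hκ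
  have : IsFiniteMeasure κ := Measure.smul_finite μ (by simp)
  obtain ⟨C, hC, hCb⟩ := exists_gronwallBound κ hst
  have hs : s ∈ Icc s t := ⟨le_rfl, hst⟩
  have ht : t ∈ Icc s t := ⟨hst, le_rfl⟩
  have hIco : ∀ r ∈ Icc s t, Ico s r ⊆ Icc s t := fun r hr x hx => ⟨hx.1, hx.2.le.trans hr.2⟩
  have hlint : ∀ (r : ℝ) (u : ℝ → ℝ≥0∞), ∫⁻ x in Ico s r, u x ∂κ =
      ENNReal.ofReal d₀⁻¹ * ∫⁻ x in Ico s r, u x ∂μ := by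
    intro r u
    rw [hκ, Measure.restrict_smul, lintegral_smul_measure, smul_eq_mul]
  have hinv : ∀ c : ℝ → ℝ, (∀ x ∈ Icc s t, d₀ ≤ c x) → ∀ x ∈ Icc s t,
      ‖(c x)⁻¹‖ₑ ≤ ENNReal.ofReal d₀⁻¹ := by
    intro c hc x hx
    have h0 : 0 < c x := hd₀.trans_le (hc x hx)
    rw [Real.enorm_eq_ofReal (inv_nonneg.2 h0.le)]
    exact ENNReal.ofReal_le_ofReal (inv_anti₀ hd₀ (hc x hx))
  have heq : ∀ g c : ℝ → ℝ, FlowSolution μ (Icc s t) g c → ∀ r ∈ Icc s t,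
      g r / g s = 1 + ∫ x in Ico s r, g x / g s * (c x)⁻¹ ∂μ := by
    intro g c h r hr
    have h0 := (h.pos s hs).ne'
    rw [h.eq s hs r hr hr.1, add_div, div_self h0, ← integral_div]
    congr 1
    refine integral_congr_ae (Eventually.of_forall fun x => ?_)
    simp only [div_eq_mul_inv]; ring
  have hnn : ∀ g c : ℝ → ℝ, FlowSolution μ (Icc s t) g c → ∀ r ∈ Icc s t,
      ‖g r / g s‖ₑ ≤ ‖g t / g s‖ₑ := by
    intro g c h r hr
    have h0 := h.pos s hs
    rw [Real.enorm_eq_ofReal (div_nonneg (h.pos r hr).le h0.le),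
      Real.enorm_eq_ofReal (div_nonneg (h.pos t ht).le h0.le)]
    exact ENNReal.ofReal_le_ofReal (div_le_div_of_nonneg_right (h.mono hr ht hr.2) h0.le)
  have hbd : ∀ g c : ℝ → ℝ, FlowSolution μ (Icc s t) g c → (∀ x ∈ Icc s t, d₀ ≤ c x) →
      ∀ r ∈ Icc s t, ‖g r / g s‖ₑ ≤ C := by
    intro g c h hc r hr
    have := hCb (fun x => ‖g x / g s‖ₑ) 1 ⟨_, enorm_ne_top, hnn g c h⟩ ?_ r hr
    · simpa using this
    intro x hx
    rw [heq g c h x hx, hlint, ← lintegral_const_mul' _ _ (by simp)]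
    refine (enorm_add_le _ _).trans ?_
    gcongr
    · simp
    refine (enorm_integral_le_lintegral_enorm _).trans ?_
    refine setLIntegral_mono' measurableSet_Ico fun y hy => ?_
    rw [enorm_mul, mul_comm]
    gcongr
    exact hinv c hc y (hIco x hx hy)
  have hint : ∀ g c : ℝ → ℝ, FlowSolution μ (Icc s t) g c → (∀ x ∈ Icc s t, d₀ ≤ c x) →
      ∀ r ∈ Icc s t, IntegrableOn (fun x => g x / g s * (c x)⁻¹) (Ico s r) μ := by
    intro g c h hc r hr
    have hm : Measurable fun x => g x / g s * (c x)⁻¹ :=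
      (h.measurable_left.div_const _).mul h.measurable_right.inv
    refine ⟨hm.aestronglyMeasurable, ?_⟩
    refine lt_of_le_of_lt (setLIntegral_mono' (g := fun _ => C * ENNReal.ofReal d₀⁻¹)
      measurableSet_Ico fun y hy => ?_) ?_
    · rw [enorm_mul]
      gcongr
      · exact hbd g c h hc y (hIco r hr hy)
      · exact hinv c hc y (hIco r hr hy)
    · simp only [lintegral_const, Measure.restrict_apply, MeasurableSet.univ, univ_inter]
      exact ENNReal.mul_lt_top (ENNReal.mul_lt_top hC.lt_top (by simp)) (measure_lt_top _ _)
  -- One factor `C` bounds the normalised solutions, the other is the Gronwall constant for their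
  -- difference.
  refine ⟨C * C, ENNReal.mul_ne_top hC hC, fun g₁ c₁ g₂ c₂ h₁ h₂ hc₁ hc₂ => ?_⟩
  set Δ := ∫⁻ x in Ico s t, ‖(c₁ x)⁻¹ - (c₂ x)⁻¹‖ₑ ∂μ with hΔ
  have key := hCb (fun x => ‖g₁ x / g₁ s - g₂ x / g₂ s‖ₑ) (C * Δ)
    ⟨C + C, by finiteness, fun x hx => ?_⟩ ?_ t ht
  · rwa [← mul_assoc] at key
  · refine (enorm_sub_le).trans ?_
    gcongr
    · exact hbd g₁ c₁ h₁ hc₁ x hx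
    · exact hbd g₂ c₂ h₂ hc₂ x hx
  · intro r hr
    rw [heq g₁ c₁ h₁ r hr, heq g₂ c₂ h₂ r hr, add_sub_add_left_eq_sub,
      ← integral_sub (hint g₁ c₁ h₁ hc₁ r hr) (hint g₂ c₂ h₂ hc₂ r hr)]
    refine (enorm_integral_le_lintegral_enorm _).trans ?_
    have hpt : ∀ x ∈ Ico s r, ‖g₁ x / g₁ s * (c₁ x)⁻¹ - g₂ x / g₂ s * (c₂ x)⁻¹‖ₑ ≤
        C * ‖(c₁ x)⁻¹ - (c₂ x)⁻¹‖ₑ +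
          ENNReal.ofReal d₀⁻¹ * ‖g₁ x / g₁ s - g₂ x / g₂ s‖ₑ := by
      intro x hx
      have hx' := hIco r hr hx
      have e : g₁ x / g₁ s * (c₁ x)⁻¹ - g₂ x / g₂ s * (c₂ x)⁻¹ =
          g₂ x / g₂ s * ((c₁ x)⁻¹ - (c₂ x)⁻¹) +
            (c₁ x)⁻¹ * (g₁ x / g₁ s - g₂ x / g₂ s) := by ring
      rw [e]
      refine (enorm_add_le _ _).trans ?_
      rw [enorm_mul, enorm_mul]
      gcongr
      · exact hbd g₂ c₂ h₂ hc₂ x hx'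
      · exact hinv c₁ hc₁ x hx'
    refine (setLIntegral_mono' measurableSet_Ico hpt).trans ?_
    have hm : Measurable fun x => C * ‖(c₁ x)⁻¹ - (c₂ x)⁻¹‖ₑ :=
      ((h₁.measurable_right.inv.sub h₂.measurable_right.inv).enorm).const_mul C
    rw [lintegral_add_left hm, lintegral_const_mul' _ _ hC, lintegral_const_mul' _ _ (by simp),
      hlint]
    gcongr
    exact lintegral_mono_set (Ico_subset_Ico_right hr.2)

/-! ### Product form of entropic plans -/

/-- The exponential as an extended nonnegative real. -/
noncomputable def expE (r : ℝ) : ℝ≥0∞ := ENNReal.ofReal (Real.exp r)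

theorem expE_add (r s : ℝ) : expE (r + s) = expE r * expE s := by
  rw [expE, expE, expE, Real.exp_add, ENNReal.ofReal_mul (Real.exp_pos r).le]

theorem expE_zero : expE 0 = 1 := by simp [expE]

theorem expE_ne_top (r : ℝ) : expE r ≠ ∞ := ENNReal.ofReal_ne_top

theorem expE_mono : Monotone expE := fun _ _ h =>
  ENNReal.ofReal_le_ofReal (Real.exp_le_exp.2 h)

theorem measurable_expE : Measurable expE := Real.measurable_exp.ennreal_ofReal

/-- `e^{x/ε} a(x) μ(dx)`. -/
noncomputable def tiltUp (ε : ℝ) (μ : Measure ℝ) (a : ℝ → ℝ≥0) : Measure ℝ :=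
  μ.withDensity fun x => expE (x / ε) * a x

/-- `e^{-x/ε} a(x) μ(dx)`. -/
noncomputable def tiltDown (ε : ℝ) (μ : Measure ℝ) (a : ℝ → ℝ≥0) : Measure ℝ :=
  μ.withDensity fun x => expE (-(x / ε)) * a x

instance (ε : ℝ) (μ : Measure ℝ) [SFinite μ] (a : ℝ → ℝ≥0) : SFinite (tiltUp ε μ a) := by
  unfold tiltUp; infer_instance

instance (ε : ℝ) (μ : Measure ℝ) [SFinite μ] (a : ℝ → ℝ≥0) : SFinite (tiltDown ε μ a) := by
  unfold tiltDown; infer_instance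

/-- `π` is the transport plan `e^{-|y-x|/ε} a(x) b(y) μ(dx) ν(dy)` from `μ` to `ν`. -/
structure EntropicFactors (ε : ℝ) (μ ν : Measure ℝ) (π : Measure (ℝ × ℝ)) (a b : ℝ → ℝ≥0) :
    Prop where
  eps_pos : 0 < ε
  marg : π ∈ Marg μ ν
  measurable_left : Measurable a
  measurable_right : Measurable b
  eq : π = (μ.prod ν).withDensity fun p => expE (-|p.2 - p.1| / ε) * (a p.1 * b p.2)

/-- With a reference pair at which `f` does not vanish, invariance under the two-point cycle
expresses `f (x, y)` through `f (x, y₀)` and `f (x₀, y)`. -/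
theorem IsCyclicallyInvariant.exists_entropicFactors {ε : ℝ} {μ ν : Measure ℝ}
    {π : Measure (ℝ × ℝ)} (hε : 0 < ε) (h : IsCyclicallyInvariant ε μ ν π) :
    ∃ a b : ℝ → ℝ≥0, EntropicFactors ε μ ν π a b := by
  obtain ⟨hm, f, hf, hπ, hc⟩ := h
  have hexp : ∀ r : ℝ, expE r = (Real.toNNReal (Real.exp r) : ℝ≥0) := fun r => rfl
  by_cases h0 : ∃ x₀ y₀, f (x₀, y₀) ≠ 0
  · obtain ⟨x₀, y₀, h0⟩ := h0
    refine ⟨fun x => Real.toNNReal (Real.exp (|y₀ - x| / ε)) * f (x, y₀),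
      fun y => Real.toNNReal (Real.exp (|y - x₀| / ε)) * f (x₀, y) /
        (Real.toNNReal (Real.exp (|y₀ - x₀| / ε)) * f (x₀, y₀)), hε, hm, ?_, ?_, ?_⟩
    · fun_prop
    · fun_prop
    · rw [hπ]
      congr 1
      ext ⟨x, y⟩
      rw [hexp, ← ENNReal.coe_mul, ← ENNReal.coe_mul]
      congr 1
      have := hc 1 ![x, x₀] ![y, y₀]
      simp only [Nat.reduceAdd, Fin.prod_univ_two, Fin.isValue, Matrix.cons_val_zero,
        Matrix.cons_val_one, zero_add, Matrix.cons_val_fin_one] at this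
      have e : ((1 : Fin 2) + 1) = 0 := rfl
      rw [e] at this
      simp only [Matrix.cons_val_zero] at this
      apply NNReal.coe_injective
      push_cast
      rw [Real.coe_toNNReal _ (Real.exp_pos _).le, Real.coe_toNNReal _ (Real.exp_pos _).le,
        Real.coe_toNNReal _ (Real.exp_pos _).le, Real.coe_toNNReal _ (Real.exp_pos _).le]
      have h0' : (f (x₀, y₀) : ℝ) ≠ 0 := by exact_mod_cast h0
      have h1 := (Real.exp_pos (|y₀ - x₀| / ε)).ne'
      have h2 := (Real.exp_pos (|y - x| / ε)).ne'
      rw [neg_div, Real.exp_neg]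
      field_simp
      linear_combination this
  · push Not at h0
    refine ⟨0, 0, hε, hm, measurable_const, measurable_const, ?_⟩
    rw [hπ]
    congr 1
    ext ⟨x, y⟩
    simp [h0]

namespace EntropicFactors

variable {ε : ℝ} {μ ν : Measure ℝ} {π : Measure (ℝ × ℝ)} {a b : ℝ → ℝ≥0}

theorem swap [SFinite μ] [SFinite ν] (h : EntropicFactors ε μ ν π a b) :
    EntropicFactors ε ν μ (π.map Prod.swap) b a where
  eps_pos := h.eps_pos
  marg := by
    constructor
    · rw [Measure.map_map measurable_fst measurable_swap]; exact h.marg.2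
    · rw [Measure.map_map measurable_snd measurable_swap]; exact h.marg.1
  measurable_left := h.measurable_right
  measurable_right := h.measurable_left
  eq := by
    have hma := h.measurable_left
    have hmb := h.measurable_right
    have hE := measurable_expE
    ext s hs
    rw [Measure.map_apply measurable_swap hs, h.eq, withDensity_apply _ (measurable_swap hs),
      withDensity_apply _ hs, ← Measure.prod_swap (μ := ν) (ν := μ),
      setLIntegral_map (measurable_swap hs) (by fun_prop) measurable_swap, ← preimage_comp,
      Prod.swap_swap_eq, preimage_id]
    refine setLIntegral_congr_fun hs fun p _ => ?_
    simp only [Prod.snd_swap, Prod.fst_swap]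
    rw [abs_sub_comm, mul_comm (a p.2 : ℝ≥0∞)]

theorem measure_fst (h : EntropicFactors ε μ ν π a b) {A : Set ℝ} (hA : MeasurableSet A) :
    π (A ×ˢ univ) = μ A := by
  rw [← h.marg.1, Measure.map_apply measurable_fst hA, prod_univ]

theorem measure_snd (h : EntropicFactors ε μ ν π a b) {B : Set ℝ} (hB : MeasurableSet B) :
    π (univ ×ˢ B) = ν B := by
  rw [← h.marg.2, Measure.map_apply measurable_snd hB, univ_prod]

theorem measure_univ (h : EntropicFactors ε μ ν π a b) : π univ = μ univ := by
  rw [← h.measure_fst MeasurableSet.univ, univ_prod_univ]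

variable [SFinite ν]

/-- On {x ≤ y} the kernel is e^{x/ε} e^{-y/ε}, so `π` is a product there for every ε. -/
theorem apply_prod_of_le (h : EntropicFactors ε μ ν π a b) {A B : Set ℝ} (hA : MeasurableSet A)
    (hB : MeasurableSet B) (hAB : ∀ x ∈ A, ∀ y ∈ B, x ≤ y) :
    π (A ×ˢ B) = tiltUp ε μ a A * tiltDown ε ν b B := by
  have hma := h.measurable_left
  have hmb := h.measurable_right
  have hE := measurable_expE
  rw [← Measure.prod_prod, tiltUp, tiltDown, prod_withDensity (by fun_prop) (by fun_prop), h.eq,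
    withDensity_apply _ (hA.prod hB), withDensity_apply _ (hA.prod hB)]
  refine setLIntegral_congr_fun (hA.prod hB) fun p hp => ?_
  have := hAB p.1 hp.1 p.2 hp.2
  have e : -|p.2 - p.1| / ε = p.1 / ε + -(p.2 / ε) := by
    rw [abs_of_nonneg (by linarith)]; ring
  simp only [e, expE_add]
  ring

theorem apply_prod_of_ge [SFinite μ] (h : EntropicFactors ε μ ν π a b) {A B : Set ℝ}
    (hA : MeasurableSet A)
    (hB : MeasurableSet B) (hAB : ∀ x ∈ A, ∀ y ∈ B, y ≤ x) :
    π (A ×ˢ B) = tiltDown ε μ a A * tiltUp ε ν b B := by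
  have := h.swap.apply_prod_of_le hB hA fun y hy x hx => hAB x hx y hy
  rw [Measure.map_apply measurable_swap (hB.prod hA), preimage_swap_prod] at this
  rw [this, mul_comm]

/-- A product of two tilted measures is controlled by `π` on products where the exponents
compare. -/
theorem tiltUp_mul_tiltUp_le (h : EntropicFactors ε μ ν π a b) {A B : Set ℝ}
    (hA : MeasurableSet A) (hB : MeasurableSet B) {t κ : ℝ}
    (hAB : ∀ x ∈ A, ∀ y ∈ B, x + y - 2 * t ≤ -|y - x| + κ) :
    tiltUp ε μ a A * tiltUp ε ν b B * expE (-(2 * t / ε)) ≤ expE (κ / ε) * π (A ×ˢ B) := by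
  have hma := h.measurable_left
  have hmb := h.measurable_right
  have hE := measurable_expE
  rw [← Measure.prod_prod, tiltUp, tiltUp, prod_withDensity (by fun_prop) (by fun_prop), h.eq,
    withDensity_apply _ (hA.prod hB), withDensity_apply _ (hA.prod hB),
    ← lintegral_mul_const' _ _ (expE_ne_top _), ← lintegral_const_mul' _ _ (expE_ne_top _)]
  refine setLIntegral_mono' (hA.prod hB) fun p hp => ?_
  have h1 : expE (p.1 / ε) * expE (p.2 / ε) * expE (-(2 * t / ε)) ≤
      expE (κ / ε) * expE (-|p.2 - p.1| / ε) := by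
    rw [← expE_add, ← expE_add, ← expE_add]
    apply expE_mono
    have := div_le_div_of_nonneg_right (hAB p.1 hp.1 p.2 hp.2) h.eps_pos.le
    calc _ = (p.1 + p.2 - 2 * t) / ε := by ring
      _ ≤ _ := this
      _ = _ := by ring
  calc _ = expE (p.1 / ε) * expE (p.2 / ε) * expE (-(2 * t / ε)) * (a p.1 * b p.2) := by ring
    _ ≤ expE (κ / ε) * expE (-|p.2 - p.1| / ε) * (a p.1 * b p.2) := by gcongr
    _ = _ := by ring

theorem tiltDown_mul_tiltDown_le (h : EntropicFactors ε μ ν π a b) {A B : Set ℝ}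
    (hA : MeasurableSet A) (hB : MeasurableSet B) {t κ : ℝ}
    (hAB : ∀ x ∈ A, ∀ y ∈ B, 2 * t - x - y ≤ -|y - x| + κ) :
    tiltDown ε μ a A * tiltDown ε ν b B * expE (2 * t / ε) ≤ expE (κ / ε) * π (A ×ˢ B) := by
  have hma := h.measurable_left
  have hmb := h.measurable_right
  have hE := measurable_expE
  rw [← Measure.prod_prod, tiltDown, tiltDown, prod_withDensity (by fun_prop) (by fun_prop), h.eq,
    withDensity_apply _ (hA.prod hB), withDensity_apply _ (hA.prod hB),
    ← lintegral_mul_const' _ _ (expE_ne_top _), ← lintegral_const_mul' _ _ (expE_ne_top _)]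
  refine setLIntegral_mono' (hA.prod hB) fun p hp => ?_
  have h1 : expE (-(p.1 / ε)) * expE (-(p.2 / ε)) * expE (2 * t / ε) ≤
      expE (κ / ε) * expE (-|p.2 - p.1| / ε) := by
    rw [← expE_add, ← expE_add, ← expE_add]
    apply expE_mono
    have := div_le_div_of_nonneg_right (hAB p.1 hp.1 p.2 hp.2) h.eps_pos.le
    calc _ = (2 * t - p.1 - p.2) / ε := by ring
      _ ≤ _ := this
      _ = _ := by ring
  calc _ = expE (-(p.1 / ε)) * expE (-(p.2 / ε)) * expE (2 * t / ε) * (a p.1 * b p.2) := by ring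
    _ ≤ expE (κ / ε) * expE (-|p.2 - p.1| / ε) * (a p.1 * b p.2) := by gcongr
    _ = _ := by ring

/-- As x + y + |y - x| = 2 max(x, y), the left side is the integral of e^{2(max(x,y)-t)/ε} against
`π` over x, y < t. The integrand is at most e^{-2δ/ε} when both points lie below t - δ, and at most
1 on the remaining strips, whose mass the marginals control. -/
theorem leftRemainder_le (h : EntropicFactors ε μ ν π a b) (t : ℝ) {δ : ℝ} (hδ : 0 < δ) :
    tiltUp ε μ a (Iio t) * tiltUp ε ν b (Iio t) * expE (-(2 * t / ε)) ≤
      expE (-(2 * δ) / ε) * μ univ + μ (Ico (t - δ) t) + ν (Ico (t - δ) t) := by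
  have hab : ∀ x y : ℝ, x < t → y < t → x + y - 2 * t ≤ -|y - x| + 0 := by
    intro x y hx hy
    rcases abs_cases (y - x) with h | h <;> linarith
  have h1 : tiltUp ε μ a (Iio (t - δ)) * tiltUp ε ν b (Iio (t - δ)) * expE (-(2 * t / ε)) ≤
      expE (-(2 * δ) / ε) * μ univ := by
    refine (h.tiltUp_mul_tiltUp_le measurableSet_Iio measurableSet_Iio (κ := -(2 * δ))
      fun x hx y hy => ?_).trans ?_
    · rw [mem_Iio] at hx hy
      rcases abs_cases (y - x) with h | h <;> linarith
    · rw [← h.measure_univ]; gcongr; simp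
  have h2 : tiltUp ε μ a (Ico (t - δ) t) * tiltUp ε ν b (Iio t) * expE (-(2 * t / ε)) ≤
      μ (Ico (t - δ) t) := by
    refine (h.tiltUp_mul_tiltUp_le measurableSet_Ico measurableSet_Iio (κ := 0)
      fun x hx y hy => hab x y hx.2 hy).trans ?_
    rw [zero_div, expE_zero, one_mul, ← h.measure_fst measurableSet_Ico]
    gcongr; simp
  have h3 : tiltUp ε μ a (Iio t) * tiltUp ε ν b (Ico (t - δ) t) * expE (-(2 * t / ε)) ≤
      ν (Ico (t - δ) t) := by
    refine (h.tiltUp_mul_tiltUp_le measurableSet_Iio measurableSet_Ico (κ := 0)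
      fun x hx y hy => hab x y hx hy.2).trans ?_
    rw [zero_div, expE_zero, one_mul, ← h.measure_snd measurableSet_Ico]
    gcongr; simp
  have hI : Iio t = Iio (t - δ) ∪ Ico (t - δ) t := (Iio_union_Ico_eq_Iio (by linarith)).symm
  have hle : ∀ m : Measure ℝ, m (Iio t) ≤ m (Iio (t - δ)) + m (Ico (t - δ) t) := fun m => by
    conv_lhs => rw [hI]
    exact measure_union_le _ _
  calc _ ≤ (tiltUp ε μ a (Iio (t - δ)) * tiltUp ε ν b (Iio (t - δ)) +
        tiltUp ε μ a (Ico (t - δ) t) * tiltUp ε ν b (Iio t) +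
        tiltUp ε μ a (Iio t) * tiltUp ε ν b (Ico (t - δ) t)) * expE (-(2 * t / ε)) := by
        gcongr
        calc _ ≤ (tiltUp ε μ a (Iio (t - δ)) + tiltUp ε μ a (Ico (t - δ) t)) *
              tiltUp ε ν b (Iio t) := by gcongr; exact hle _
          _ ≤ tiltUp ε μ a (Iio (t - δ)) * (tiltUp ε ν b (Iio (t - δ)) +
              tiltUp ε ν b (Ico (t - δ) t)) +
              tiltUp ε μ a (Ico (t - δ) t) * tiltUp ε ν b (Iio t) := by
              rw [add_mul]; gcongr; exact hle _
          _ = tiltUp ε μ a (Iio (t - δ)) * tiltUp ε ν b (Iio (t - δ)) +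
              tiltUp ε μ a (Ico (t - δ) t) * tiltUp ε ν b (Iio t) +
              tiltUp ε μ a (Iio (t - δ)) * tiltUp ε ν b (Ico (t - δ) t) := by ring
          _ ≤ _ := by gcongr; linarith
    _ ≤ _ := by rw [add_mul, add_mul]; gcongr

theorem rightRemainder_le (h : EntropicFactors ε μ ν π a b) (t : ℝ) {δ : ℝ} (hδ : 0 < δ) :
    tiltDown ε μ a (Ioi t) * tiltDown ε ν b (Ioi t) * expE (2 * t / ε) ≤
      expE (-(2 * δ) / ε) * μ univ + μ (Ioc t (t + δ)) + ν (Ioc t (t + δ)) := by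
  have hab : ∀ x y : ℝ, t < x → t < y → 2 * t - x - y ≤ -|y - x| + 0 := by
    intro x y hx hy
    rcases abs_cases (y - x) with h | h <;> linarith
  have h1 : tiltDown ε μ a (Ioi (t + δ)) * tiltDown ε ν b (Ioi (t + δ)) * expE (2 * t / ε) ≤
      expE (-(2 * δ) / ε) * μ univ := by
    refine (h.tiltDown_mul_tiltDown_le measurableSet_Ioi measurableSet_Ioi (κ := -(2 * δ))
      fun x hx y hy => ?_).trans ?_
    · rw [mem_Ioi] at hx hy
      rcases abs_cases (y - x) with h | h <;> linarith
    · rw [← h.measure_univ]; gcongr; simp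
  have h2 : tiltDown ε μ a (Ioc t (t + δ)) * tiltDown ε ν b (Ioi t) * expE (2 * t / ε) ≤
      μ (Ioc t (t + δ)) := by
    refine (h.tiltDown_mul_tiltDown_le measurableSet_Ioc measurableSet_Ioi (κ := 0)
      fun x hx y hy => hab x y hx.1 hy).trans ?_
    rw [zero_div, expE_zero, one_mul, ← h.measure_fst measurableSet_Ioc]
    gcongr; simp
  have h3 : tiltDown ε μ a (Ioi t) * tiltDown ε ν b (Ioc t (t + δ)) * expE (2 * t / ε) ≤
      ν (Ioc t (t + δ)) := by
    refine (h.tiltDown_mul_tiltDown_le measurableSet_Ioi measurableSet_Ioc (κ := 0)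
      fun x hx y hy => hab x y hx hy.1).trans ?_
    rw [zero_div, expE_zero, one_mul, ← h.measure_snd measurableSet_Ioc]
    gcongr; simp
  have hI : Ioi t = Ioi (t + δ) ∪ Ioc t (t + δ) := by
    rw [union_comm, Ioc_union_Ioi_eq_Ioi (by linarith)]
  have hle : ∀ m : Measure ℝ, m (Ioi t) ≤ m (Ioi (t + δ)) + m (Ioc t (t + δ)) := fun m => by
    conv_lhs => rw [hI]
    exact measure_union_le _ _
  calc _ ≤ (tiltDown ε μ a (Ioi (t + δ)) * tiltDown ε ν b (Ioi (t + δ)) +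
        tiltDown ε μ a (Ioc t (t + δ)) * tiltDown ε ν b (Ioi t) +
        tiltDown ε μ a (Ioi t) * tiltDown ε ν b (Ioc t (t + δ))) * expE (2 * t / ε) := by
        gcongr
        calc _ ≤ (tiltDown ε μ a (Ioi (t + δ)) + tiltDown ε μ a (Ioc t (t + δ))) *
              tiltDown ε ν b (Ioi t) := by gcongr; exact hle _
          _ ≤ tiltDown ε μ a (Ioi (t + δ)) * (tiltDown ε ν b (Ioi (t + δ)) +
              tiltDown ε ν b (Ioc t (t + δ))) +
              tiltDown ε μ a (Ioc t (t + δ)) * tiltDown ε ν b (Ioi t) := by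
              rw [add_mul]; gcongr; exact hle _
          _ = tiltDown ε μ a (Ioi (t + δ)) * tiltDown ε ν b (Ioi (t + δ)) +
              tiltDown ε μ a (Ioc t (t + δ)) * tiltDown ε ν b (Ioi t) +
              tiltDown ε μ a (Ioi (t + δ)) * tiltDown ε ν b (Ioc t (t + δ)) := by ring
          _ ≤ _ := by gcongr; linarith
    _ ≤ _ := by rw [add_mul, add_mul]; gcongr

/-- The product of the flows through `t` in both directions. -/
theorem cross_mul_cross_le [SFinite μ] (h : EntropicFactors ε μ ν π a b) (t : ℝ) :
    π (Iio t ×ˢ Ici t) * π (Ici t ×ˢ Iio t) ≤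
      tiltUp ε μ a (Iio t) * tiltUp ε ν b (Iio t) * expE (-(2 * t / ε)) * μ univ := by
  rw [h.apply_prod_of_le measurableSet_Iio measurableSet_Ici fun x hx y hy => (hx.trans_le hy).le,
    h.apply_prod_of_ge measurableSet_Ici measurableSet_Iio fun x hx y hy => (hy.trans_le hx).le]
  -- The four tilted masses are regrouped by the side of `t` on which they live; the pair on the
  -- right costs at most the total mass.
  have h1 : tiltDown ε μ a (Ici t) * tiltDown ε ν b (Ici t) * expE (2 * t / ε) ≤ μ univ := by
    refine (h.tiltDown_mul_tiltDown_le measurableSet_Ici measurableSet_Ici (κ := 0)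
      fun x hx y hy => ?_).trans ?_
    · rw [mem_Ici] at hx hy
      rcases abs_cases (y - x) with h | h <;> linarith
    · rw [zero_div, expE_zero, one_mul, ← h.measure_univ]; gcongr; simp
  have h2 : expE (-(2 * t / ε)) * expE (2 * t / ε) = 1 := by
    rw [← expE_add, neg_add_cancel, expE_zero]
  calc _ = tiltUp ε μ a (Iio t) * tiltUp ε ν b (Iio t) *
        (tiltDown ε μ a (Ici t) * tiltDown ε ν b (Ici t)) *
        (expE (-(2 * t / ε)) * expE (2 * t / ε)) := by rw [h2]; ring
    _ = tiltUp ε μ a (Iio t) * tiltUp ε ν b (Iio t) * expE (-(2 * t / ε)) *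
        (tiltDown ε μ a (Ici t) * tiltDown ε ν b (Ici t) * expE (2 * t / ε)) := by ring
    _ ≤ _ := by gcongr

/-- This is the condition that the first marginal has density one with respect to μ; the integral
over y is split at x, where |y - x| changes form. -/
theorem density_mul_left_eq_one [SigmaFinite μ] (h : EntropicFactors ε μ ν π a b) :
    ∀ᵐ x ∂μ, expE (x / ε) * a x *
      (tiltDown ε ν b (Ici x) + expE (-(2 * x / ε)) * tiltUp ε ν b (Iio x)) = 1 := by
  have hma := h.measurable_left
  have hmb := h.measurable_right
  have hE := measurable_expE
  have e : ∀ x, ∫⁻ y, expE (-|y - x| / ε) * (a x * b y) ∂ν = expE (x / ε) * a x *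
      (tiltDown ε ν b (Ici x) + expE (-(2 * x / ε)) * tiltUp ε ν b (Iio x)) := by
    intro x
    rw [← setLIntegral_univ, ← Ici_union_Iio (a := x),
      lintegral_union measurableSet_Iio (by
        rw [disjoint_left]; intro z hz hz'
        simp only [mem_Ici, mem_Iio] at hz hz'; linarith), mul_add,
      tiltUp,
      tiltDown, withDensity_apply _ measurableSet_Iio, withDensity_apply _ measurableSet_Ici,
      ← mul_assoc, ← lintegral_const_mul _ (by fun_prop), ← lintegral_const_mul _ (by fun_prop)]
    congr 1
    · refine setLIntegral_congr_fun measurableSet_Ici fun y hy => ?_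
      rw [mem_Ici] at hy
      have e : -|y - x| / ε = x / ε + -(y / ε) := by
        rw [abs_of_nonneg (by linarith)]; ring
      simp only [e, expE_add]; ring
    · refine setLIntegral_congr_fun measurableSet_Iio fun y hy => ?_
      rw [mem_Iio] at hy
      have e : -|y - x| / ε = x / ε + -(2 * x / ε) + y / ε := by
        rw [abs_of_neg (by linarith)]; ring
      simp only [e, expE_add]; ring
  have hmeas : Measurable fun x => ∫⁻ y, expE (-|y - x| / ε) * (a x * b y) ∂ν :=
    Measurable.lintegral_prod_right' (f := fun p : ℝ × ℝ =>
      expE (-|p.2 - p.1| / ε) * (a p.1 * b p.2)) (by fun_prop)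
  have hden : μ.withDensity (fun x => ∫⁻ y, expE (-|y - x| / ε) * (a x * b y) ∂ν) =
      μ.withDensity 1 := by
    rw [withDensity_one]
    ext s hs
    rw [withDensity_apply _ hs]
    conv_rhs => rw [← h.marg.1, Measure.map_apply measurable_fst hs, h.eq,
      withDensity_apply _ (measurable_fst hs), ← prod_univ, ← Measure.prod_restrict,
      Measure.restrict_univ, lintegral_prod _ (by fun_prop)]
  have := (withDensity_eq_iff_of_sigmaFinite hmeas.aemeasurable measurable_one.aemeasurable).1 hden
  filter_upwards [this] with x hx
  rw [← e, hx, Pi.one_apply]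

theorem density_mul_right_eq_one [SFinite μ] [SigmaFinite ν] (h : EntropicFactors ε μ ν π a b) :
    ∀ᵐ y ∂ν, expE (-(y / ε)) * b y *
      (tiltUp ε μ a (Iic y) + expE (2 * y / ε) * tiltDown ε μ a (Ioi y)) = 1 := by
  have hma := h.measurable_left
  have hmb := h.measurable_right
  have hE := measurable_expE
  have e : ∀ y, ∫⁻ x, expE (-|x - y| / ε) * (b y * a x) ∂μ = expE (-(y / ε)) * b y *
      (tiltUp ε μ a (Iic y) + expE (2 * y / ε) * tiltDown ε μ a (Ioi y)) := by
    intro y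
    rw [← setLIntegral_univ, ← Iic_union_Ioi (a := y),
      lintegral_union measurableSet_Ioi (by
        rw [disjoint_left]; intro z hz hz'
        simp only [mem_Iic, mem_Ioi] at hz hz'; linarith), mul_add,
      tiltUp,
      tiltDown, withDensity_apply _ measurableSet_Ioi, withDensity_apply _ measurableSet_Iic,
      ← mul_assoc, ← lintegral_const_mul _ (by fun_prop), ← lintegral_const_mul _ (by fun_prop)]
    congr 1
    · refine setLIntegral_congr_fun measurableSet_Iic fun x hx => ?_
      rw [mem_Iic] at hx
      have e : -|x - y| / ε = x / ε + -(y / ε) := by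
        rw [abs_of_nonpos (by linarith)]; ring
      simp only [e, expE_add]; ring
    · refine setLIntegral_congr_fun measurableSet_Ioi fun x hx => ?_
      rw [mem_Ioi] at hx
      have e : -|x - y| / ε = -(x / ε) + 2 * y / ε + -(y / ε) := by
        rw [abs_of_pos (by linarith)]; ring
      simp only [e, expE_add]; ring
  have hmeas : Measurable fun y => ∫⁻ x, expE (-|x - y| / ε) * (b y * a x) ∂μ :=
    Measurable.lintegral_prod_right' (f := fun p : ℝ × ℝ =>
      expE (-|p.2 - p.1| / ε) * (b p.1 * a p.2)) (by fun_prop)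
  have hden : ν.withDensity (fun y => ∫⁻ x, expE (-|x - y| / ε) * (b y * a x) ∂μ) =
      ν.withDensity 1 := by
    rw [withDensity_one]
    ext s hs
    rw [withDensity_apply _ hs]
    conv_rhs => rw [← h.swap.marg.1, Measure.map_apply measurable_fst hs, h.swap.eq,
      withDensity_apply _ (measurable_fst hs), ← prod_univ, ← Measure.prod_restrict,
      Measure.restrict_univ, lintegral_prod _ (by fun_prop)]
  have := (withDensity_eq_iff_of_sigmaFinite hmeas.aemeasurable measurable_one.aemeasurable).1 hden
  filter_upwards [this] with x hx
  rw [← e, hx, Pi.one_apply]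

end EntropicFactors

/-! ### Limits of solutions -/

theorem tendsto_lintegral_enorm_inv_sub {ι : Type*} {l : Filter ι} [l.IsCountablyGenerated]
    {μ : Measure ℝ} [IsFiniteMeasure μ] {s t d₀ : ℝ} (hd₀ : 0 < d₀) {c : ι → ℝ → ℝ} {c' : ℝ → ℝ}
    (hm : ∀ᶠ i in l, Measurable (c i)) (hm' : Measurable c')
    (hc : ∀ᶠ i in l, ∀ x ∈ Icc s t, d₀ ≤ c i x) (hc' : ∀ x ∈ Icc s t, d₀ ≤ c' x)
    (hlim : ∀ x ∈ Icc s t, Tendsto (fun i => c i x) l (𝓝 (c' x))) :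
    Tendsto (fun i => ∫⁻ x in Ico s t, ‖(c i x)⁻¹ - (c' x)⁻¹‖ₑ ∂μ) l (𝓝 0) := by
  have hinv : ∀ r : ℝ, d₀ ≤ r → ‖r⁻¹‖ₑ ≤ ENNReal.ofReal d₀⁻¹ := by
    intro r hr
    have h0 : 0 < r := hd₀.trans_le hr
    rw [Real.enorm_eq_ofReal (inv_nonneg.2 h0.le)]
    exact ENNReal.ofReal_le_ofReal (inv_anti₀ hd₀ hr)
  have := tendsto_lintegral_filter_of_dominated_convergence (μ := μ.restrict (Ico s t))
    (l := l) (F := fun i x => ‖(c i x)⁻¹ - (c' x)⁻¹‖ₑ) (f := fun _ => 0)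
    (fun _ => ENNReal.ofReal d₀⁻¹ + ENNReal.ofReal d₀⁻¹) ?_ ?_ ?_ ?_
  · simpa using this
  · filter_upwards [hm] with i hi
    exact (hi.inv.sub hm'.inv).enorm
  · filter_upwards [hc] with i hi
    filter_upwards [ae_restrict_mem measurableSet_Ico] with x hx
    have hx' : x ∈ Icc s t := Ico_subset_Icc_self hx
    exact enorm_sub_le.trans (add_le_add (hinv _ (hi x hx')) (hinv _ (hc' x hx')))
  · simp only [lintegral_const, Measure.restrict_apply, MeasurableSet.univ, univ_inter]
    finiteness
  · filter_upwards [ae_restrict_mem measurableSet_Ico] with x hx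
    have hx' : x ∈ Icc s t := Ico_subset_Icc_self hx
    have h0 : c' x ≠ 0 := (hd₀.trans_le (hc' x hx')).ne'
    have := (((hlim x hx').inv₀ h0).sub_const (c' x)⁻¹).enorm
    simpa using this

/-- Applied to a constant family, this says that the coefficient determines the ratio. -/
theorem FlowSolution.tendsto_ratio {ι : Type*} {l : Filter ι} [l.IsCountablyGenerated]
    {μ : Measure ℝ} [IsFiniteMeasure μ] {s t d₀ : ℝ} (hst : s ≤ t) (hd₀ : 0 < d₀)
    {g c : ι → ℝ → ℝ} {g' c' : ℝ → ℝ}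
    (h : ∀ᶠ i in l, FlowSolution μ (Icc s t) (g i) (c i)) (h' : FlowSolution μ (Icc s t) g' c')
    (hc : ∀ᶠ i in l, ∀ x ∈ Icc s t, d₀ ≤ c i x) (hc' : ∀ x ∈ Icc s t, d₀ ≤ c' x)
    (hlim : ∀ x ∈ Icc s t, Tendsto (fun i => c i x) l (𝓝 (c' x))) :
    Tendsto (fun i => g i t / g i s) l (𝓝 (g' t / g' s)) := by
  obtain ⟨C, hC, hb⟩ := FlowSolution.exists_enorm_sub_le μ hst hd₀
  have hΔ := tendsto_lintegral_enorm_inv_sub (μ := μ) hd₀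
    (h.mono fun i hi => hi.measurable_right) h'.measurable_right hc hc' hlim
  rw [tendsto_iff_edist_tendsto_0]
  have h0 := ENNReal.Tendsto.const_mul hΔ (Or.inr hC)
  rw [mul_zero] at h0
  refine tendsto_of_tendsto_of_tendsto_of_le_of_le' tendsto_const_nhds h0
    (Eventually.of_forall fun _ => zero_le) ?_
  filter_upwards [h, hc] with i hi hci
  rw [edist_eq_enorm_sub]
  exact hb _ _ _ _ hi h' hci hc'

/-- No solution of the limit equation is presupposed. The ratios are Cauchy because two coefficients
of the family can be compared through their common limit `c'`. -/
theorem FlowSolution.exists_tendsto_ratio {ι : Type*} {l : Filter ι} [l.IsCountablyGenerated]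
    [l.NeBot] {μ : Measure ℝ} [IsFiniteMeasure μ] {s t d₀ : ℝ} (hst : s ≤ t) (hd₀ : 0 < d₀)
    {g c : ι → ℝ → ℝ} {c' : ℝ → ℝ}
    (h : ∀ᶠ i in l, FlowSolution μ (Icc s t) (g i) (c i)) (hm' : Measurable c')
    (hc : ∀ᶠ i in l, ∀ x ∈ Icc s t, d₀ ≤ c i x) (hc' : ∀ x ∈ Icc s t, d₀ ≤ c' x)
    (hlim : ∀ x ∈ Icc s t, Tendsto (fun i => c i x) l (𝓝 (c' x))) :
    ∃ ρ : ℝ, 1 ≤ ρ ∧ Tendsto (fun i => g i t / g i s) l (𝓝 ρ) := by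
  obtain ⟨C, hC, hb⟩ := FlowSolution.exists_enorm_sub_le μ hst hd₀
  have hΔ := tendsto_lintegral_enorm_inv_sub (μ := μ) hd₀
    (h.mono fun i hi => hi.measurable_right) hm' hc hc' hlim
  set Δ : ι → ℝ≥0∞ := fun i => ∫⁻ x in Ico s t, ‖(c i x)⁻¹ - (c' x)⁻¹‖ₑ ∂μ with hΔdef
  have hpair : ∀ᶠ p : ι × ι in l ×ˢ l,
      edist (g p.1 t / g p.1 s) (g p.2 t / g p.2 s) ≤ C * (Δ p.1 + Δ p.2) := by
    have h12 := (h.and hc).prod_mk (h.and hc)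
    filter_upwards [h12] with p hp
    obtain ⟨⟨h1, hc1⟩, h2, hc2⟩ := hp
    rw [edist_eq_enorm_sub]
    refine (hb _ _ _ _ h1 h2 hc1 hc2).trans ?_
    gcongr
    change _ ≤ ∫⁻ x in Ico s t, ‖(c p.1 x)⁻¹ - (c' x)⁻¹‖ₑ ∂μ +
      ∫⁻ x in Ico s t, ‖(c p.2 x)⁻¹ - (c' x)⁻¹‖ₑ ∂μ
    have hm1 : Measurable fun x => ‖(c p.1 x)⁻¹ - (c' x)⁻¹‖ₑ :=
      (h1.measurable_right.inv.sub hm'.inv).enorm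
    rw [← lintegral_add_left hm1]
    refine lintegral_mono fun x => ?_
    have e : (c p.1 x)⁻¹ - (c p.2 x)⁻¹ =
      ((c p.1 x)⁻¹ - (c' x)⁻¹) - ((c p.2 x)⁻¹ - (c' x)⁻¹) := by ring
    rw [e]
    exact enorm_sub_le
  have hcau : Cauchy (map (fun i => g i t / g i s) l) := by
    rw [cauchy_map_iff]
    refine ⟨inferInstance, ?_⟩
    rw [uniformity_basis_edist.tendsto_right_iff]
    intro η hη
    have h0 : Tendsto (fun p : ι × ι => C * (Δ p.1 + Δ p.2)) (l ×ˢ l) (𝓝 0) := by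
      have := ENNReal.Tendsto.const_mul ((hΔ.comp tendsto_fst).add (hΔ.comp tendsto_snd))
        (Or.inr hC) (f := l ×ˢ l)
      simpa using this
    filter_upwards [hpair, h0.eventually_lt_const hη] with p hp1 hp2
    exact hp1.trans_lt hp2
  obtain ⟨ρ, hρ⟩ := CompleteSpace.complete hcau
  refine ⟨ρ, ge_of_tendsto hρ ?_, hρ⟩
  filter_upwards [h] with i hi
  have hs : s ∈ Icc s t := ⟨le_rfl, hst⟩
  have ht : t ∈ Icc s t := ⟨hst, le_rfl⟩
  rw [one_le_div (hi.pos s hs)]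
  exact hi.mono hs ht hst

theorem flowSolution_toReal {μ : Measure ℝ} {I : Set ℝ} (hI : OrdConnected I) {G C : ℝ → ℝ≥0∞}
    (hG : Monotone G) (hC : Measurable C) (hG0 : ∀ t ∈ I, G t ≠ 0) (hGt : ∀ t ∈ I, G t ≠ ∞)
    (hC0 : ∀ t ∈ I, C t ≠ 0)
    (heq : ∀ s ∈ I, ∀ t ∈ I, s ≤ t → G t = G s + ∫⁻ x in Ico s t, G x / C x ∂μ) :
    FlowSolution μ I (fun t => (G t).toReal) (fun t => (C t).toReal) where
  measurable_left := hG.measurable.ennreal_toReal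
  measurable_right := hC.ennreal_toReal
  pos t ht := ENNReal.toReal_pos (hG0 t ht) (hGt t ht)
  mono s _ t ht hst := ENNReal.toReal_mono (hGt t ht) (hG hst)
  eq s hs t ht hst := by
    have h1 := heq s hs t ht hst
    have hfin : ∫⁻ x in Ico s t, G x / C x ∂μ ≠ ∞ := by
      intro h
      rw [h, add_top] at h1
      exact hGt t ht h1
    have hm : Measurable fun x => G x / C x := hG.measurable.div hC
    rw [h1, ENNReal.toReal_add (hGt s hs) hfin, ← integral_toReal hm.aemeasurable]
    · simp only [ENNReal.toReal_div]
    · filter_upwards [ae_restrict_mem measurableSet_Ico] with x hx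
      have hxI : x ∈ I := hI.out hs ht (Ico_subset_Icc_self hx)
      exact ENNReal.div_lt_top (hGt x hxI) (hC0 x hxI)

/-! ### The small-noise limit of the flows through a point -/

theorem tendsto_expE_neg_div {δ : ℝ} (hδ : 0 < δ) :
    Tendsto (fun ε : ℝ => expE (-δ / ε)) (𝓝[>] 0) (𝓝 0) := by
  have h1 : Tendsto (fun ε : ℝ => -δ / ε) (𝓝[>] 0) atBot := by
    simp only [div_eq_mul_inv]
    exact (tendsto_inv_nhdsGT_zero).const_mul_atTop_of_neg (by linarith)
  have := ENNReal.tendsto_ofReal (Real.tendsto_exp_atBot.comp h1)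
  simpa [expE] using this

/-- Conservation of mass: `Iio t ×ˢ Iio t` contributes equally to both marginals of `Iio t`, so the
net flow through `t` depends on μ and ν only. -/
theorem Marg.cross_add {μ ν : Measure ℝ} {π : Measure (ℝ × ℝ)} (h : π ∈ Marg μ ν) (t : ℝ) :
    π (Iio t ×ˢ Ici t) + ν (Iio t) = π (Ici t ×ˢ Iio t) + μ (Iio t) := by
  have h1 : μ (Iio t) = π (Iio t ×ˢ Iio t) + π (Iio t ×ˢ Ici t) := by
    rw [← h.1, Measure.map_apply measurable_fst measurableSet_Iio, ← prod_univ,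
      ← Iio_union_Ici (a := t), prod_union, measure_union _
        (measurableSet_Iio.prod measurableSet_Ici)]
    rw [disjoint_left]
    rintro p ⟨-, hp⟩ ⟨-, hp'⟩
    exact (not_lt.2 (mem_Ici.1 hp')) (mem_Iio.1 hp)
  have h2 : ν (Iio t) = π (Iio t ×ˢ Iio t) + π (Ici t ×ˢ Iio t) := by
    rw [← h.2, Measure.map_apply measurable_snd measurableSet_Iio, ← univ_prod,
      ← Iio_union_Ici (a := t), union_prod, measure_union _
        (measurableSet_Ici.prod measurableSet_Iio)]
    rw [disjoint_left]
    rintro p ⟨hp, -⟩ ⟨hp', -⟩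
    exact (not_lt.2 (mem_Ici.1 hp')) (mem_Iio.1 hp)
  rw [h1, h2]; ring

theorem Marg.measure_ne_top {μ ν : Measure ℝ} [IsFiniteMeasure μ]
    {π : Measure (ℝ × ℝ)} (h : π ∈ Marg μ ν) (S : Set (ℝ × ℝ)) :
    π S ≠ ∞ := by
  have h1 : π univ = μ univ := by
    rw [← h.1, Measure.map_apply measurable_fst MeasurableSet.univ, preimage_univ]
  exact ne_top_of_le_ne_top (by rw [h1]; exact MeasureTheory.measure_ne_top _ _)
    (measure_mono (subset_univ S))

section Family

variable {μ ν : Measure ℝ} [IsFiniteMeasure μ] [IsFiniteMeasure ν] {π : ℝ → Measure (ℝ × ℝ)}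
  {a b : ℝ → ℝ → ℝ≥0}

/-- First δ is fixed so that `W δ` is small, then ε tends to zero. -/
theorem tendsto_zero_of_remainder_le {F : ℝ → ℝ≥0∞} {M : ℝ≥0∞} (hM : M ≠ ∞)
    {W : ℝ → ℝ≥0∞} (hW : Tendsto W (𝓝[>] 0) (𝓝 0))
    (hF : ∀ ε > 0, ∀ δ > 0, F ε ≤ expE (-(2 * δ) / ε) * M + W δ) :
    Tendsto F (𝓝[>] 0) (𝓝 0) := by
  rw [ENNReal.tendsto_nhds_zero]
  intro η hη
  have hη2 : 0 < η / 2 := ENNReal.half_pos hη.ne'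
  have h1 := (hW.eventually_lt_const hη2).and self_mem_nhdsWithin
  obtain ⟨δ, hδW, hδ⟩ := h1.exists
  have h2 := ENNReal.Tendsto.mul_const (tendsto_expE_neg_div (δ := 2 * δ) (by linarith))
    (Or.inr hM)
  rw [zero_mul] at h2
  filter_upwards [h2.eventually_lt_const hη2, self_mem_nhdsWithin] with ε hε hε0
  calc F ε ≤ expE (-(2 * δ) / ε) * M + W δ := hF ε hε0 δ hδ
    _ ≤ η / 2 + η / 2 := add_le_add hε.le hδW.le
    _ = η := ENNReal.add_halves η

theorem tendsto_leftRemainder (h : ∀ ε > 0, EntropicFactors ε μ ν (π ε) (a ε) (b ε)) (t : ℝ) :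
    Tendsto (fun ε => tiltUp ε μ (a ε) (Iio t) * tiltUp ε ν (b ε) (Iio t) *
      expE (-(2 * t / ε))) (𝓝[>] 0) (𝓝 0) := by
  have hsub : Tendsto (fun δ : ℝ => t - δ) (𝓝[>] 0) (𝓝[<] t) := by
    refine tendsto_nhdsWithin_iff.2 ⟨?_, ?_⟩
    · have : Tendsto (fun δ : ℝ => t - δ) (𝓝 0) (𝓝 (t - 0)) :=
        tendsto_const_nhds.sub tendsto_id
      rw [sub_zero] at this
      exact this.mono_left nhdsWithin_le_nhds
    · filter_upwards [self_mem_nhdsWithin] with δ hδ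
      rw [mem_Ioi] at hδ
      rw [mem_Iio]; linarith
  have hW := ((tendsto_measure_Ico_nhdsLT μ t).comp hsub).add
    ((tendsto_measure_Ico_nhdsLT ν t).comp hsub)
  rw [add_zero] at hW
  refine tendsto_zero_of_remainder_le (measure_ne_top μ univ) hW fun ε hε δ hδ => ?_
  rw [← add_assoc]
  exact (h ε hε).leftRemainder_le t hδ

theorem tendsto_rightRemainder (h : ∀ ε > 0, EntropicFactors ε μ ν (π ε) (a ε) (b ε)) (t : ℝ) :
    Tendsto (fun ε => tiltDown ε μ (a ε) (Ioi t) * tiltDown ε ν (b ε) (Ioi t) *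
      expE (2 * t / ε)) (𝓝[>] 0) (𝓝 0) := by
  have hadd : Tendsto (fun δ : ℝ => t + δ) (𝓝[>] 0) (𝓝[>] t) := by
    refine tendsto_nhdsWithin_iff.2 ⟨?_, ?_⟩
    · have : Tendsto (fun δ : ℝ => t + δ) (𝓝 0) (𝓝 (t + 0)) :=
        tendsto_const_nhds.add tendsto_id
      rw [add_zero] at this
      exact this.mono_left nhdsWithin_le_nhds
    · filter_upwards [self_mem_nhdsWithin] with δ hδ
      rw [mem_Ioi] at hδ
      rw [mem_Ioi]; linarith
  have hW := ((tendsto_measure_Ioc_nhdsGT μ t).comp hadd).add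
    ((tendsto_measure_Ioc_nhdsGT ν t).comp hadd)
  rw [add_zero] at hW
  refine tendsto_zero_of_remainder_le (measure_ne_top μ univ) hW fun ε hε δ hδ => ?_
  rw [← add_assoc]
  exact (h ε hε).rightRemainder_le t hδ

/-- The flow through `t` from left to right tends to the positive part of the difference of the
distribution functions. -/
theorem tendsto_cross (h : ∀ ε > 0, EntropicFactors ε μ ν (π ε) (a ε) (b ε)) (t : ℝ) :
    Tendsto (fun ε => π ε (Iio t ×ˢ Ici t)) (𝓝[>] 0) (𝓝 (μ (Iio t) - ν (Iio t))) := by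
  set p : ℝ → ℝ := fun ε => (π ε (Iio t ×ˢ Ici t)).toReal with hp
  set n : ℝ → ℝ := fun ε => (π ε (Ici t ×ˢ Iio t)).toReal with hn
  set d : ℝ := (μ (Iio t)).toReal - (ν (Iio t)).toReal with hd
  have hpn : Tendsto (fun ε => p ε * n ε) (𝓝[>] 0) (𝓝 0) := by
    have h1 : Tendsto (fun ε => π ε (Iio t ×ˢ Ici t) * π ε (Ici t ×ˢ Iio t)) (𝓝[>] 0) (𝓝 0) := by
      have h0 := ENNReal.Tendsto.mul_const (tendsto_leftRemainder h t)
        (Or.inr (measure_ne_top μ univ))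
      rw [zero_mul] at h0
      refine tendsto_of_tendsto_of_tendsto_of_le_of_le' tendsto_const_nhds h0
        (Eventually.of_forall fun _ => zero_le) ?_
      filter_upwards [self_mem_nhdsWithin] with ε hε
      exact (h ε hε).cross_mul_cross_le t
    have := (ENNReal.tendsto_toReal ENNReal.zero_ne_top).comp h1
    simpa [Function.comp_def, ENNReal.toReal_mul] using this
  have hsub : ∀ ε > 0, p ε - n ε = d := by
    intro ε hε
    have hm := (h ε hε).marg
    have := congrArg ENNReal.toReal (Marg.cross_add hm t)
    rw [ENNReal.toReal_add (Marg.measure_ne_top hm _) (measure_ne_top _ _),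
      ENNReal.toReal_add (Marg.measure_ne_top hm _) (measure_ne_top _ _)] at this
    simp only [hp, hn, hd]; linarith
  -- `p` is the larger root of X² - dX - pn, hence a continuous function of the product `p * n`,
  -- which tends to 0.
  have hformula : ∀ ε > 0, p ε = (d + Real.sqrt (d ^ 2 + 4 * (p ε * n ε))) / 2 := by
    intro ε hε
    have h0 : 0 ≤ p ε + n ε := add_nonneg ENNReal.toReal_nonneg ENNReal.toReal_nonneg
    have h1 : d ^ 2 + 4 * (p ε * n ε) = (p ε + n ε) ^ 2 := by rw [← hsub ε hε]; ring
    rw [h1, Real.sqrt_sq h0, ← hsub ε hε]; ring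
  have hlim : Tendsto p (𝓝[>] 0) (𝓝 (max d 0)) := by
    have h1 : Tendsto (fun ε => (d + Real.sqrt (d ^ 2 + 4 * (p ε * n ε))) / 2) (𝓝[>] 0)
        (𝓝 ((d + Real.sqrt (d ^ 2 + 4 * 0)) / 2)) :=
      (((hpn.const_mul 4).const_add (d ^ 2)).sqrt.const_add d).div_const 2
    have e : (d + Real.sqrt (d ^ 2 + 4 * 0)) / 2 = max d 0 := by
      rw [mul_zero, add_zero, Real.sqrt_sq_eq_abs]
      rcases le_total 0 d with h0 | h0
      · rw [abs_of_nonneg h0, max_eq_left h0]; ring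
      · rw [abs_of_nonpos h0, max_eq_right h0]; ring
    rw [e] at h1
    refine h1.congr' ?_
    filter_upwards [self_mem_nhdsWithin] with ε hε
    exact (hformula ε hε).symm
  have h2 := ENNReal.tendsto_ofReal hlim
  have e : ENNReal.ofReal (max d 0) = μ (Iio t) - ν (Iio t) := by
    rw [ENNReal.ofReal_max, ENNReal.ofReal_zero, max_eq_left zero_le, hd,
      ENNReal.ofReal_sub _ ENNReal.toReal_nonneg, ENNReal.ofReal_toReal (measure_ne_top _ _),
      ENNReal.ofReal_toReal (measure_ne_top _ _)]
  rw [e] at h2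
  refine h2.congr' ?_
  filter_upwards [self_mem_nhdsWithin] with ε hε
  exact ENNReal.ofReal_toReal (Marg.measure_ne_top (h ε hε).marg _)

end Family

/-! ### The small-noise limit on an interval of strict inequality -/

/-- An open interval on which the distribution function of `μ` exceeds that of `ν`, locally
uniformly. -/
structure IsFlowInterval (μ ν : Measure ℝ) (I : Set ℝ) : Prop where
  ordConnected : OrdConnected I
  isOpen : IsOpen I
  nonempty : I.Nonempty
  exists_le : ∀ s ∈ I, ∀ t ∈ I, ∃ d₀ > 0, ∀ x ∈ Icc s t,
    ENNReal.ofReal d₀ + ν (Iio x) ≤ μ (Iio x)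

theorem IsFlowInterval.lt {μ ν : Measure ℝ} [IsFiniteMeasure ν] {I : Set ℝ}
    (hI : IsFlowInterval μ ν I) {t : ℝ} (ht : t ∈ I) : ν (Iio t) < μ (Iio t) := by
  obtain ⟨d, hd, h⟩ := hI.exists_le t ht t ht
  refine lt_of_lt_of_le ?_ (h t ⟨le_rfl, le_rfl⟩)
  rw [add_comm]
  exact ENNReal.lt_add_right (measure_ne_top _ _) (by simpa using hd)

/-- The part of the density of the flow that multiplies `dμ / dg`. -/
noncomputable def flowCoeff (ε : ℝ) (μ ν : Measure ℝ) (a b : ℝ → ℝ≥0) (x : ℝ) : ℝ≥0∞ :=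
  tiltUp ε μ a (Iio x) *
    (tiltDown ε ν b (Ici x) + expE (-(2 * x / ε)) * tiltUp ε ν b (Iio x))

theorem monotone_measure_Iio (κ : Measure ℝ) : Monotone fun x => κ (Iio x) :=
  fun _ _ h => measure_mono (Iio_subset_Iio h)

theorem antitone_measure_Ici (κ : Measure ℝ) : Antitone fun x => κ (Ici x) :=
  fun _ _ h => measure_mono (Ici_subset_Ici.2 h)

theorem measurable_flowCoeff (ε : ℝ) (μ ν : Measure ℝ) (a b : ℝ → ℝ≥0) :
    Measurable (flowCoeff ε μ ν a b) := by
  have h1 := (monotone_measure_Iio (tiltUp ε μ a)).measurable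
  have h2 := (antitone_measure_Ici (tiltDown ε ν b)).measurable
  have h3 := (monotone_measure_Iio (tiltUp ε ν b)).measurable
  have hE := measurable_expE
  unfold flowCoeff
  fun_prop

namespace EntropicFactors

variable {ε : ℝ} {μ ν : Measure ℝ} {π : Measure (ℝ × ℝ)} {a b : ℝ → ℝ≥0}

theorem cross_eq [SFinite ν] (h : EntropicFactors ε μ ν π a b) {s t : ℝ} (hst : s ≤ t) :
    π (Iio s ×ˢ Ici t) = tiltUp ε μ a (Iio s) * tiltDown ε ν b (Ici t) :=
  h.apply_prod_of_le measurableSet_Iio measurableSet_Ici fun _ hx _ hy =>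
    ((mem_Iio.1 hx).le.trans hst).trans (mem_Ici.1 hy)

theorem sub_le_cross (h : EntropicFactors ε μ ν π a b) (t : ℝ) :
    μ (Iio t) - ν (Iio t) ≤ π (Iio t ×ˢ Ici t) := by
  rw [tsub_le_iff_right, Marg.cross_add h.marg t]
  exact le_add_self

variable [IsFiniteMeasure ν]

/-- The coefficient is a flow plus a remainder that vanishes with ε. This gives both its limit and a
lower bound uniform in ε, the two inputs of the Gronwall estimate. -/
theorem flowCoeff_eq (h : EntropicFactors ε μ ν π a b) (t : ℝ) :
    flowCoeff ε μ ν a b t = π (Iio t ×ˢ Ici t) +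
      tiltUp ε μ a (Iio t) * tiltUp ε ν b (Iio t) * expE (-(2 * t / ε)) := by
  rw [h.cross_eq le_rfl, flowCoeff]; ring

theorem sub_le_flowCoeff (h : EntropicFactors ε μ ν π a b) (t : ℝ) :
    μ (Iio t) - ν (Iio t) ≤ flowCoeff ε μ ν a b t := by
  rw [h.flowCoeff_eq]
  exact (h.sub_le_cross t).trans le_self_add

theorem cross_pos (h : EntropicFactors ε μ ν π a b) {t : ℝ}
    (ht : ν (Iio t) < μ (Iio t)) : 0 < tiltUp ε μ a (Iio t) * tiltDown ε ν b (Ici t) := by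
  rw [← h.cross_eq le_rfl]
  exact (tsub_pos_of_lt ht).trans_le (h.sub_le_cross t)

theorem tiltUp_Iio_ne_zero (h : EntropicFactors ε μ ν π a b) {t : ℝ}
    (ht : ν (Iio t) < μ (Iio t)) : tiltUp ε μ a (Iio t) ≠ 0 :=
  left_ne_zero_of_mul (h.cross_pos ht).ne'

theorem tiltDown_Ici_ne_zero (h : EntropicFactors ε μ ν π a b) {t : ℝ}
    (ht : ν (Iio t) < μ (Iio t)) : tiltDown ε ν b (Ici t) ≠ 0 :=
  right_ne_zero_of_mul (h.cross_pos ht).ne'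

theorem flowCoeff_ne_zero (h : EntropicFactors ε μ ν π a b) {t : ℝ}
    (ht : ν (Iio t) < μ (Iio t)) : flowCoeff ε μ ν a b t ≠ 0 :=
  ((tsub_pos_of_lt ht).trans_le (h.sub_le_flowCoeff t)).ne'

variable [IsFiniteMeasure μ]

theorem flowCoeff_ne_top (h : EntropicFactors ε μ ν π a b) (t : ℝ) :
    flowCoeff ε μ ν a b t ≠ ∞ := by
  rw [h.flowCoeff_eq]
  refine ENNReal.add_ne_top.2 ⟨Marg.measure_ne_top h.marg _,
    ne_top_of_le_ne_top ?_ (h.leftRemainder_le t one_pos)⟩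
  have := expE_ne_top (-(2 * 1) / ε)
  finiteness

/-- The product with `tiltDown ε ν b (Ici t)` is a finite mass, and that second factor is not zero.
-/
theorem tiltUp_Iio_ne_top (h : EntropicFactors ε μ ν π a b) {t : ℝ}
    (ht : ν (Iio t) < μ (Iio t)) : tiltUp ε μ a (Iio t) ≠ ∞ := by
  intro h0
  apply Marg.measure_ne_top h.marg (Iio t ×ˢ Ici t)
  rw [h.cross_eq le_rfl, h0, ENNReal.top_mul (h.tiltDown_Ici_ne_zero ht)]

theorem tiltDown_Ici_ne_top (h : EntropicFactors ε μ ν π a b) {t : ℝ}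
    (ht : ν (Iio t) < μ (Iio t)) : tiltDown ε ν b (Ici t) ≠ ∞ := by
  intro h0
  apply Marg.measure_ne_top h.marg (Iio t ×ˢ Ici t)
  rw [h.cross_eq le_rfl, h0, ENNReal.mul_top (h.tiltUp_Iio_ne_zero ht)]

/-- The marginal condition gives e^{x/ε} a(x) as an inverse. Multiplying and dividing by `tiltUp ε μ
a (Iio x)` turns it into a linear equation whose coefficient no longer depends on the common scaling
of `a` and `b`. -/
theorem tiltUp_apply_eq (h : EntropicFactors ε μ ν π a b) {A : Set ℝ} (hA : MeasurableSet A)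
    (hlt : ∀ t ∈ A, ν (Iio t) < μ (Iio t)) :
    tiltUp ε μ a A = ∫⁻ x in A, tiltUp ε μ a (Iio x) / flowCoeff ε μ ν a b x ∂μ := by
  conv_lhs => rw [tiltUp]
  rw [withDensity_apply _ hA]
  refine lintegral_congr_ae ?_
  filter_upwards [ae_restrict_of_ae h.density_mul_left_eq_one, ae_restrict_mem hA] with x hx hxA
  have h1 := ENNReal.eq_inv_of_mul_eq_one_left hx
  rw [h1, flowCoeff, ENNReal.div_eq_inv_mul, ENNReal.mul_inv
    (Or.inl (h.tiltUp_Iio_ne_zero (hlt x hxA))) (Or.inl (h.tiltUp_Iio_ne_top (hlt x hxA))),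
    mul_right_comm, ENNReal.inv_mul_cancel (h.tiltUp_Iio_ne_zero (hlt x hxA))
      (h.tiltUp_Iio_ne_top (hlt x hxA)), one_mul]

theorem tiltDown_apply_eq (h : EntropicFactors ε μ ν π a b) {A : Set ℝ} (hA : MeasurableSet A) :
    tiltDown ε ν b A =
      ∫⁻ y in A, (tiltUp ε μ a (Iic y) + expE (2 * y / ε) * tiltDown ε μ a (Ioi y))⁻¹ ∂ν := by
  conv_lhs => rw [tiltDown]
  rw [withDensity_apply _ hA]
  refine lintegral_congr_ae ?_
  filter_upwards [ae_restrict_of_ae h.density_mul_right_eq_one] with y hy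
  exact ENNReal.eq_inv_of_mul_eq_one_left hy

theorem flowSolution (h : EntropicFactors ε μ ν π a b) {I : Set ℝ} (hI : OrdConnected I)
    (hlt : ∀ t ∈ I, ν (Iio t) < μ (Iio t)) :
    FlowSolution μ I (fun t => (tiltUp ε μ a (Iio t)).toReal)
      (fun t => (flowCoeff ε μ ν a b t).toReal) := by
  refine flowSolution_toReal hI (monotone_measure_Iio _) (measurable_flowCoeff _ _ _ _ _)
    (fun t ht => h.tiltUp_Iio_ne_zero (hlt t ht)) (fun t ht => h.tiltUp_Iio_ne_top (hlt t ht))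
    (fun t ht => h.flowCoeff_ne_zero (hlt t ht)) fun s hs t ht hst => ?_
  rw [← h.tiltUp_apply_eq measurableSet_Ico fun x hx =>
      hlt x (hI.out hs ht (Ico_subset_Icc_self hx)),
    ← measure_union _ measurableSet_Ico, Iio_union_Ico_eq_Iio hst]
  rw [disjoint_left]
  intro x hx hx'
  exact not_lt.2 hx'.1 (mem_Iio.1 hx)

end EntropicFactors

section Family

variable {μ ν : Measure ℝ} [IsFiniteMeasure μ] [IsFiniteMeasure ν] {π : ℝ → Measure (ℝ × ℝ)}
  {a b : ℝ → ℝ → ℝ≥0} {I : Set ℝ}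

theorem tendsto_flowCoeff (h : ∀ ε > 0, EntropicFactors ε μ ν (π ε) (a ε) (b ε)) (t : ℝ) :
    Tendsto (fun ε => flowCoeff ε μ ν (a ε) (b ε) t) (𝓝[>] 0)
      (𝓝 (μ (Iio t) - ν (Iio t))) := by
  have := (tendsto_cross h t).add (tendsto_leftRemainder h t)
  rw [add_zero] at this
  refine this.congr' ?_
  filter_upwards [self_mem_nhdsWithin] with ε hε
  exact ((h ε hε).flowCoeff_eq t).symm

theorem measurable_sub_Iio (μ ν : Measure ℝ) : Measurable fun t => μ (Iio t) - ν (Iio t) :=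
  (monotone_measure_Iio μ).measurable.sub (monotone_measure_Iio ν).measurable

theorem IsFlowInterval.le_toReal_sub {μ ν : Measure ℝ} [IsFiniteMeasure μ] [IsFiniteMeasure ν]
    {d₀ x : ℝ} (hx : ENNReal.ofReal d₀ + ν (Iio x) ≤ μ (Iio x)) :
    d₀ ≤ (μ (Iio x) - ν (Iio x)).toReal := by
  rw [← ENNReal.ofReal_le_iff_le_toReal (by finiteness)]
  exact ENNReal.le_sub_of_add_le_right (measure_ne_top _ _) hx

theorem exists_tendsto_tiltUp_ratio (h : ∀ ε > 0, EntropicFactors ε μ ν (π ε) (a ε) (b ε))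
    (hI : IsFlowInterval μ ν I) {s t : ℝ} (hs : s ∈ I) (ht : t ∈ I) (hst : s ≤ t) :
    ∃ ρ : ℝ, 1 ≤ ρ ∧ Tendsto (fun ε => (tiltUp ε μ (a ε) (Iio t)).toReal /
      (tiltUp ε μ (a ε) (Iio s)).toReal) (𝓝[>] 0) (𝓝 ρ) := by
  obtain ⟨d₀, hd₀, hd⟩ := hI.exists_le s hs t ht
  have hsub : Icc s t ⊆ I := hI.ordConnected.out hs ht
  refine FlowSolution.exists_tendsto_ratio (μ := μ) hst hd₀
    (g := fun ε x => (tiltUp ε μ (a ε) (Iio x)).toReal)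
    (c := fun ε x => (flowCoeff ε μ ν (a ε) (b ε) x).toReal)
    (c' := fun x => (μ (Iio x) - ν (Iio x)).toReal) ?_
    (measurable_sub_Iio μ ν).ennreal_toReal ?_
    (fun x hx => IsFlowInterval.le_toReal_sub (hd x hx)) ?_
  · filter_upwards [self_mem_nhdsWithin] with ε hε
    exact ((h ε hε).flowSolution hI.ordConnected fun t ht => hI.lt ht).mono_set hsub
  · filter_upwards [self_mem_nhdsWithin] with ε hε x hx
    exact (IsFlowInterval.le_toReal_sub (hd x hx)).trans
      (ENNReal.toReal_mono ((h ε hε).flowCoeff_ne_top x) ((h ε hε).sub_le_flowCoeff x))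
  · intro x _
    exact (ENNReal.tendsto_toReal (by finiteness)).comp (tendsto_flowCoeff h x)

theorem exists_limit_tiltUp (h : ∀ ε > 0, EntropicFactors ε μ ν (π ε) (a ε) (b ε))
    (hI : IsFlowInterval μ ν I) {s₀ : ℝ} (hs₀ : s₀ ∈ I) :
    ∃ g : ℝ → ℝ≥0∞, Measurable g ∧ ∀ t ∈ I, g t ≠ 0 ∧ g t ≠ ∞ ∧
      Tendsto (fun ε => tiltUp ε μ (a ε) (Iio t) / tiltUp ε μ (a ε) (Iio s₀)) (𝓝[>] 0)
        (𝓝 (g t)) := by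
  have hpt : ∀ t ∈ I, ∃ r : ℝ, 0 < r ∧ Tendsto (fun ε => (tiltUp ε μ (a ε) (Iio t)).toReal /
      (tiltUp ε μ (a ε) (Iio s₀)).toReal) (𝓝[>] 0) (𝓝 r) := by
    intro t ht
    rcases le_total s₀ t with hst | hst
    · obtain ⟨ρ, hρ, hlim⟩ := exists_tendsto_tiltUp_ratio h hI hs₀ ht hst
      exact ⟨ρ, by linarith, hlim⟩
    · obtain ⟨ρ, hρ, hlim⟩ := exists_tendsto_tiltUp_ratio h hI ht hs₀ hst
      refine ⟨ρ⁻¹, by positivity, (hlim.inv₀ (by positivity)).congr fun ε => inv_div _ _⟩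
  choose! r hr0 hr using hpt
  have hlim : ∀ t ∈ I, Tendsto (fun ε => tiltUp ε μ (a ε) (Iio t) /
      tiltUp ε μ (a ε) (Iio s₀)) (𝓝[>] 0) (𝓝 (ENNReal.ofReal (r t))) := by
    intro t ht
    refine (ENNReal.tendsto_ofReal (hr t ht)).congr' ?_
    filter_upwards [self_mem_nhdsWithin] with ε hε
    have h1 := (h ε hε).tiltUp_Iio_ne_top (hI.lt ht)
    have h2 := (h ε hε).tiltUp_Iio_ne_top (hI.lt hs₀)
    have h3 := (h ε hε).tiltUp_Iio_ne_zero (hI.lt hs₀)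
    rw [ENNReal.ofReal_div_of_pos (ENNReal.toReal_pos h3 h2), ENNReal.ofReal_toReal h1,
      ENNReal.ofReal_toReal h2]
  -- Cut off outside `I`, where no convergence is known, so that `g` is a pointwise limit of
  -- measurable functions everywhere.
  refine ⟨I.indicator fun t => ENNReal.ofReal (r t), ?_, fun t ht => ?_⟩
  · refine measurable_of_tendsto_metrizable' (𝓝[>] (0 : ℝ))
      (f := fun ε => I.indicator fun t => tiltUp ε μ (a ε) (Iio t) / tiltUp ε μ (a ε) (Iio s₀))
      (fun ε => ((monotone_measure_Iio _).measurable.div_const _).indicator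
        hI.isOpen.measurableSet) (tendsto_pi_nhds.2 fun t => ?_)
    by_cases ht : t ∈ I
    · simpa [indicator_of_mem ht] using hlim t ht
    · simp [indicator_of_notMem ht]
  · rw [indicator_of_mem ht]
    exact ⟨by simpa using hr0 t ht, ENNReal.ofReal_ne_top, hlim t ht⟩

/-- The data of the limit flow: `g` and `h` are the distribution function and the tail of the two
factors of a strongly multiplicative plan, `k` is the right limit of `g`. -/
structure LimitFlow (μ ν : Measure ℝ) (I : Set ℝ) (g h k : ℝ → ℝ≥0∞) : Prop where
  measurable_k : Measurable k
  g_ne_zero : ∀ t ∈ I, g t ≠ 0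
  g_ne_top : ∀ t ∈ I, g t ≠ ∞
  mul_eq : ∀ t ∈ I, g t * h t = μ (Iio t) - ν (Iio t)
  k_eq : ∀ t ∈ I, k t = g t + (h t)⁻¹ * μ {t}
  g_eq : ∀ s ∈ I, ∀ t ∈ I, s ≤ t → g t = g s + ∫⁻ x in Ico s t, (h x)⁻¹ ∂μ
  h_eq : ∀ s ∈ I, ∀ t ∈ I, s ≤ t → h s = h t + ∫⁻ y in Ico s t, (k y)⁻¹ ∂ν

/-- Dividing `G ε` and multiplying `H ε` by the same number `G ε s₀` leaves their product unchanged
and makes both converge. The choice `D / g` for the limit of `H` is forced by the limit of the flow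
at a single point, and the integral equations pass to the limit by dominated convergence. -/
theorem exists_limitFlow (h : ∀ ε > 0, EntropicFactors ε μ ν (π ε) (a ε) (b ε))
    (hI : IsFlowInterval μ ν I) :
    ∃ g' h' k' : ℝ → ℝ≥0∞, LimitFlow μ ν I g' h' k' ∧ ∀ s ∈ I, ∀ t ∈ I, s ≤ t →
      Tendsto (fun ε => π ε (Iio s ×ˢ Ici t)) (𝓝[>] 0) (𝓝 (g' s * h' t)) := by
  obtain ⟨s₀, hs₀⟩ := hI.nonempty
  obtain ⟨g, hgm, hg⟩ := exists_limit_tiltUp h hI hs₀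
  set D : ℝ → ℝ≥0∞ := fun t => μ (Iio t) - ν (Iio t) with hD
  have hDm : Measurable D := measurable_sub_Iio μ ν
  have hD0 : ∀ t ∈ I, D t ≠ 0 := fun t ht => (tsub_pos_of_lt (hI.lt ht)).ne'
  have hDt : ∀ t, D t ≠ ∞ := fun t => by simp only [hD]; finiteness
  have hg0 : ∀ t ∈ I, g t ≠ 0 := fun t ht => (hg t ht).1
  have hgt : ∀ t ∈ I, g t ≠ ∞ := fun t ht => (hg t ht).2.1
  set G : ℝ → ℝ → ℝ≥0∞ := fun ε t => tiltUp ε μ (a ε) (Iio t) with hG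
  set H : ℝ → ℝ → ℝ≥0∞ := fun ε t => tiltDown ε ν (b ε) (Ici t) with hH
  set C : ℝ → ℝ → ℝ≥0∞ := fun ε t => flowCoeff ε μ ν (a ε) (b ε) t with hCdef
  have hglim : ∀ t ∈ I, Tendsto (fun ε => G ε t / G ε s₀) (𝓝[>] 0) (𝓝 (g t)) :=
    fun t ht => (hg t ht).2.2
  have hG0 : ∀ ε > 0, ∀ t ∈ I, G ε t ≠ 0 := fun ε hε t ht =>
    (h ε hε).tiltUp_Iio_ne_zero (hI.lt ht)
  have hGt : ∀ ε > 0, ∀ t ∈ I, G ε t ≠ ∞ := fun ε hε t ht =>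
    (h ε hε).tiltUp_Iio_ne_top (hI.lt ht)
  have hH0 : ∀ ε > 0, ∀ t ∈ I, H ε t ≠ 0 := fun ε hε t ht =>
    (h ε hε).tiltDown_Ici_ne_zero (hI.lt ht)
  have hHt : ∀ ε > 0, ∀ t ∈ I, H ε t ≠ ∞ := fun ε hε t ht =>
    (h ε hε).tiltDown_Ici_ne_top (hI.lt ht)
  have hsub : ∀ s ∈ I, ∀ t ∈ I, Icc s t ⊆ I := fun s hs t ht => hI.ordConnected.out hs ht
  have hClim : ∀ t, Tendsto (fun ε => C ε t) (𝓝[>] 0) (𝓝 (D t)) := tendsto_flowCoeff h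
  set h' : ℝ → ℝ≥0∞ := fun t => D t / g t with hh'
  have hh0 : ∀ t ∈ I, h' t ≠ 0 := fun t ht => ENNReal.div_ne_zero.2 ⟨hD0 t ht, hgt t ht⟩
  have hht : ∀ t ∈ I, h' t ≠ ∞ := fun t ht => ENNReal.div_ne_top (hDt t) (hg0 t ht)
  have hhinv : ∀ t ∈ I, (h' t)⁻¹ = g t / D t := fun t ht =>
    ENNReal.inv_div (Or.inl (hgt t ht)) (Or.inl (hg0 t ht))
  have hhlim : ∀ t ∈ I, Tendsto (fun ε => G ε s₀ * H ε t) (𝓝[>] 0) (𝓝 (h' t)) := by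
    intro t ht
    have h1 := ENNReal.Tendsto.div (tendsto_cross h t) (Or.inl (hD0 t ht)) (hglim t ht)
      (Or.inl (hgt t ht))
    refine h1.congr' ?_
    filter_upwards [self_mem_nhdsWithin] with ε hε
    have e1 := hG0 ε hε t ht
    have e2 := hGt ε hε t ht
    have e3 := hG0 ε hε s₀ hs₀
    have e4 := hGt ε hε s₀ hs₀
    change π ε (Iio t ×ˢ Ici t) / (G ε t / G ε s₀) = G ε s₀ * H ε t
    rw [(h ε hε).cross_eq le_rfl]
    change G ε t * H ε t / (G ε t / G ε s₀) = G ε s₀ * H ε t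
    rw [ENNReal.div_eq_inv_mul, ENNReal.inv_div (Or.inl e4) (Or.inl e3), ENNReal.div_eq_inv_mul]
    calc _ = ((G ε t)⁻¹ * G ε t) * (G ε s₀ * H ε t) := by ring
      _ = _ := by rw [ENNReal.inv_mul_cancel e1 e2, one_mul]
  have hglimC : ∀ x ∈ I, Tendsto (fun ε => G ε x / G ε s₀ / C ε x) (𝓝[>] 0)
      (𝓝 ((h' x)⁻¹)) := by
    intro x hx
    rw [hhinv x hx]
    exact ENNReal.Tendsto.div (hglim x hx) (Or.inl (hg0 x hx)) (hClim x) (Or.inl (hDt x))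
  have hsing : ∀ ε > 0, ∀ y ∈ I, tiltUp ε μ (a ε) {y} = G ε y / C ε y * μ {y} := by
    intro ε hε y hy
    rw [(h ε hε).tiltUp_apply_eq (measurableSet_singleton y) (by
      rintro x rfl; exact hI.lt hy), lintegral_singleton]
  set k' : ℝ → ℝ≥0∞ := fun t => g t + (h' t)⁻¹ * μ {t} with hk'
  have hh'm : Measurable h' := hDm.div hgm
  have hsm : Measurable fun t => μ {t} := by
    have e : ∀ t, μ {t} = μ (Iic t) - μ (Iio t) := by
      intro t
      rw [← measure_sdiff (Iio_subset_Iic_self) measurableSet_Iio.nullMeasurableSet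
        (measure_ne_top _ _)]
      congr 1
      ext x
      simp [le_antisymm_iff]
    simp only [e]
    have h1 : Monotone fun t => μ (Iic t) := fun _ _ h => measure_mono (Iic_subset_Iic.2 h)
    exact h1.measurable.sub (monotone_measure_Iio μ).measurable
  have hk'm : Measurable k' := hgm.add (hh'm.inv.mul hsm)
  set Kf : ℝ → ℝ → ℝ≥0∞ := fun ε y =>
    tiltUp ε μ (a ε) (Iic y) + expE (2 * y / ε) * tiltDown ε μ (a ε) (Ioi y) with hKf
  have hklim : ∀ y ∈ I, Tendsto (fun ε => Kf ε y / G ε s₀) (𝓝[>] 0) (𝓝 (k' y)) := by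
    intro y hy
    obtain ⟨t, hyt, ht⟩ : ∃ t, y < t ∧ t ∈ I := by
      have h1 : ∀ᶠ t in 𝓝[>] y, t ∈ I := mem_nhdsWithin_of_mem_nhds (hI.isOpen.mem_nhds hy)
      obtain ⟨t, ht, hyt⟩ := (h1.and self_mem_nhdsWithin).exists
      exact ⟨t, hyt, ht⟩
    -- The right remainder at `y` also carries the factor `tiltDown ε ν (b ε) (Ioi y)`, which is at
    -- least `H ε t`. As `G ε s₀ * H ε t` has the nonzero limit `h' t`, the remainder can be divided
    -- by it.
    have h3 : Tendsto (fun ε => expE (2 * y / ε) * tiltDown ε μ (a ε) (Ioi y) / G ε s₀)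
        (𝓝[>] 0) (𝓝 0) := by
      have h4 := ENNReal.Tendsto.div (tendsto_rightRemainder h y) (Or.inr (hh0 t ht))
        (hhlim t ht) (Or.inr ENNReal.zero_ne_top)
      rw [ENNReal.zero_div] at h4
      refine tendsto_of_tendsto_of_tendsto_of_le_of_le' tendsto_const_nhds h4
        (Eventually.of_forall fun _ => zero_le) ?_
      filter_upwards [self_mem_nhdsWithin] with ε hε
      have e1 := hH0 ε hε t ht
      have e2 := hHt ε hε t ht
      have e3 : H ε t ≤ tiltDown ε ν (b ε) (Ioi y) :=
        measure_mono fun z hz => hyt.trans_le hz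
      calc _ = expE (2 * y / ε) * tiltDown ε μ (a ε) (Ioi y) * H ε t / (G ε s₀ * H ε t) := by
            rw [ENNReal.mul_div_mul_right _ _ e1 e2]
        _ ≤ _ := by
            refine ENNReal.div_le_div_right ?_ _
            calc _ = tiltDown ε μ (a ε) (Ioi y) * H ε t * expE (2 * y / ε) := by ring
              _ ≤ _ := by gcongr
    have h5 := (hglim y hy).add
      ((ENNReal.Tendsto.mul_const (hglimC y hy) (Or.inr (measure_ne_top μ {y}))).add h3)
    rw [add_zero] at h5
    refine h5.congr' ?_
    filter_upwards [self_mem_nhdsWithin] with ε hε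
    have e : tiltUp ε μ (a ε) (Iic y) = G ε y + G ε y / C ε y * μ {y} := by
      rw [← hsing ε hε y hy, ← Iio_union_right, measure_union _ (measurableSet_singleton y)]
      simp
    simp only [hKf, e, div_eq_mul_inv]
    ring
  refine ⟨g, h', k', ⟨hk'm, hg0, hgt, fun t ht => ?_, fun t ht => rfl, ?_, ?_⟩, ?_⟩
  · rw [hh']
    exact ENNReal.mul_div_cancel (hg0 t ht) (hgt t ht)
  · intro s hs t ht hst
    obtain ⟨d₀, hd₀, hd⟩ := hI.exists_le s hs t ht
    have hdC : ∀ ε > 0, ∀ x ∈ Icc s t, ENNReal.ofReal d₀ ≤ C ε x := fun ε hε x hx =>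
      (ENNReal.le_sub_of_add_le_right (measure_ne_top _ _) (hd x hx)).trans
        ((h ε hε).sub_le_flowCoeff x)
    have h1 : Tendsto (fun ε => ∫⁻ x in Ico s t, G ε x / G ε s₀ / C ε x ∂μ) (𝓝[>] 0)
        (𝓝 (∫⁻ x in Ico s t, (h' x)⁻¹ ∂μ)) := by
      -- The numerator is monotone in x and converges at `t`; the denominator is at least `d₀`.
      refine tendsto_lintegral_filter_of_dominated_convergence
        (fun _ => (g t + 1) / ENNReal.ofReal d₀) ?_ ?_ ?_ ?_
      · exact Eventually.of_forall fun ε =>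
          ((monotone_measure_Iio _).measurable.div_const _).div (measurable_flowCoeff _ _ _ _ _)
      · have h2 : ∀ᶠ ε in 𝓝[>] (0 : ℝ), G ε t / G ε s₀ < g t + 1 :=
          (hglim t ht).eventually_lt_const (ENNReal.lt_add_right (hgt t ht) one_ne_zero)
        filter_upwards [h2, self_mem_nhdsWithin] with ε hε1 hε
        filter_upwards [ae_restrict_mem measurableSet_Ico] with x hx
        have hx' := Ico_subset_Icc_self hx
        refine ENNReal.div_le_div (le_trans ?_ hε1.le) (hdC ε hε x hx')
        exact ENNReal.div_le_div_right (monotone_measure_Iio _ hx'.2) _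
      · simp only [lintegral_const, Measure.restrict_apply, MeasurableSet.univ, univ_inter]
        refine ENNReal.mul_ne_top (ENNReal.div_ne_top ?_ (by simpa using hd₀))
          (measure_ne_top _ _)
        exact ENNReal.add_ne_top.2 ⟨hgt t ht, ENNReal.one_ne_top⟩
      · filter_upwards [ae_restrict_mem measurableSet_Ico] with x hx
        exact hglimC x (hsub s hs t ht (Ico_subset_Icc_self hx))
    refine tendsto_nhds_unique (hglim t ht) (((hglim s hs).add h1).congr' ?_)
    filter_upwards [self_mem_nhdsWithin] with ε hε
    have e1 : G ε t = G ε s + ∫⁻ x in Ico s t, G ε x / C ε x ∂μ := by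
      simp only [hG, hCdef]
      rw [← (h ε hε).tiltUp_apply_eq measurableSet_Ico fun x hx =>
          hI.lt (hsub s hs t ht (Ico_subset_Icc_self hx)),
        ← measure_union _ measurableSet_Ico, Iio_union_Ico_eq_Iio hst]
      rw [disjoint_left]
      intro x hx hx'
      exact not_lt.2 hx'.1 (mem_Iio.1 hx)
    rw [e1, ENNReal.add_div]
    congr 1
    simp only [div_eq_mul_inv]
    rw [← lintegral_mul_const' _ _ (ENNReal.inv_ne_top.2 (hG0 ε hε s₀ hs₀))]
    refine lintegral_congr fun x => ?_
    ring
  · intro s hs t ht hst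
    have h1 : Tendsto (fun ε => ∫⁻ y in Ico s t, (Kf ε y / G ε s₀)⁻¹ ∂ν) (𝓝[>] 0)
        (𝓝 (∫⁻ y in Ico s t, (k' y)⁻¹ ∂ν)) := by
      refine tendsto_lintegral_filter_of_dominated_convergence
        (fun _ => (g s)⁻¹ + 1) ?_ ?_ ?_ ?_
      · refine Eventually.of_forall fun ε => ?_
        have m1 : Measurable fun y => tiltUp ε μ (a ε) (Iic y) :=
          Monotone.measurable fun _ _ h => measure_mono (Iic_subset_Iic.2 h)
        have m2 : Measurable fun y => tiltDown ε μ (a ε) (Ioi y) :=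
          Antitone.measurable fun _ _ h => measure_mono (Ioi_subset_Ioi h)
        have hE := measurable_expE
        simp only [hKf]
        fun_prop
      · have h2 : ∀ᶠ ε in 𝓝[>] (0 : ℝ), (G ε s / G ε s₀)⁻¹ < (g s)⁻¹ + 1 :=
          (hglim s hs).inv.eventually_lt_const (ENNReal.lt_add_right
            (ENNReal.inv_ne_top.2 (hg0 s hs)) one_ne_zero)
        filter_upwards [h2] with ε hε1
        filter_upwards [ae_restrict_mem measurableSet_Ico] with y hy
        refine le_trans ?_ hε1.le
        rw [ENNReal.inv_le_inv]
        refine ENNReal.div_le_div_right ?_ _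
        exact (measure_mono fun z hz => (mem_Iio.1 hz).le.trans hy.1).trans le_self_add
      · simp only [lintegral_const, Measure.restrict_apply, MeasurableSet.univ, univ_inter]
        refine ENNReal.mul_ne_top (ENNReal.add_ne_top.2 ⟨ENNReal.inv_ne_top.2 (hg0 s hs),
          ENNReal.one_ne_top⟩) (measure_ne_top _ _)
      · filter_upwards [ae_restrict_mem measurableSet_Ico] with y hy
        exact (hklim y (hsub s hs t ht (Ico_subset_Icc_self hy))).inv
    refine tendsto_nhds_unique (hhlim s hs) (((hhlim t ht).add h1).congr' ?_)
    filter_upwards [self_mem_nhdsWithin] with ε hε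
    have e3 := hG0 ε hε s₀ hs₀
    have e4 := hGt ε hε s₀ hs₀
    have e1 : H ε s = H ε t + ∫⁻ y in Ico s t, (Kf ε y)⁻¹ ∂ν := by
      simp only [hH, hKf]
      rw [← (h ε hε).tiltDown_apply_eq measurableSet_Ico,
        ← measure_union _ measurableSet_Ico, union_comm, Ico_union_Ici_eq_Ici hst]
      rw [disjoint_left]
      intro x hx hx'
      exact not_lt.2 (mem_Ici.1 hx) hx'.2
    rw [e1, mul_add, ← lintegral_const_mul' _ _ e4]
    congr 1
    refine lintegral_congr fun y => ?_
    rw [ENNReal.inv_div (Or.inl e4) (Or.inl e3), div_eq_mul_inv]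
  · intro s hs t ht hst
    have h1 := ENNReal.Tendsto.mul (hglim s hs) (Or.inl (hg0 s hs)) (hhlim t ht)
      (Or.inl (hh0 t ht))
    refine h1.congr' ?_
    filter_upwards [self_mem_nhdsWithin] with ε hε
    rw [(h ε hε).cross_eq hst, ← mul_assoc,
      ENNReal.div_mul_cancel (hG0 ε hε s₀ hs₀) (hGt ε hε s₀ hs₀)]

end Family

/-! ### Weak convergence from convergence on quadrants -/

theorem tendsto_measure_Iio_nhdsLT (κ : Measure ℝ) [IsFiniteMeasure κ] (t : ℝ) :
    Tendsto (fun r => κ (Iio r)) (𝓝[<] t) (𝓝 (κ (Iio t))) := by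
  have h := ENNReal.Tendsto.sub (tendsto_const_nhds (x := κ (Iio t)))
    (tendsto_measure_Ico_nhdsLT κ t) (Or.inl (measure_ne_top _ _))
  rw [tsub_zero] at h
  refine h.congr' ?_
  filter_upwards [self_mem_nhdsWithin] with r hr
  have e : Iio t = Iio r ∪ Ico r t := (Iio_union_Ico_eq_Iio (le_of_lt hr)).symm
  rw [e, measure_union _ measurableSet_Ico, ENNReal.add_sub_cancel_right (measure_ne_top _ _)]
  rw [disjoint_left]
  intro x hx hx'
  exact not_lt.2 hx'.1 (mem_Iio.1 hx)

theorem tendsto_measure_Iio_nhdsGT (κ : Measure ℝ) [IsFiniteMeasure κ] (t : ℝ) :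
    Tendsto (fun r => κ (Iio r)) (𝓝[>] t) (𝓝 (κ (Iic t))) := by
  have h := (tendsto_measure_Ioc_nhdsGT κ t).const_add (κ (Iic t))
  rw [add_zero] at h
  refine tendsto_of_tendsto_of_tendsto_of_le_of_le' tendsto_const_nhds h ?_ ?_
  · filter_upwards [self_mem_nhdsWithin] with r hr
    exact measure_mono fun x hx => (mem_Iic.1 hx).trans_lt hr
  · filter_upwards [self_mem_nhdsWithin] with r hr
    refine (measure_mono ?_).trans (measure_union_le _ _)
    rw [Iic_union_Ioc_eq_Iic (le_of_lt hr)]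
    exact Iio_subset_Iic_self

theorem countable_setOf_measure_singleton_ne_zero (κ : Measure ℝ) [IsFiniteMeasure κ] :
    {t : ℝ | κ {t} ≠ 0}.Countable := by
  have := Measure.countable_meas_pos_of_disjoint_iUnion (μ := κ) (As := fun t : ℝ => {t})
    (fun t => measurableSet_singleton t) fun s t hst => by
      simpa [Function.onFun] using hst
  simpa [pos_iff_ne_zero] using this

theorem dense_setOf_measure_singleton_eq_zero (κ : Measure ℝ) [IsFiniteMeasure κ] :
    Dense {t : ℝ | κ {t} = 0} := by
  have := (countable_setOf_measure_singleton_ne_zero κ).dense_compl ℝ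
  convert this using 1
  ext t
  simp

theorem measureReal_Ico_prod_Ico (P : Measure (ℝ × ℝ)) [IsFiniteMeasure P] {s s' t t' : ℝ}
    (hs : s ≤ s') (ht : t ≤ t') :
    P.real (Ico s s' ×ˢ Ico t t') = P.real (Iio s' ×ˢ Iio t') - P.real (Iio s ×ˢ Iio t') -
      (P.real (Iio s' ×ˢ Iio t) - P.real (Iio s ×ˢ Iio t)) := by
  have h1 : ∀ r : ℝ, P.real (Iio s' ×ˢ Iio r) =
      P.real (Iio s ×ˢ Iio r) + P.real (Ico s s' ×ˢ Iio r) := by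
    intro r
    rw [← Iio_union_Ico_eq_Iio hs, union_prod, measureReal_union _
      (measurableSet_Ico.prod measurableSet_Iio)]
    rw [disjoint_left]
    rintro p ⟨hp, -⟩ ⟨hp', -⟩
    exact not_lt.2 hp'.1 (mem_Iio.1 hp)
  have h2 : P.real (Ico s s' ×ˢ Iio t') =
      P.real (Ico s s' ×ˢ Iio t) + P.real (Ico s s' ×ˢ Ico t t') := by
    rw [← Iio_union_Ico_eq_Iio ht, prod_union, measureReal_union _
      (measurableSet_Ico.prod measurableSet_Ico)]
    rw [disjoint_left]
    rintro p ⟨-, hp⟩ ⟨-, hp'⟩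
    exact not_lt.2 hp'.1 (mem_Iio.1 hp)
  rw [h1 t', h1 t, h2]; ring

/-- Half-open boxes with corners in `T` are, when they meet, stable under intersection, and they
form small neighbourhoods of every point; inclusion and exclusion reduces their masses to quadrants.
-/
theorem tendsto_probabilityMeasure_of_quadrants {ι : Type*} {l : Filter ι}
    [l.IsCountablyGenerated] {P : ι → ProbabilityMeasure (ℝ × ℝ)} {Q : ProbabilityMeasure (ℝ × ℝ)}
    {T : Set ℝ} (hT : Dense T) (h : ∀ s ∈ T, ∀ t ∈ T,
      Tendsto (fun i => (P i : Measure (ℝ × ℝ)).real (Iio s ×ˢ Iio t)) l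
        (𝓝 ((Q : Measure (ℝ × ℝ)).real (Iio s ×ˢ Iio t)))) :
    Tendsto P l (𝓝 Q) := by
  set S : Set (Set (ℝ × ℝ)) := {A | ∃ s ∈ T, ∃ s' ∈ T, ∃ t ∈ T, ∃ t' ∈ T, s ≤ s' ∧ t ≤ t' ∧
    A = Ico s s' ×ˢ Ico t t'} with hS
  have hpi : IsPiSystem S := by
    rintro _ ⟨s, hs, s', hs', t, ht, t', ht', hss, htt, rfl⟩ _
      ⟨r, hr, r', hr', u, hu, u', hu', hrr, huu, rfl⟩ hne
    have e : Ico s s' ×ˢ Ico t t' ∩ Ico r r' ×ˢ Ico u u' =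
        Ico (max s r) (min s' r') ×ˢ Ico (max t u) (min t' u') := by
      rw [prod_inter_prod, Ico_inter_Ico, Ico_inter_Ico]
    rw [e] at hne ⊢
    obtain ⟨p, hp⟩ := hne
    refine ⟨_, ?_, _, ?_, _, ?_, _, ?_, hp.1.1.trans hp.1.2.le, hp.2.1.trans hp.2.2.le, rfl⟩
    · rcases max_choice s r with h | h <;> rw [h] <;> assumption
    · rcases min_choice s' r' with h | h <;> rw [h] <;> assumption
    · rcases max_choice t u with h | h <;> rw [h] <;> assumption
    · rcases min_choice t' u' with h | h <;> rw [h] <;> assumption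
  refine hpi.tendsto_probabilityMeasure_of_tendsto_of_mem ?_ ?_ ?_
  · rintro _ ⟨s, -, s', -, t, -, t', -, -, -, rfl⟩
    exact measurableSet_Ico.prod measurableSet_Ico
  · rintro U hU ⟨x, y⟩ hxy
    obtain ⟨A, hA, B, hB, hAB⟩ := mem_nhds_prod_iff.1 (hU.mem_nhds hxy)
    have hone : ∀ (z : ℝ) (A : Set ℝ), A ∈ 𝓝 z →
        ∃ s ∈ T, ∃ s' ∈ T, s < z ∧ z < s' ∧ Ico s s' ⊆ A := by
      intro z A hA
      obtain ⟨l, u, ⟨hl, hu⟩, hlu⟩ := mem_nhds_iff_exists_Ioo_subset.1 hA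
      obtain ⟨s, hs, hs1⟩ := hT.exists_between hl
      obtain ⟨s', hs', hs'1⟩ := hT.exists_between hu
      exact ⟨s, hs, s', hs', hs1.2, hs'1.1,
        fun w hw => hlu ⟨hs1.1.trans_le hw.1, hw.2.trans hs'1.2⟩⟩
    obtain ⟨s, hs, s', hs', h1, h2, h3⟩ := hone x A hA
    obtain ⟨t, ht, t', ht', h4, h5, h6⟩ := hone y B hB
    refine ⟨Ico s s' ×ˢ Ico t t', ⟨s, hs, s', hs', t, ht, t', ht', (h1.trans h2).le,
      (h4.trans h5).le, rfl⟩, prod_mem_nhds (Ico_mem_nhds h1 h2) (Ico_mem_nhds h4 h5),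
      (prod_mono h3 h6).trans hAB⟩
  · rintro _ ⟨s, hs, s', hs', t, ht, t', ht', hss, htt, rfl⟩
    have := ((h s' hs' t' ht').sub (h s hs t' ht')).sub ((h s' hs' t ht).sub (h s hs t ht))
    rw [← measureReal_Ico_prod_Ico _ hss htt] at this
    rw [← NNReal.tendsto_coe]
    refine this.congr fun i => ?_
    rw [← measureReal_Ico_prod_Ico _ hss htt]
    rfl

/-- Finite measures on the plane of the same mass converge weakly as soon as they converge on the
quadrants with corners in a dense set. -/
theorem tendsto_finiteMeasure_of_quadrants {ι : Type*} {l : Filter ι}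
    [l.IsCountablyGenerated] {P : ι → FiniteMeasure (ℝ × ℝ)} {Q : FiniteMeasure (ℝ × ℝ)}
    {T : Set ℝ} (hT : Dense T)
    (hmass : ∀ᶠ i in l, (P i : Measure (ℝ × ℝ)) univ = (Q : Measure (ℝ × ℝ)) univ)
    (h : ∀ s ∈ T, ∀ t ∈ T,
      Tendsto (fun i => (P i : Measure (ℝ × ℝ)) (Iio s ×ˢ Iio t)) l
        (𝓝 ((Q : Measure (ℝ × ℝ)) (Iio s ×ˢ Iio t)))) :
    Tendsto P l (𝓝 Q) := by
  have hm : ∀ᶠ i in l, (P i).mass = Q.mass := by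
    filter_upwards [hmass] with i hi
    apply ENNReal.coe_injective
    simpa using hi
  have hmt : Tendsto (fun i => (P i).mass) l (𝓝 Q.mass) :=
    tendsto_const_nhds.congr' (hm.mono fun i hi => hi.symm)
  by_cases hQ : Q = 0
  · subst hQ
    exact FiniteMeasure.tendsto_zero_of_tendsto_zero_mass (by simpa using hmt)
  refine FiniteMeasure.tendsto_of_tendsto_normalize_testAgainstNN_of_tendsto_mass ?_ hmt
  refine tendsto_probabilityMeasure_of_quadrants hT fun s hs t ht => ?_
  have hQm : Q.mass ≠ 0 := Q.mass_nonzero_iff.2 hQ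
  have hreal : ∀ R : FiniteMeasure (ℝ × ℝ), R ≠ 0 → ∀ A,
      (R.normalize : Measure (ℝ × ℝ)).real A = (R.mass : ℝ)⁻¹ * (R : Measure (ℝ × ℝ)).real A := by
    intro R hR A
    rw [R.toMeasure_normalize_eq_of_nonzero hR]
    rw [measureReal_def, Measure.smul_apply, ENNReal.smul_def, smul_eq_mul, ENNReal.toReal_mul]
    rfl
  rw [hreal Q hQ]
  have h1 := ((ENNReal.tendsto_toReal (measure_ne_top _ _)).comp (h s hs t ht)).const_mul
    ((Q.mass : ℝ)⁻¹)
  refine h1.congr' ?_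
  filter_upwards [hm] with i hi
  have hP : P i ≠ 0 := by
    rw [← (P i).mass_nonzero_iff, hi]; exact hQm
  rw [hreal (P i) hP, hi]
  rfl

/-- The constant sequence `P` converges weakly to both `P` and `Q`, and weak limits are unique. -/
theorem ext_of_quadrants {P Q : Measure (ℝ × ℝ)} [IsFiniteMeasure P] [IsFiniteMeasure Q]
    {T : Set ℝ} (hT : Dense T) (hmass : P univ = Q univ)
    (h : ∀ s ∈ T, ∀ t ∈ T, P (Iio s ×ˢ Iio t) = Q (Iio s ×ˢ Iio t)) : P = Q := by
  set P' : FiniteMeasure (ℝ × ℝ) := ⟨P, inferInstance⟩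
  set Q' : FiniteMeasure (ℝ × ℝ) := ⟨Q, inferInstance⟩
  have h1 : Tendsto (fun _ : ℕ => P') atTop (𝓝 Q') :=
    tendsto_finiteMeasure_of_quadrants hT (Eventually.of_forall fun _ => hmass)
      fun s hs t ht => by
        change Tendsto (fun _ => P (Iio s ×ˢ Iio t)) _ (𝓝 (Q (Iio s ×ˢ Iio t)))
        rw [h s hs t ht]
        exact tendsto_const_nhds
  exact congrArg (fun R : FiniteMeasure (ℝ × ℝ) => (R : Measure (ℝ × ℝ)))
    (tendsto_nhds_unique tendsto_const_nhds h1)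

/-! ### Measures near an open interval -/

section Interval

variable {I : Set ℝ}

theorem mem_or_lowerBounds_or_upperBounds (hI : OrdConnected I) (s : ℝ) :
    s ∈ I ∨ s ∈ lowerBounds I ∨ s ∈ upperBounds I := by
  by_contra! h
  obtain ⟨h1, h2, h3⟩ := h
  simp only [lowerBounds, upperBounds, mem_ofPred_eq, not_forall, not_le] at h2 h3
  obtain ⟨x, hx, hxs⟩ := h2
  obtain ⟨y, hy, hsy⟩ := h3
  exact h1 (hI.out hx hy ⟨hxs.le, hsy.le⟩)

theorem exists_rat_lt_mem (hI : IsOpen I) {x : ℝ} (hx : x ∈ I) :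
    ∃ q : ℚ, (q : ℝ) ∈ I ∧ (q : ℝ) < x := by
  have h1 : ∀ᶠ t in 𝓝[<] x, t ∈ I := mem_nhdsWithin_of_mem_nhds (hI.mem_nhds hx)
  obtain ⟨r, hr, hrI⟩ := (mem_nhdsLT_iff_exists_Ioo_subset).1 h1
  obtain ⟨q, hq1, hq2⟩ := exists_rat_btwn (mem_Iio.1 hr)
  exact ⟨q, hrI ⟨hq1, hq2⟩, hq2⟩

theorem exists_rat_gt_mem (hI : IsOpen I) {x : ℝ} (hx : x ∈ I) :
    ∃ q : ℚ, (q : ℝ) ∈ I ∧ x < q := by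
  have h1 : ∀ᶠ t in 𝓝[>] x, t ∈ I := mem_nhdsWithin_of_mem_nhds (hI.mem_nhds hx)
  obtain ⟨r, hr, hrI⟩ := (mem_nhdsGT_iff_exists_Ioo_subset).1 h1
  obtain ⟨q, hq1, hq2⟩ := exists_rat_btwn (mem_Ioi.1 hr)
  exact ⟨q, hrI ⟨hq1, hq2⟩, hq1⟩

/-- Since `I` has no least element, rational left end points in `I` exhaust `I ∩ Iio t` by a
countable directed union. -/
theorem measure_inter_Iio_le (hI : IsOpen I) (P : Measure ℝ) (t : ℝ) {c : ℝ≥0∞}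
    (h : ∀ s ∈ I, P (Ico s t) ≤ c) : P (I ∩ Iio t) ≤ c := by
  have hsub : I ∩ Iio t ⊆ ⋃ q ∈ {q : ℚ | (q : ℝ) ∈ I}, Ico (q : ℝ) t := by
    rintro x ⟨hx, hxt⟩
    obtain ⟨q, hq, hqx⟩ := exists_rat_lt_mem hI hx
    exact mem_biUnion (s := {q : ℚ | (q : ℝ) ∈ I}) hq ⟨hqx.le, hxt⟩
  refine (measure_mono hsub).trans ?_
  rw [measure_biUnion_eq_iSup (to_countable _)]
  · exact iSup₂_le fun q hq => h q hq
  · intro p hp q hq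
    rcases le_total p q with hpq | hpq
    · exact ⟨p, hp, le_rfl, Ico_subset_Ico_left (by exact_mod_cast hpq)⟩
    · exact ⟨q, hq, Ico_subset_Ico_left (by exact_mod_cast hpq), le_rfl⟩

theorem measure_inter_Ici_le (hI : IsOpen I) (P : Measure ℝ) (t : ℝ) {c : ℝ≥0∞}
    (h : ∀ s ∈ I, P (Ico t s) ≤ c) : P (I ∩ Ici t) ≤ c := by
  have hsub : I ∩ Ici t ⊆ ⋃ q ∈ {q : ℚ | (q : ℝ) ∈ I}, Ico t (q : ℝ) := by
    rintro x ⟨hx, hxt⟩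
    obtain ⟨q, hq, hqx⟩ := exists_rat_gt_mem hI hx
    exact mem_biUnion (s := {q : ℚ | (q : ℝ) ∈ I}) hq ⟨hxt, hqx⟩
  refine (measure_mono hsub).trans ?_
  rw [measure_biUnion_eq_iSup (to_countable _)]
  · exact iSup₂_le fun q hq => h q hq
  · intro p hp q hq
    rcases le_total p q with hpq | hpq
    · exact ⟨q, hq, Ico_subset_Ico_right (by exact_mod_cast hpq), le_rfl⟩
    · exact ⟨p, hp, le_rfl, Ico_subset_Ico_right (by exact_mod_cast hpq)⟩

theorem measure_lowerBounds_eq_zero (hne : I.Nonempty) {P : Measure ℝ}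
    (h : ∀ s ∈ lowerBounds I, P (Iic s) = 0) : P (lowerBounds I) = 0 := by
  by_cases hb : BddBelow I
  · exact measure_mono_null (fun s hs => le_csInf hne hs) (h (sInf I) fun x hx => csInf_le hb hx)
  · rw [show lowerBounds I = ∅ from not_nonempty_iff_eq_empty.1 hb, measure_empty]

theorem measure_univ_le_of_Iio (hIo : IsOpen I) (hne : I.Nonempty)
    {P : Measure ℝ} {c : ℝ≥0∞} (h : ∀ t ∈ I, P (Iio t) ≤ c)
    (h' : ∀ s ∈ upperBounds I, P (Ici s) = 0) : P univ ≤ c := by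
  have h0 : P (upperBounds I) = 0 := by
    by_cases hb : BddAbove I
    · exact measure_mono_null (fun s hs => csSup_le hne hs)
        (h' (sSup I) fun x hx => le_csSup hb hx)
    · rw [show upperBounds I = ∅ from not_nonempty_iff_eq_empty.1 hb, measure_empty]
  have hsub : univ ⊆ (⋃ q ∈ {q : ℚ | (q : ℝ) ∈ I}, Iio (q : ℝ)) ∪ upperBounds I := by
    intro x _
    rw [mem_union]
    by_contra! hx
    simp only [mem_iUnion, not_exists, mem_Iio, not_lt, mem_ofPred_eq] at hx
    refine hx.2 fun y hy => ?_
    obtain ⟨q, hq, hyq⟩ := exists_rat_gt_mem hIo hy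
    exact hyq.le.trans (hx.1 q hq)
  refine (measure_mono hsub).trans ((measure_union_le _ _).trans ?_)
  rw [h0, add_zero, measure_biUnion_eq_iSup (to_countable _)]
  · exact iSup₂_le fun q hq => h q hq
  · intro p hp q hq
    rcases le_total p q with hpq | hpq
    · exact ⟨q, hq, Iio_subset_Iio (by exact_mod_cast hpq), le_rfl⟩
    · exact ⟨p, hp, le_rfl, Iio_subset_Iio (by exact_mod_cast hpq)⟩

/-- The measures live on the closure of `I`. An atom at the left end is seen by `Iio t` for `t ∈ I`,
one at the right end by the total mass. -/
theorem ext_of_Iio_mem (hI : OrdConnected I) (hne : I.Nonempty)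
    {P Q : Measure ℝ} [IsFiniteMeasure P] [IsFiniteMeasure Q] (huniv : P univ = Q univ)
    (h : ∀ t ∈ I, P (Iio t) = Q (Iio t))
    (hP : ∀ s ∈ lowerBounds I, P (Iio s) = 0) (hQ : ∀ s ∈ lowerBounds I, Q (Iio s) = 0)
    (hP' : ∀ s ∈ upperBounds I, P (Ioi s) = 0) (hQ' : ∀ s ∈ upperBounds I, Q (Ioi s) = 0) :
    P = Q := by
  have key : ∀ t, P (Iio t) = Q (Iio t) := by
    intro t
    rcases mem_or_lowerBounds_or_upperBounds hI t with ht | ht | ht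
    · exact h t ht
    · rw [hP t ht, hQ t ht]
    by_cases hex : ∃ t' < t, t' ∈ upperBounds I
    · obtain ⟨t', htt, ht'⟩ := hex
      have e : ∀ R : Measure ℝ, R (Ioi t') = 0 → R (Iio t) = R univ := by
        intro R hR
        have h0 : R (Iio t)ᶜ = 0 := measure_mono_null (fun x hx => by
          rw [compl_Iio, mem_Ici] at hx; exact htt.trans_le hx) hR
        exact measure_of_measure_compl_eq_zero h0
      rw [e P (hP' t' ht'), e Q (hQ' t' ht'), huniv]
    -- Now `t` is the supremum of `I`, so its value is a left limit of values at points of `I`,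
    -- unless `t` is in `I`.
    · push Not at hex
      obtain ⟨x₀, hx₀⟩ := hne
      have hx₀t : x₀ < t ∨ x₀ = t := (ht hx₀).lt_or_eq
      rcases hx₀t with hx₀t | rfl
      · have hev : ∀ᶠ r in 𝓝[<] t, r ∈ I := by
          filter_upwards [Ioo_mem_nhdsLT hx₀t] with r hr
          have h1 := hex r hr.2
          simp only [upperBounds, mem_ofPred_eq, not_forall, not_le] at h1
          obtain ⟨y, hy, hry⟩ := h1
          exact hI.out hx₀ hy ⟨hr.1.le, hry.le⟩
        refine tendsto_nhds_unique (tendsto_measure_Iio_nhdsLT P t)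
          ((tendsto_measure_Iio_nhdsLT Q t).congr' ?_)
        filter_upwards [hev] with r hr
        exact (h r hr).symm
      · exact h _ hx₀
  refine Measure.ext_of_Ici P Q fun t => ?_
  rw [← compl_Iio, measure_compl measurableSet_Iio (measure_ne_top _ _),
    measure_compl measurableSet_Iio (measure_ne_top _ _), huniv, key]

end Interval

/-! ### Strongly multiplicative plans -/

theorem measurableSet_fst_le_snd : MeasurableSet {p : ℝ × ℝ | p.1 ≤ p.2} :=
  measurableSet_le measurable_fst measurable_snd

section Multiplicative

variable {η₁ η₂ : Measure ℝ}

theorem restrict_prod_apply_of_le [SFinite η₂] {A B : Set ℝ} (hA : MeasurableSet A)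
    (hB : MeasurableSet B) (hAB : ∀ x ∈ A, ∀ y ∈ B, x ≤ y) :
    (η₁.prod η₂).restrict {p : ℝ × ℝ | p.1 ≤ p.2} (A ×ˢ B) = η₁ A * η₂ B := by
  rw [Measure.restrict_apply (hA.prod hB), inter_eq_left.2 fun p hp => hAB p.1 hp.1 p.2 hp.2,
    Measure.prod_prod]

theorem restrict_prod_apply_of_lt {A B : Set ℝ} (hA : MeasurableSet A) (hB : MeasurableSet B)
    (hAB : ∀ x ∈ A, ∀ y ∈ B, y < x) :
    (η₁.prod η₂).restrict {p : ℝ × ℝ | p.1 ≤ p.2} (A ×ˢ B) = 0 := by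
  rw [Measure.restrict_apply (hA.prod hB)]
  convert measure_empty (μ := η₁.prod η₂)
  ext p
  simp only [mem_inter_iff, mem_prod, mem_ofPred_eq, mem_empty_iff_false, iff_false, not_and,
    not_le]
  exact fun hp => hAB p.1 hp.1 p.2 hp.2

theorem restrict_prod_apply_fst [SFinite η₂] {A : Set ℝ} (hA : MeasurableSet A) :
    (η₁.prod η₂).restrict {p : ℝ × ℝ | p.1 ≤ p.2} (A ×ˢ univ) = ∫⁻ x in A, η₂ (Ici x) ∂η₁ := by
  have hm := (hA.prod MeasurableSet.univ).inter measurableSet_fst_le_snd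
  rw [Measure.restrict_apply (hA.prod MeasurableSet.univ), Measure.prod_apply hm,
    ← lintegral_indicator hA]
  refine lintegral_congr fun x => ?_
  by_cases hx : x ∈ A
  · rw [indicator_of_mem hx]
    congr 1
    ext y
    simp [hx]
  · rw [indicator_of_notMem hx]
    convert measure_empty (μ := η₂)
    ext y
    simp [hx]

theorem restrict_prod_apply_snd [SFinite η₁] [SFinite η₂] {B : Set ℝ} (hB : MeasurableSet B) :
    (η₁.prod η₂).restrict {p : ℝ × ℝ | p.1 ≤ p.2} (univ ×ˢ B) = ∫⁻ y in B, η₁ (Iic y) ∂η₂ := by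
  have hm := (MeasurableSet.univ.prod hB).inter measurableSet_fst_le_snd
  rw [Measure.restrict_apply (MeasurableSet.univ.prod hB), Measure.prod_apply_symm hm,
    ← lintegral_indicator hB]
  refine lintegral_congr fun y => ?_
  by_cases hy : y ∈ B
  · rw [indicator_of_mem hy]
    congr 1
    ext x
    simp [hy]
  · rw [indicator_of_notMem hy]
    convert measure_empty (μ := η₁)
    ext x
    simp [hy]

end Multiplicative

/-- `m` and `n` are the marginals of the restriction of the transport problem from `μ` to `ν` to
the interval `I`: they restrict to `μ` and `ν` on `I`, and apart from this `m` may have an atom at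
the left and `n` an atom at the right end point. -/
structure ComponentMarginals (μ ν : Measure ℝ) (I : Set ℝ) (m n : Measure ℝ) : Prop where
  measure_univ_eq : m univ = n univ
  left_restrict : m.restrict I = μ.restrict I
  right_restrict : n.restrict I = ν.restrict I
  left_Iio : ∀ s ∈ lowerBounds I, m (Iio s) = 0
  left_Ici : ∀ s ∈ upperBounds I, m (Ici s) = 0
  right_Iic : ∀ s ∈ lowerBounds I, n (Iic s) = 0
  right_Ioi : ∀ s ∈ upperBounds I, n (Ioi s) = 0
  balance : ∀ t ∈ I, m (Iio t) + ν (Iio t) = μ (Iio t) + n (Iio t)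

section Component

variable {μ ν m n : Measure ℝ} {I : Set ℝ}

/-- By `balance`, the component has the same net flow through `t` as the whole problem; without
reverse flow, the net flow is the crossing mass. -/
theorem ComponentMarginals.cross_eq_sub [IsFiniteMeasure ν] [IsFiniteMeasure n]
    (hc : ComponentMarginals μ ν I m n)
    {K : Measure (ℝ × ℝ)} (hK : K ∈ Marg m n) {t : ℝ} (ht : t ∈ I)
    (h0 : K (Ici t ×ˢ Iio t) = 0) : K (Iio t ×ˢ Ici t) = μ (Iio t) - ν (Iio t) := by
  have h1 := Marg.cross_add hK t
  rw [h0, zero_add] at h1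
  have h2 := hc.balance t ht
  rw [← h1] at h2
  refine ENNReal.eq_sub_of_add_eq (measure_ne_top _ _) ?_
  refine (ENNReal.add_left_inj (measure_ne_top n (Iio t))).1 ?_
  rw [← h2]; ring

theorem restrict_apply_of_subset {P Q : Measure ℝ} (h : P.restrict I = Q.restrict I) {A : Set ℝ}
    (hA : MeasurableSet A) (hAI : A ⊆ I) : P A = Q A := by
  rw [← inter_eq_left.2 hAI, ← Measure.restrict_apply hA, h, Measure.restrict_apply hA]

theorem restrict_eq_of_subset {P Q : Measure ℝ} (h : P.restrict I = Q.restrict I) {A : Set ℝ}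
    (hAI : A ⊆ I) : P.restrict A = Q.restrict A := by
  rw [← Measure.restrict_restrict_of_subset hAI, h, Measure.restrict_restrict_of_subset hAI]

variable [IsFiniteMeasure μ] [IsFiniteMeasure ν] [IsFiniteMeasure n]

/-- The distribution function of the first factor of a strongly multiplicative plan solves the
limit equation. -/
theorem ComponentMarginals.flowSolution (hI : IsFlowInterval μ ν I)
    (hc : ComponentMarginals μ ν I m n) {η₁ η₂ : Measure ℝ} [SigmaFinite η₁] [SigmaFinite η₂]
    (hK : (η₁.prod η₂).restrict {p : ℝ × ℝ | p.1 ≤ p.2} ∈ Marg m n) :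
    (∀ t ∈ I, η₁ (Iio t) * η₂ (Ici t) = μ (Iio t) - ν (Iio t)) ∧
    (∀ t ∈ I, η₁ (Iio t) ≠ 0 ∧ η₁ (Iio t) ≠ ∞) ∧
    FlowSolution μ I (fun t => (η₁ (Iio t)).toReal)
      (fun t => (μ (Iio t) - ν (Iio t)).toReal) := by
  have hcross : ∀ t ∈ I, η₁ (Iio t) * η₂ (Ici t) = μ (Iio t) - ν (Iio t) := by
    intro t ht
    rw [← restrict_prod_apply_of_le measurableSet_Iio measurableSet_Ici fun x hx y hy =>
      (mem_Iio.1 hx).le.trans (mem_Ici.1 hy)]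
    exact hc.cross_eq_sub hK ht (restrict_prod_apply_of_lt measurableSet_Ici measurableSet_Iio
      fun x hx y hy => (mem_Iio.1 hy).trans_le (mem_Ici.1 hx))
  have hD0 : ∀ t ∈ I, μ (Iio t) - ν (Iio t) ≠ 0 := fun t ht =>
    (tsub_pos_of_lt (hI.lt ht)).ne'
  have hg0 : ∀ t ∈ I, η₁ (Iio t) ≠ 0 := fun t ht h => hD0 t ht (by
    rw [← hcross t ht, h, zero_mul])
  have hh0 : ∀ t ∈ I, η₂ (Ici t) ≠ 0 := fun t ht h => hD0 t ht (by
    rw [← hcross t ht, h, mul_zero])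
  have hDt : ∀ t, μ (Iio t) - ν (Iio t) ≠ ∞ := fun t => by finiteness
  have hgt : ∀ t ∈ I, η₁ (Iio t) ≠ ∞ := fun t ht h => hDt t (by
    rw [← hcross t ht, h, ENNReal.top_mul (hh0 t ht)])
  have hht : ∀ t ∈ I, η₂ (Ici t) ≠ ∞ := fun t ht h => hDt t (by
    rw [← hcross t ht, h, ENNReal.mul_top (hg0 t ht)])
  have hhm : Measurable fun x => η₂ (Ici x) := (antitone_measure_Ici η₂).measurable
  -- On `I`, where `m` is μ, this reads dη₁ = dμ / h with h the tail of `η₂`. As g h = D for g the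
  -- distribution function of `η₁`, it is the equation dg = (g / D) dμ.
  have hm : m = η₁.withDensity fun x => η₂ (Ici x) := by
    ext A hA
    rw [withDensity_apply _ hA, ← restrict_prod_apply_fst hA]
    conv_lhs => rw [← hK.1, Measure.map_apply measurable_fst hA, ← prod_univ]
  refine ⟨hcross, fun t ht => ⟨hg0 t ht, hgt t ht⟩, ?_⟩
  refine flowSolution_toReal hI.ordConnected (monotone_measure_Iio _) (measurable_sub_Iio μ ν)
    hg0 hgt hD0 fun s hs t ht hst => ?_
  have hsub : Ico s t ⊆ I := Ico_subset_Icc_self.trans (hI.ordConnected.out hs ht)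
  have hgD : Measurable fun x => η₁ (Iio x) / (μ (Iio x) - ν (Iio x)) :=
    (monotone_measure_Iio _).measurable.div (measurable_sub_Iio μ ν)
  have e : ∫⁻ x in Ico s t, η₁ (Iio x) / (μ (Iio x) - ν (Iio x)) ∂μ = η₁ (Ico s t) := by
    rw [← restrict_eq_of_subset hc.left_restrict hsub, hm, restrict_withDensity measurableSet_Ico,
      lintegral_withDensity_eq_lintegral_mul _ hhm hgD, ← setLIntegral_one]
    refine setLIntegral_congr_fun measurableSet_Ico fun x hx => ?_
    have hx := hsub hx
    simp only [Pi.mul_apply]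
    rw [← hcross x hx, ← mul_div_assoc, mul_comm, ENNReal.div_self]
    · exact mul_ne_zero (hg0 x hx) (hh0 x hx)
    · exact ENNReal.mul_ne_top (hgt x hx) (hht x hx)
  rw [e, ← measure_union _ measurableSet_Ico, Iio_union_Ico_eq_Iio hst]
  rw [disjoint_left]
  intro x hx hx'
  exact not_lt.2 hx'.1 (mem_Iio.1 hx)

/-- The factors can be rescaled by reciprocal constants, but g(t)/g(s) is fixed by the flow equation
and g(t) h(t) by the net flow, hence so is g(s) h(t). -/
theorem ComponentMarginals.eq_of_multiplicative [IsFiniteMeasure m] (hI : IsFlowInterval μ ν I)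
    (hc : ComponentMarginals μ ν I m n) {K K' : Measure (ℝ × ℝ)} (hK : K ∈ Marg m n)
    (hK' : K' ∈ Marg m n) (hs : IsStronglyMultiplicative K) (hs' : IsStronglyMultiplicative K') :
    K = K' := by
  obtain ⟨η₁, η₂, h₁, h₂, rfl⟩ := hs
  obtain ⟨θ₁, θ₂, h₁', h₂', rfl⟩ := hs'
  obtain ⟨hcr, hne, hfl⟩ := hc.flowSolution hI hK
  obtain ⟨hcr', hne', hfl'⟩ := hc.flowSolution hI hK'
  have hfin : IsFiniteMeasure ((η₁.prod η₂).restrict {p : ℝ × ℝ | p.1 ≤ p.2}) :=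
    ⟨(Marg.measure_ne_top hK univ).lt_top⟩
  have hfin' : IsFiniteMeasure ((θ₁.prod θ₂).restrict {p : ℝ × ℝ | p.1 ≤ p.2}) :=
    ⟨(Marg.measure_ne_top hK' univ).lt_top⟩
  have hfst : ∀ {L : Measure (ℝ × ℝ)}, L ∈ Marg m n → ∀ s, L (Iio s ×ˢ univ) = m (Iio s) := by
    intro L hL s
    rw [← hL.1, Measure.map_apply measurable_fst measurableSet_Iio, prod_univ]
  have hsnd : ∀ {L : Measure (ℝ × ℝ)}, L ∈ Marg m n → ∀ {B : Set ℝ}, MeasurableSet B →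
      L (univ ×ˢ B) = n B := by
    intro L hL B hB
    rw [← hL.2, Measure.map_apply measurable_snd hB, univ_prod]
  have hin : ∀ s ∈ I, ∀ t ∈ I, s ≤ t → η₁ (Iio s) * η₂ (Ici t) = θ₁ (Iio s) * θ₂ (Ici t) := by
    intro s hs t ht hst
    obtain ⟨d₀, hd₀, hd⟩ := hI.exists_le s hs t ht
    have hsub : Icc s t ⊆ I := hI.ordConnected.out hs ht
    have hd' : ∀ x ∈ Icc s t, d₀ ≤ (μ (Iio x) - ν (Iio x)).toReal := fun x hx =>
      IsFlowInterval.le_toReal_sub (hd x hx)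
    have hratio := tendsto_nhds_unique
      (FlowSolution.tendsto_ratio (l := (atTop : Filter ℕ)) hst hd₀
        (Eventually.of_forall fun _ => hfl.mono_set hsub) (hfl'.mono_set hsub)
        (Eventually.of_forall fun _ => hd') hd' fun _ _ => tendsto_const_nhds)
      tendsto_const_nhds
    have e : ∀ x y z w : ℝ≥0∞, x ≠ 0 → x ≠ ∞ → y ≠ 0 → y ≠ ∞ → x * z = w →
        y * z = w / (x / y) := by
      intro x y z w hx hx' hy hy' h
      rw [← h, ENNReal.div_eq_inv_mul, ENNReal.inv_div (Or.inl hy') (Or.inl hy),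
        ENNReal.div_eq_inv_mul]
      calc y * z = (x⁻¹ * x) * (y * z) := by rw [ENNReal.inv_mul_cancel hx hx', one_mul]
        _ = _ := by ring
    rw [e _ _ _ _ (hne t ht).1 (hne t ht).2 (hne s hs).1 (hne s hs).2 (hcr t ht),
      e _ _ _ _ (hne' t ht).1 (hne' t ht).2 (hne' s hs).1 (hne' s hs).2 (hcr' t ht)]
    congr 1
    rw [← ENNReal.toReal_eq_toReal_iff' (ENNReal.div_ne_top (hne t ht).2 (hne s hs).1)
      (ENNReal.div_ne_top (hne' t ht).2 (hne' s hs).1), ENNReal.toReal_div, ENNReal.toReal_div]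
    exact hratio.symm
  have hall : ∀ s t, s ≤ t → n {t} = 0 →
      (η₁.prod η₂).restrict {p : ℝ × ℝ | p.1 ≤ p.2} (Iio s ×ˢ Ici t) =
        (θ₁.prod θ₂).restrict {p : ℝ × ℝ | p.1 ≤ p.2} (Iio s ×ˢ Ici t) := by
    intro s t hst hnt
    have hle : ∀ x ∈ Iio s, ∀ y ∈ Ici t, x ≤ y := fun x hx y hy =>
      ((mem_Iio.1 hx).le.trans hst).trans (mem_Ici.1 hy)
    rcases mem_or_lowerBounds_or_upperBounds hI.ordConnected t with ht | ht | ht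
    · rcases mem_or_lowerBounds_or_upperBounds hI.ordConnected s with hs | hs | hs
      · rw [restrict_prod_apply_of_le measurableSet_Iio measurableSet_Ici hle,
          restrict_prod_apply_of_le measurableSet_Iio measurableSet_Ici hle]
        exact hin s hs t ht hst
      · have h0 := hc.left_Iio s hs
        rw [measure_mono_null (prod_mono_right (subset_univ _)) ((hfst hK s).trans h0),
          measure_mono_null (prod_mono_right (subset_univ _)) ((hfst hK' s).trans h0)]
      · have hst' : s = t := le_antisymm hst (hs ht)
        subst hst'
        rw [restrict_prod_apply_of_le measurableSet_Iio measurableSet_Ici hle,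
          restrict_prod_apply_of_le measurableSet_Iio measurableSet_Ici hle]
        exact hin s ht s ht le_rfl
    · have h0 := hc.left_Iio s fun x hx => hst.trans (ht hx)
      rw [measure_mono_null (prod_mono_right (subset_univ _)) ((hfst hK s).trans h0),
        measure_mono_null (prod_mono_right (subset_univ _)) ((hfst hK' s).trans h0)]
    -- `n` may have an atom at the right end of `I`; `hnt` excludes that `t` carries it.
    · have h0 : n (Ici t) = 0 := by
        rw [← Ioi_union_left]
        exact measure_union_null (hc.right_Ioi t ht) hnt
      rw [measure_mono_null (prod_mono_left (subset_univ _)) ((hsnd hK measurableSet_Ici).trans h0),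
        measure_mono_null (prod_mono_left (subset_univ _))
          ((hsnd hK' measurableSet_Ici).trans h0)]
  refine ext_of_quadrants (dense_setOf_measure_singleton_eq_zero n) ?_ fun s _ t ht => ?_
  · rw [← univ_prod_univ, hsnd hK MeasurableSet.univ, hsnd hK' MeasurableSet.univ]
  · rcases le_total s t with hst | hst
    · have e : ∀ L : Measure (ℝ × ℝ), L (Iio s ×ˢ univ) =
          L (Iio s ×ˢ Iio t) + L (Iio s ×ˢ Ici t) := by
        intro L
        rw [← Iio_union_Ici (a := t), prod_union, measure_union _
          (measurableSet_Iio.prod measurableSet_Ici)]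
        rw [disjoint_left]
        rintro p ⟨-, hp⟩ ⟨-, hp'⟩
        exact (not_lt.2 (mem_Ici.1 hp')) (mem_Iio.1 hp)
      have h1 := e ((η₁.prod η₂).restrict {p : ℝ × ℝ | p.1 ≤ p.2})
      rw [hfst hK, ← hfst hK', e, hall s t hst ht,
        ENNReal.add_left_inj (measure_ne_top _ _)] at h1
      exact h1.symm
    -- For t ≤ s, the constraints x ≤ y and y < t already force x < s, so the quadrant mass is a
    -- value of the second marginal.
    · have e : ∀ ζ₁ ζ₂ : Measure ℝ,
          (ζ₁.prod ζ₂).restrict {p : ℝ × ℝ | p.1 ≤ p.2} (Iio s ×ˢ Iio t) =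
          (ζ₁.prod ζ₂).restrict {p : ℝ × ℝ | p.1 ≤ p.2} (univ ×ˢ Iio t) := by
        intro ζ₁ ζ₂
        rw [Measure.restrict_apply (measurableSet_Iio.prod measurableSet_Iio),
          Measure.restrict_apply (MeasurableSet.univ.prod measurableSet_Iio)]
        congr 1
        ext p
        simp only [mem_inter_iff, mem_prod, mem_Iio, mem_ofPred_eq, mem_univ, true_and]
        exact ⟨fun h => ⟨h.1.2, h.2⟩, fun h => ⟨⟨(h.2.trans_lt h.1).trans_le hst, h.1⟩, h.2⟩⟩
      rw [e, e, hsnd hK measurableSet_Iio, hsnd hK' measurableSet_Iio]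

end Component

/-! ### Construction of the Kellerer plan of a component -/

theorem withDensity_restrict_apply {P : Measure ℝ} {I : Set ℝ} {f : ℝ → ℝ≥0∞} {A : Set ℝ}
    (hA : MeasurableSet A) (hAI : A ⊆ I) :
    (P.restrict I).withDensity f A = ∫⁻ x in A, f x ∂P := by
  rw [withDensity_apply _ hA, Measure.restrict_restrict_of_subset hAI]

theorem withDensity_restrict_apply_inter {P : Measure ℝ} {I : Set ℝ} {f : ℝ → ℝ≥0∞}
    (hI : MeasurableSet I) {A : Set ℝ} (hA : MeasurableSet A) :
    (P.restrict I).withDensity f A = (P.restrict I).withDensity f (I ∩ A) := by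
  rw [withDensity_apply _ hA, withDensity_apply _ (hI.inter hA), Measure.restrict_restrict hA,
    Measure.restrict_restrict (hI.inter hA), inter_comm A I, inter_right_comm, inter_self]

namespace LimitFlow

variable {μ ν : Measure ℝ} {I : Set ℝ} {g h k : ℝ → ℝ≥0∞}

theorem g_mono (hf : LimitFlow μ ν I g h k) {s t : ℝ} (hs : s ∈ I) (ht : t ∈ I) (hst : s ≤ t) :
    g s ≤ g t := by
  rw [hf.g_eq s hs t ht hst]; exact le_self_add

theorem h_anti (hf : LimitFlow μ ν I g h k) {s t : ℝ} (hs : s ∈ I) (ht : t ∈ I) (hst : s ≤ t) :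
    h t ≤ h s := by
  rw [hf.h_eq s hs t ht hst]; exact le_self_add

theorem k_ne_zero (hf : LimitFlow μ ν I g h k) {t : ℝ} (ht : t ∈ I) : k t ≠ 0 := by
  rw [hf.k_eq t ht]
  intro h0
  exact hf.g_ne_zero t ht (add_eq_zero.1 h0).1

theorem h_ne_top [IsFiniteMeasure μ] (hf : LimitFlow μ ν I g h k) {t : ℝ} (ht : t ∈ I) :
    h t ≠ ∞ := by
  intro h0
  have := hf.mul_eq t ht
  rw [h0, ENNReal.mul_top (hf.g_ne_zero t ht)] at this
  exact (by finiteness : μ (Iio t) - ν (Iio t) ≠ ∞) this.symm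

variable [IsFiniteMeasure ν]

theorem h_ne_zero (hf : LimitFlow μ ν I g h k) (hI : IsFlowInterval μ ν I) {t : ℝ} (ht : t ∈ I) :
    h t ≠ 0 := by
  intro h0
  have := hf.mul_eq t ht
  rw [h0, mul_zero] at this
  exact (tsub_pos_of_lt (hI.lt ht)).ne this

/-- Equal total masses bound `g s * h s` by `ν (Ici s)`, which vanishes at +∞, while `g` stays above
the positive value `g t`. So no atom is needed at an infinite right end. -/
theorem iInf_h_eq_zero (hf : LimitFlow μ ν I g h k) (hI : IsFlowInterval μ ν I)
    (hmass : μ univ = ν univ) (hb : ¬BddAbove I) : ⨅ s ∈ I, h s = 0 := by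
  obtain ⟨t, ht⟩ := hI.nonempty
  have hev : ∀ᶠ s in atTop, s ∈ I ∧ t ≤ s := by
    refine (eventually_ge_atTop t).mono fun s hs => ⟨?_, hs⟩
    rw [not_bddAbove_iff] at hb
    obtain ⟨x, hx, hxs⟩ := hb s
    exact hI.ordConnected.out ht hx ⟨hs, hxs.le⟩
  have hlim : Tendsto (fun s => ν (Ici s)) atTop (𝓝 0) := by
    have := tendsto_measure_iInter_atTop (μ := ν) (s := fun s : ℝ => Ici s)
      (fun _ => measurableSet_Ici.nullMeasurableSet) (fun _ _ h => Ici_subset_Ici.2 h)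
      ⟨0, measure_ne_top _ _⟩
    rw [show (⋂ s : ℝ, Ici s) = ∅ by
      ext x; simp only [mem_iInter, mem_Ici, mem_empty_iff_false, iff_false, not_forall, not_le]
      exact ⟨x + 1, by linarith⟩, measure_empty] at this
    exact this
  have h1 : g t * (⨅ s ∈ I, h s) ≤ 0 := by
    refine ge_of_tendsto hlim ?_
    filter_upwards [hev] with s hs
    calc g t * (⨅ s ∈ I, h s) ≤ g s * h s := by
          gcongr
          · exact hf.g_mono ht hs.1 hs.2
          · exact iInf₂_le s hs.1
      _ = _ := hf.mul_eq s hs.1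
      _ ≤ _ := by
        rw [tsub_le_iff_right, ← compl_Iio, add_comm, measure_add_measure_compl measurableSet_Iio,
          ← hmass]
        exact measure_mono (subset_univ _)
  have h2 := le_antisymm h1 zero_le
  exact (mul_eq_zero.1 h2).resolve_left (hf.g_ne_zero t ht)

variable [IsFiniteMeasure μ]

theorem k_ne_top (hf : LimitFlow μ ν I g h k) (hI : IsFlowInterval μ ν I) {t : ℝ} (ht : t ∈ I) :
    k t ≠ ∞ := by
  rw [hf.k_eq t ht]
  exact ENNReal.add_ne_top.2 ⟨hf.g_ne_top t ht, ENNReal.mul_ne_top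
    (ENNReal.inv_ne_top.2 (hf.h_ne_zero hI ht)) (measure_ne_top _ _)⟩

/-- The mirror argument at -∞, with `g s * h s ≤ μ (Iio s)`. -/
theorem iInf_g_eq_zero (hf : LimitFlow μ ν I g h k) (hI : IsFlowInterval μ ν I)
    (hb : ¬BddBelow I) : ⨅ s ∈ I, g s = 0 := by
  obtain ⟨t, ht⟩ := hI.nonempty
  have hev : ∀ᶠ s in atBot, s ∈ I ∧ s ≤ t := by
    refine (eventually_le_atBot t).mono fun s hs => ⟨?_, hs⟩
    rw [not_bddBelow_iff] at hb
    obtain ⟨x, hx, hxs⟩ := hb s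
    exact hI.ordConnected.out hx ht ⟨hxs.le, hs⟩
  have hlim : Tendsto (fun s => μ (Iio s)) atBot (𝓝 0) := by
    have := tendsto_measure_iInter_atBot (μ := μ) (s := fun s : ℝ => Iio s)
      (fun _ => measurableSet_Iio.nullMeasurableSet) (fun _ _ h => Iio_subset_Iio h)
      ⟨0, measure_ne_top _ _⟩
    rw [show (⋂ s : ℝ, Iio s) = ∅ by
      ext x; simp only [mem_iInter, mem_Iio, mem_empty_iff_false, iff_false, not_forall]
      exact ⟨x, lt_irrefl x⟩, measure_empty] at this
    exact this
  have h1 : (⨅ s ∈ I, g s) * h t ≤ 0 := by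
    refine ge_of_tendsto hlim ?_
    filter_upwards [hev] with s hs
    calc (⨅ s ∈ I, g s) * h t ≤ g s * h s := by
          gcongr
          · exact iInf₂_le s hs.1
          · exact hf.h_anti hs.1 ht hs.2
      _ = _ := hf.mul_eq s hs.1
      _ ≤ _ := tsub_le_self
  have h2 := le_antisymm h1 zero_le
  exact (mul_eq_zero.1 h2).resolve_right (hf.h_ne_zero hI ht)

/-- The first factor of the Kellerer plan of a component. -/
theorem exists_left_factor (hf : LimitFlow μ ν I g h k) (hI : IsFlowInterval μ ν I) :
    ∃ η : Measure ℝ, SigmaFinite η ∧ (∀ t ∈ I, η (Iio t) = g t) ∧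
      (∀ s ∈ lowerBounds I, η (Iio s) = 0) ∧ (∀ s ∈ upperBounds I, η (Ici s) = 0) ∧
      ∀ y ∈ I, η (Iic y) = k y := by
  -- The limit of `g` at the left end becomes an atom there. If `I` is unbounded below, `sInf I` is
  -- the default value 0, but then `g₀ = 0` by `iInf_g_eq_zero`.
  set g₀ : ℝ≥0∞ := ⨅ s ∈ I, g s with hg₀
  set P : Measure ℝ := (μ.restrict I).withDensity fun x => (h x)⁻¹ with hP
  have hIm := hI.isOpen.measurableSet
  have hg₀t : g₀ ≠ ∞ := by
    obtain ⟨s, hs⟩ := hI.nonempty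
    exact ne_top_of_le_ne_top (hf.g_ne_top s hs) (iInf₂_le s hs)
  have hne : ∀ s ∈ lowerBounds I, s ∉ I := by
    intro s hs hsI
    obtain ⟨q, hq, hqs⟩ := exists_rat_lt_mem hI.isOpen hsI
    exact not_le.2 hqs (hs hq)
  have hne' : ∀ s ∈ upperBounds I, s ∉ I := by
    intro s hs hsI
    obtain ⟨q, hq, hqs⟩ := exists_rat_gt_mem hI.isOpen hsI
    exact not_le.2 hqs (hs hq)
  have hbdd : g₀ ≠ 0 → BddBelow I := fun h0 => by
    by_contra hb; exact h0 (hf.iInf_g_eq_zero hI hb)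
  have hinf : BddBelow I → sInf I ∈ lowerBounds I := fun hb x hx => csInf_le hb hx
  have hatom : ∀ A : Set ℝ, MeasurableSet A → (BddBelow I → sInf I ∉ A) →
      (g₀ • Measure.dirac (sInf I)) A = 0 := by
    intro A hA h0
    rw [Measure.smul_apply, smul_eq_mul, Measure.dirac_apply' _ hA]
    by_cases hg : g₀ = 0
    · rw [hg, zero_mul]
    · rw [indicator_of_notMem (h0 (hbdd hg)), mul_zero]
  have hatom' : ∀ t ∈ I, (g₀ • Measure.dirac (sInf I)) (Iio t) = g₀ := by
    intro t ht
    rw [Measure.smul_apply, smul_eq_mul, Measure.dirac_apply' _ measurableSet_Iio]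
    by_cases hg : g₀ = 0
    · rw [hg, zero_mul]
    · have hb := hbdd hg
      have hlt : sInf I < t := lt_of_le_of_ne (csInf_le hb ht) fun h =>
        hne _ (hinf hb) (h ▸ ht)
      rw [indicator_of_mem (mem_Iio.2 hlt), Pi.one_apply, mul_one]
  have hPg : ∀ s ∈ I, ∀ t ∈ I, s ≤ t → g t = g s + P (Ico s t) := by
    intro s hs t ht hst
    rw [hP, withDensity_restrict_apply measurableSet_Ico
      (Ico_subset_Icc_self.trans (hI.ordConnected.out hs ht))]
    exact hf.g_eq s hs t ht hst
  have hIio : ∀ t ∈ I, P (Iio t) + g₀ = g t := by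
    intro t ht
    apply le_antisymm
    · refine ENNReal.le_sub_iff_add_le_right hg₀t (iInf₂_le t ht) |>.1 ?_
      rw [hP, withDensity_restrict_apply_inter hIm measurableSet_Iio, ← hP]
      refine measure_inter_Iio_le hI.isOpen P t fun s hs => ?_
      rcases le_total s t with hst | hst
      · rw [ENNReal.le_sub_iff_add_le_right hg₀t (iInf₂_le t ht), hPg s hs t ht hst, add_comm]
        gcongr
        exact iInf₂_le s hs
      · rw [Ico_eq_empty (not_lt.2 hst), measure_empty]
        exact zero_le
    · rw [← tsub_le_iff_left]
      refine le_iInf₂ fun s hs => ?_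
      rw [tsub_le_iff_left]
      rcases le_total s t with hst | hst
      · rw [hPg s hs t ht hst, add_comm]
        gcongr
        exact fun x hx => hx.2
      · exact (hf.g_mono ht hs hst).trans le_add_self
  refine ⟨P + g₀ • Measure.dirac (sInf I), ?_, fun t ht => ?_, fun s hs => ?_, fun s hs => ?_,
    fun y hy => ?_⟩
  · have h1 : SigmaFinite P := by
      refine SigmaFinite.withDensity_of_ne_top ?_
      filter_upwards [ae_restrict_mem hIm] with x hx
      exact ENNReal.inv_ne_top.2 (hf.h_ne_zero hI hx)
    have h2 : IsFiniteMeasure (g₀ • Measure.dirac (sInf I)) := Measure.smul_finite _ hg₀t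
    infer_instance
  · rw [Measure.add_apply, hatom' t ht, hIio t ht]
  · rw [Measure.add_apply, hatom _ measurableSet_Iio, hP,
      withDensity_restrict_apply_inter hIm measurableSet_Iio, show I ∩ Iio s = ∅ by
        ext x; simp only [mem_inter_iff, mem_Iio, mem_empty_iff_false, iff_false, not_and, not_lt]
        exact fun hx => hs hx, measure_empty, add_zero]
    exact fun hb => not_lt.2 (le_csInf hI.nonempty hs)
  · have hs' : I ∩ Ici s = ∅ := by
      ext x; simp only [mem_inter_iff, mem_Ici, mem_empty_iff_false, iff_false, not_and, not_le]
      exact fun hx => lt_of_le_of_ne (hs hx) fun h => hne' s hs (h ▸ hx)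
    rw [Measure.add_apply, hatom _ measurableSet_Ici, hP,
      withDensity_restrict_apply_inter hIm measurableSet_Ici, hs', measure_empty, add_zero]
    intro hb
    obtain ⟨x, hx⟩ := hI.nonempty
    rw [mem_Ici, not_le]
    exact (csInf_le hb hx).trans_lt
      (lt_of_le_of_ne (hs hx) fun h => hne' s hs (h ▸ hx))
  · rw [← Iio_union_right, measure_union _ (measurableSet_singleton y), Measure.add_apply,
      hatom' y hy, hIio y hy, Measure.add_apply, hatom _ (measurableSet_singleton y), add_zero, hP,
      withDensity_restrict_apply (measurableSet_singleton y) (singleton_subset_iff.2 hy),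
      lintegral_singleton, hf.k_eq y hy]
    · intro hb h0
      rw [mem_singleton_iff] at h0
      exact hne _ (hinf hb) (h0 ▸ hy)
    · simp

/-- The second factor of the Kellerer plan of a component. -/
theorem exists_right_factor (hf : LimitFlow μ ν I g h k) (hI : IsFlowInterval μ ν I)
    (hmass : μ univ = ν univ) :
    ∃ η : Measure ℝ, SigmaFinite η ∧ (∀ t ∈ I, η (Ici t) = h t) ∧
      (∀ s ∈ lowerBounds I, η (Iic s) = 0) ∧ (∀ s ∈ upperBounds I, η (Ioi s) = 0) ∧
      ∀ A ⊆ I, MeasurableSet A → ∫⁻ y in A, k y ∂η = ν A := by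
  -- The atom at the right end; it vanishes when `sSup I` is a default value, by `iInf_h_eq_zero`.
  set h₀ : ℝ≥0∞ := ⨅ s ∈ I, h s with hh₀
  set P : Measure ℝ := (ν.restrict I).withDensity fun x => (k x)⁻¹ with hP
  have hIm := hI.isOpen.measurableSet
  have hh₀t : h₀ ≠ ∞ := by
    obtain ⟨s, hs⟩ := hI.nonempty
    exact ne_top_of_le_ne_top (hf.h_ne_top hs) (iInf₂_le s hs)
  have hne : ∀ s ∈ lowerBounds I, s ∉ I := by
    intro s hs hsI
    obtain ⟨q, hq, hqs⟩ := exists_rat_lt_mem hI.isOpen hsI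
    exact not_le.2 hqs (hs hq)
  have hne' : ∀ s ∈ upperBounds I, s ∉ I := by
    intro s hs hsI
    obtain ⟨q, hq, hqs⟩ := exists_rat_gt_mem hI.isOpen hsI
    exact not_le.2 hqs (hs hq)
  have hbdd : h₀ ≠ 0 → BddAbove I := fun h0 => by
    by_contra hb; exact h0 (hf.iInf_h_eq_zero hI hmass hb)
  have hsup : BddAbove I → sSup I ∈ upperBounds I := fun hb x hx => le_csSup hb hx
  have hatom : ∀ A : Set ℝ, MeasurableSet A → (BddAbove I → sSup I ∉ A) →
      (h₀ • Measure.dirac (sSup I)) A = 0 := by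
    intro A hA h0
    rw [Measure.smul_apply, smul_eq_mul, Measure.dirac_apply' _ hA]
    by_cases hg : h₀ = 0
    · rw [hg, zero_mul]
    · rw [indicator_of_notMem (h0 (hbdd hg)), mul_zero]
  have hatom' : ∀ t ∈ I, (h₀ • Measure.dirac (sSup I)) (Ici t) = h₀ := by
    intro t ht
    rw [Measure.smul_apply, smul_eq_mul, Measure.dirac_apply' _ measurableSet_Ici]
    by_cases hg : h₀ = 0
    · rw [hg, zero_mul]
    · rw [indicator_of_mem (mem_Ici.2 (le_csSup (hbdd hg) ht)), Pi.one_apply, mul_one]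
  have hPh : ∀ s ∈ I, ∀ t ∈ I, s ≤ t → h s = h t + P (Ico s t) := by
    intro s hs t ht hst
    rw [hP, withDensity_restrict_apply measurableSet_Ico
      (Ico_subset_Icc_self.trans (hI.ordConnected.out hs ht))]
    exact hf.h_eq s hs t ht hst
  have hIci : ∀ t ∈ I, P (Ici t) + h₀ = h t := by
    intro t ht
    apply le_antisymm
    · refine ENNReal.le_sub_iff_add_le_right hh₀t (iInf₂_le t ht) |>.1 ?_
      rw [hP, withDensity_restrict_apply_inter hIm measurableSet_Ici, ← hP]
      refine measure_inter_Ici_le hI.isOpen P t fun s hs => ?_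
      rcases le_total t s with hst | hst
      · rw [ENNReal.le_sub_iff_add_le_right hh₀t (iInf₂_le t ht), hPh t ht s hs hst, add_comm]
        gcongr
        exact iInf₂_le s hs
      · rw [Ico_eq_empty (not_lt.2 hst), measure_empty]
        exact zero_le
    · rw [← tsub_le_iff_left]
      refine le_iInf₂ fun s hs => ?_
      rw [tsub_le_iff_left]
      rcases le_total t s with hst | hst
      · rw [hPh t ht s hs hst, add_comm]
        gcongr
        exact fun x hx => hx.1
      · exact (hf.h_anti hs ht hst).trans le_add_self
  have hsub : ∀ A ⊆ I, MeasurableSet A →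
      (P + h₀ • Measure.dirac (sSup I)).restrict A = P.restrict A := by
    intro A hA hAm
    rw [Measure.restrict_add, Measure.restrict_eq_zero.2 (hatom A hAm fun hb h0 =>
      hne' _ (hsup hb) (hA h0)), add_zero]
  refine ⟨P + h₀ • Measure.dirac (sSup I), ?_, fun t ht => ?_, fun s hs => ?_, fun s hs => ?_,
    fun A hA hAm => ?_⟩
  · have h1 : SigmaFinite P := by
      refine SigmaFinite.withDensity_of_ne_top ?_
      filter_upwards [ae_restrict_mem hIm] with x hx
      exact ENNReal.inv_ne_top.2 (hf.k_ne_zero hx)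
    have h2 : IsFiniteMeasure (h₀ • Measure.dirac (sSup I)) := Measure.smul_finite _ hh₀t
    infer_instance
  · rw [Measure.add_apply, hatom' t ht, hIci t ht]
  · have hs' : I ∩ Iic s = ∅ := by
      ext x; simp only [mem_inter_iff, mem_Iic, mem_empty_iff_false, iff_false, not_and, not_le]
      exact fun hx => lt_of_le_of_ne (hs hx) fun h => hne s hs (h ▸ hx)
    rw [Measure.add_apply, hatom _ measurableSet_Iic, hP,
      withDensity_restrict_apply_inter hIm measurableSet_Iic, hs', measure_empty, add_zero]
    intro hb
    obtain ⟨x, hx⟩ := hI.nonempty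
    rw [mem_Iic, not_le]
    exact (lt_of_le_of_ne (hs hx) fun h => hne s hs (h ▸ hx)).trans_le (le_csSup hb hx)
  · rw [Measure.add_apply, hatom _ measurableSet_Ioi, hP,
      withDensity_restrict_apply_inter hIm measurableSet_Ioi, show I ∩ Ioi s = ∅ by
        ext x; simp only [mem_inter_iff, mem_Ioi, mem_empty_iff_false, iff_false, not_and, not_lt]
        exact fun hx => hs hx, measure_empty, add_zero]
    exact fun hb => not_lt.2 (csSup_le hI.nonempty hs)
  · have hkm : Measurable fun x => (k x)⁻¹ := hf.measurable_k.inv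
    rw [hsub A hA hAm, hP, restrict_withDensity hAm, Measure.restrict_restrict_of_subset hA,
      lintegral_withDensity_eq_lintegral_mul _ hkm hf.measurable_k,
      ← setLIntegral_one]
    refine setLIntegral_congr_fun hAm fun y hy => ?_
    simp only [Pi.mul_apply]
    exact ENNReal.inv_mul_cancel (hf.k_ne_zero (hA hy)) (hf.k_ne_top hI (hA hy))

/-- Existence of the Kellerer plan of a component. -/
theorem exists_multiplicative {m n : Measure ℝ} [IsFiniteMeasure m] [IsFiniteMeasure n]
    (hf : LimitFlow μ ν I g h k) (hI : IsFlowInterval μ ν I) (hmass : μ univ = ν univ)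
    (hc : ComponentMarginals μ ν I m n) :
    ∃ K : Measure (ℝ × ℝ), K ∈ Marg m n ∧ IsStronglyMultiplicative K ∧
      ∀ s ∈ I, ∀ t ∈ I, s ≤ t → K (Iio s ×ˢ Ici t) = g s * h t := by
  obtain ⟨η₁, hσ₁, h1g, h1lo, h1up, h1k⟩ := hf.exists_left_factor hI
  obtain ⟨η₂, hσ₂, h2h, h2lo, h2up, h2k⟩ := hf.exists_right_factor hI hmass
  set K : Measure (ℝ × ℝ) := (η₁.prod η₂).restrict {p : ℝ × ℝ | p.1 ≤ p.2} with hK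
  have hIm := hI.isOpen.measurableSet
  have hcross : ∀ s ∈ I, ∀ t ∈ I, s ≤ t → K (Iio s ×ˢ Ici t) = g s * h t := by
    intro s hs t ht hst
    rw [hK, restrict_prod_apply_of_le measurableSet_Iio measurableSet_Ici fun x hx y hy =>
      ((mem_Iio.1 hx).le.trans hst).trans (mem_Ici.1 hy), h1g s hs, h2h t ht]
  have hrev : ∀ t, K (Ici t ×ˢ Iio t) = 0 := fun t =>
    restrict_prod_apply_of_lt measurableSet_Ici measurableSet_Iio fun x hx y hy =>
      (mem_Iio.1 hy).trans_le (mem_Ici.1 hx)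
  have hKle : ∀ A B : Set ℝ, K (A ×ˢ B) ≤ η₁ A * η₂ B := fun A B =>
    (Measure.restrict_apply_le _ _).trans (Measure.prod_prod A B).le
  have hfst : ∀ {A : Set ℝ}, MeasurableSet A → K.map Prod.fst A = K (A ×ˢ univ) := fun hA => by
    rw [Measure.map_apply measurable_fst hA, prod_univ]
  have hsnd : ∀ {A : Set ℝ}, MeasurableSet A → K.map Prod.snd A = K (univ ×ˢ A) := fun hA => by
    rw [Measure.map_apply measurable_snd hA, univ_prod]
  -- On `I` the second marginal has density `η₁ (Iic y) = k y` with respect to `η₂`, which in turn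
  -- has density `(k y)⁻¹` with respect to ν.
  have hsndI : ∀ A ⊆ I, MeasurableSet A → K.map Prod.snd A = n A := by
    intro A hA hAm
    rw [hsnd hAm, hK, restrict_prod_apply_snd hAm,
      setLIntegral_congr_fun hAm fun y hy => h1k y (hA hy), h2k A hA hAm,
      restrict_apply_of_subset hc.right_restrict hAm hA]
  have hsndlo : ∀ s ∈ lowerBounds I, K.map Prod.snd (Iic s) = 0 := by
    intro s hs
    rw [hsnd measurableSet_Iic]
    exact le_antisymm ((hKle _ _).trans (by rw [h2lo s hs, mul_zero])) zero_le
  have hsndIio : ∀ t ∈ I, K.map Prod.snd (Iio t) = n (Iio t) := by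
    intro t ht
    have e : ∀ Q : Measure ℝ, (∀ s ∈ lowerBounds I, Q (Iic s) = 0) →
        Q (Iio t) = Q (I ∩ Iio t) := by
      intro Q hQ
      refine le_antisymm ?_ (measure_mono inter_subset_right)
      have hsub : Iio t ⊆ (I ∩ Iio t) ∪ lowerBounds I := by
        intro x hx
        rcases mem_or_lowerBounds_or_upperBounds hI.ordConnected x with h | h | h
        · exact Or.inl ⟨h, hx⟩
        · exact Or.inr h
        · exact absurd (h ht) (not_le.2 hx)
      refine (measure_mono hsub).trans ((measure_union_le _ _).trans ?_)
      rw [measure_lowerBounds_eq_zero hI.nonempty hQ, add_zero]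
    rw [e _ hsndlo, e n hc.right_Iic, hsndI _ inter_subset_left (hIm.inter measurableSet_Iio)]
  -- The first marginal needs no integration: nothing flows backwards through `t`, so conservation
  -- of mass yields it from the second marginal and the flow `g t * h t`.
  have hfstIio : ∀ t ∈ I, K.map Prod.fst (Iio t) = m (Iio t) := by
    intro t ht
    have h1 := Marg.cross_add (μ := K.map Prod.fst) (ν := K.map Prod.snd) (π := K) ⟨rfl, rfl⟩ t
    rw [hrev, zero_add, hcross t ht t ht le_rfl, hf.mul_eq t ht, hsndIio t ht] at h1
    rw [← h1]
    refine (ENNReal.add_left_inj (measure_ne_top ν (Iio t))).1 ?_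
    rw [hc.balance t ht, add_right_comm, tsub_add_cancel_of_le (hI.lt ht).le]
  have hfstup : ∀ s ∈ upperBounds I, K.map Prod.fst (Ici s) = 0 := by
    intro s hs
    rw [hfst measurableSet_Ici]
    exact le_antisymm ((hKle _ _).trans (by rw [h1up s hs, zero_mul])) zero_le
  -- Neither measure charges the upper bounds of `I`, so the sets `Iio t` exhaust the mass. The
  -- total mass then fixes the atom of the second marginal at the right end.
  have hfstuniv : K.map Prod.fst univ = m univ := by
    apply le_antisymm
    · exact measure_univ_le_of_Iio hI.isOpen hI.nonempty (fun t ht =>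
        (hfstIio t ht).le.trans (measure_mono (subset_univ _))) hfstup
    · exact measure_univ_le_of_Iio hI.isOpen hI.nonempty (fun t ht =>
        (hfstIio t ht).ge.trans (measure_mono (subset_univ _))) hc.left_Ici
  have hKuniv : K univ = m univ := by
    rw [← hfstuniv, hfst MeasurableSet.univ, univ_prod_univ]
  have hsnduniv : K.map Prod.snd univ = n univ := by
    rw [hsnd MeasurableSet.univ, univ_prod_univ, hKuniv, hc.measure_univ_eq]
  have hfin1 : IsFiniteMeasure (K.map Prod.fst) := ⟨by rw [hfstuniv]; exact measure_lt_top _ _⟩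
  have hfin2 : IsFiniteMeasure (K.map Prod.snd) := ⟨by rw [hsnduniv]; exact measure_lt_top _ _⟩
  refine ⟨K, ⟨?_, ?_⟩, ⟨η₁, η₂, hσ₁, hσ₂, rfl⟩, hcross⟩
  · refine ext_of_Iio_mem hI.ordConnected hI.nonempty hfstuniv hfstIio (fun s hs => ?_)
      hc.left_Iio (fun s hs => measure_mono_null Ioi_subset_Ici_self (hfstup s hs))
      fun s hs => measure_mono_null Ioi_subset_Ici_self (hc.left_Ici s hs)
    rw [hfst measurableSet_Iio]
    exact le_antisymm ((hKle _ _).trans (by rw [h1lo s hs, zero_mul])) zero_le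
  · refine ext_of_Iio_mem hI.ordConnected hI.nonempty hsnduniv hsndIio
      (fun s hs => measure_mono_null Iio_subset_Iic_self (hsndlo s hs))
      (fun s hs => measure_mono_null Iio_subset_Iic_self (hc.right_Iic s hs)) (fun s hs => ?_)
      hc.right_Ioi
    rw [hsnd measurableSet_Ioi]
    exact le_antisymm ((hKle _ _).trans (by rw [h2up s hs, mul_zero])) zero_le

end LimitFlow

/-! ### Components of open sets of reals -/

section Components

variable {E I J : Set ℝ}

theorem components_subset (hI : I ∈ components E) : I ⊆ E := by
  obtain ⟨x, -, rfl⟩ := hI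
  exact connectedComponentIn_subset E x

theorem components_nonempty (hI : I ∈ components E) : I.Nonempty := by
  obtain ⟨x, hx, rfl⟩ := hI
  exact ⟨x, mem_connectedComponentIn hx⟩

theorem components_ordConnected (hI : I ∈ components E) : OrdConnected I := by
  obtain ⟨x, -, rfl⟩ := hI
  exact isPreconnected_connectedComponentIn.ordConnected

theorem components_isOpen (hE : IsOpen E) (hI : I ∈ components E) : IsOpen I := by
  obtain ⟨x, -, rfl⟩ := hI
  exact hE.connectedComponentIn

theorem components_maximal (hI : I ∈ components E) (hJ : OrdConnected J) (hJE : J ⊆ E)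
    (h : (J ∩ I).Nonempty) : J ⊆ I := by
  obtain ⟨x, -, rfl⟩ := hI
  obtain ⟨y, hyJ, hyI⟩ := h
  rw [connectedComponentIn_eq hyI]
  exact hJ.isPreconnected.subset_connectedComponentIn hyJ hJE

theorem components_disjoint (hI : I ∈ components E) (hJ : J ∈ components E) (h : I ≠ J) :
    Disjoint I J := by
  rw [disjoint_iff_inter_eq_empty, ← not_nonempty_iff_eq_empty]
  intro hne
  refine h (Subset.antisymm ?_ ?_)
  · exact components_maximal hJ (components_ordConnected hI) (components_subset hI) hne
  · exact components_maximal hI (components_ordConnected hJ) (components_subset hJ)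
      (inter_comm I J ▸ hne)

theorem countable_components (hE : IsOpen E) : (components E).Countable :=
  PairwiseDisjoint.countable_of_isOpen (s := id)
    (fun _ hI _ hJ h => components_disjoint hI hJ h) (fun _ hI => components_isOpen hE hI)
    fun _ hI => components_nonempty hI

theorem mem_lowerBounds_iff_le_leftEnd {s : ℝ} : s ∈ lowerBounds I ↔ (s : EReal) ≤ leftEnd I := by
  simp [leftEnd, lowerBounds]

theorem mem_upperBounds_iff_rightEnd_le {s : ℝ} :
    s ∈ upperBounds I ↔ rightEnd I ≤ (s : EReal) := by
  simp [rightEnd, upperBounds]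

/-- `lowerBounds I` is a closed half-line or empty when `I` is nonempty, so this form treats finite
and infinite end points together. -/
theorem cdfR_leftEnd (κ : Measure ℝ) (I : Set ℝ) : cdfR κ (leftEnd I) = κ (lowerBounds I) := by
  rw [cdfR]
  congr 1
  ext x
  rw [mem_lowerBounds_iff_le_leftEnd]
  rfl

theorem cdfL_rightEnd (κ : Measure ℝ) (I : Set ℝ) :
    cdfL κ (rightEnd I) = κ (upperBounds I)ᶜ := by
  rw [cdfL]
  congr 1
  ext x
  rw [mem_compl_iff, mem_upperBounds_iff_rightEnd_le, not_le]
  rfl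

theorem leftEnd_lt (hI : IsOpen I) {x : ℝ} (hx : x ∈ I) : leftEnd I < x := by
  obtain ⟨q, hq, hqx⟩ := exists_rat_lt_mem hI hx
  exact (sInf_le (mem_image_of_mem _ hq)).trans_lt (EReal.coe_lt_coe_iff.2 hqx)

theorem lt_rightEnd (hI : IsOpen I) {x : ℝ} (hx : x ∈ I) : (x : EReal) < rightEnd I := by
  obtain ⟨q, hq, hqx⟩ := exists_rat_gt_mem hI hx
  exact (EReal.coe_lt_coe_iff.2 hqx).trans_le (le_sSup (mem_image_of_mem _ hq))

theorem leftEnd_eq_bot_or (hI : I.Nonempty) :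
    (leftEnd I = ⊥ ∧ lowerBounds I = ∅) ∨ ∃ a : ℝ, leftEnd I = a ∧ lowerBounds I = Iic a := by
  have key : ∀ s : ℝ, s ∈ lowerBounds I ↔ (s : EReal) ≤ leftEnd I := fun _ =>
    mem_lowerBounds_iff_le_leftEnd
  obtain ⟨x, hx⟩ := hI
  have hx' : leftEnd I ≤ x := sInf_le (mem_image_of_mem _ hx)
  generalize leftEnd I = l at *
  induction l with
  | bot => exact Or.inl ⟨rfl, eq_empty_of_forall_notMem fun s hs => by simpa using (key s).1 hs⟩
  | top => simp at hx'
  | coe a => exact Or.inr ⟨a, rfl, ext fun s => by simp [key]⟩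

theorem rightEnd_eq_top_or (hI : I.Nonempty) :
    (rightEnd I = ⊤ ∧ upperBounds I = ∅) ∨ ∃ b : ℝ, rightEnd I = b ∧ upperBounds I = Ici b := by
  have key : ∀ s : ℝ, s ∈ upperBounds I ↔ rightEnd I ≤ (s : EReal) := fun _ =>
    mem_upperBounds_iff_rightEnd_le
  obtain ⟨x, hx⟩ := hI
  have hx' : (x : EReal) ≤ rightEnd I := le_sSup (mem_image_of_mem _ hx)
  generalize rightEnd I = l at *
  induction l with
  | bot => simp at hx'
  | top => exact Or.inl ⟨rfl, eq_empty_of_forall_notMem fun s hs => by simpa using (key s).1 hs⟩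
  | coe a => exact Or.inr ⟨a, rfl, ext fun s => by simp [key]⟩

theorem measurableSet_lowerBounds (hI : I.Nonempty) : MeasurableSet (lowerBounds I) := by
  obtain ⟨-, h⟩ | ⟨a, -, h⟩ := leftEnd_eq_bot_or hI <;> rw [h]
  exacts [MeasurableSet.empty, measurableSet_Iic]

theorem eventually_mem_nhdsGT (hI : OrdConnected I) (ho : IsOpen I) (hne : I.Nonempty) {a : ℝ}
    (ha : leftEnd I = a) : ∀ᶠ t in 𝓝[>] a, t ∈ I := by
  obtain ⟨x, hx⟩ := hne
  have hax : a < x := EReal.coe_lt_coe_iff.1 (ha ▸ leftEnd_lt ho hx)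
  filter_upwards [Ioo_mem_nhdsGT hax] with t ht
  obtain h | h | h := mem_or_lowerBounds_or_upperBounds hI t
  · exact h
  · rw [mem_lowerBounds_iff_le_leftEnd, ha, EReal.coe_le_coe_iff] at h
    exact absurd ht.1 (not_lt.2 h)
  · exact absurd (h hx) (not_le.2 ht.2)

theorem eventually_mem_nhdsLT (hI : OrdConnected I) (ho : IsOpen I) (hne : I.Nonempty) {b : ℝ}
    (hb : rightEnd I = b) : ∀ᶠ t in 𝓝[<] b, t ∈ I := by
  obtain ⟨x, hx⟩ := hne
  have hxb : x < b := EReal.coe_lt_coe_iff.1 (hb ▸ lt_rightEnd ho hx)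
  filter_upwards [Ioo_mem_nhdsLT hxb] with t ht
  obtain h | h | h := mem_or_lowerBounds_or_upperBounds hI t
  · exact h
  · exact absurd (h hx) (not_le.2 ht.1)
  · rw [mem_upperBounds_iff_rightEnd_le, hb, EReal.coe_le_coe_iff] at h
    exact absurd ht.2 (not_lt.2 h)

/-- A finite end point of a component of an open set does not belong to the set. -/
theorem notMem_of_leftEnd_eq (hE : IsOpen E) (hI : I ∈ components E) {a : ℝ}
    (ha : leftEnd I = a) : a ∉ E := by
  intro haE
  have ho := components_isOpen hE hI
  have hc := components_ordConnected hI
  obtain ⟨x, hx⟩ := components_nonempty hI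
  have hax : a < x := EReal.coe_lt_coe_iff.1 (ha ▸ leftEnd_lt ho hx)
  have hsub : Icc a x ⊆ I := components_maximal hI ordConnected_Icc (fun y hy => by
    rcases eq_or_lt_of_le hy.1 with rfl | h
    · exact haE
    · obtain h' | h' | h' := mem_or_lowerBounds_or_upperBounds hc y
      · exact components_subset hI h'
      · rw [mem_lowerBounds_iff_le_leftEnd, ha, EReal.coe_le_coe_iff] at h'
        exact absurd h (not_lt.2 h')
      · exact components_subset hI (le_antisymm hy.2 (h' hx) ▸ hx)) ⟨x, ⟨hax.le, le_rfl⟩, hx⟩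
  exact absurd (ha ▸ leftEnd_lt ho (hsub (left_mem_Icc.2 hax.le))) (lt_irrefl _)

theorem notMem_of_rightEnd_eq (hE : IsOpen E) (hI : I ∈ components E) {b : ℝ}
    (hb : rightEnd I = b) : b ∉ E := by
  intro hbE
  have ho := components_isOpen hE hI
  have hc := components_ordConnected hI
  obtain ⟨x, hx⟩ := components_nonempty hI
  have hxb : x < b := EReal.coe_lt_coe_iff.1 (hb ▸ lt_rightEnd ho hx)
  have hsub : Icc x b ⊆ I := components_maximal hI ordConnected_Icc (fun y hy => by
    rcases eq_or_lt_of_le hy.2 with rfl | h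
    · exact hbE
    · obtain h' | h' | h' := mem_or_lowerBounds_or_upperBounds hc y
      · exact components_subset hI h'
      · exact components_subset hI (le_antisymm (h' hx) hy.1 ▸ hx)
      · rw [mem_upperBounds_iff_rightEnd_le, hb, EReal.coe_le_coe_iff] at h'
        exact absurd h (not_lt.2 h')) ⟨x, ⟨le_rfl, hxb.le⟩, hx⟩
  exact absurd (hb ▸ lt_rightEnd ho (hsub (right_mem_Icc.2 hxb.le))) (lt_irrefl _)

theorem Iio_eq_lowerBounds_union (hI : OrdConnected I) (ho : IsOpen I) {t : ℝ} (ht : t ∈ I) :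
    Iio t = lowerBounds I ∪ I ∩ Iio t := by
  ext x
  constructor
  · intro hx
    obtain h | h | h := mem_or_lowerBounds_or_upperBounds hI x
    · exact Or.inr ⟨h, hx⟩
    · exact Or.inl h
    · exact absurd (h ht) (not_le.2 hx)
  · rintro (h | h)
    · exact EReal.coe_lt_coe_iff.1
        ((mem_lowerBounds_iff_le_leftEnd.1 h).trans_lt (leftEnd_lt ho ht))
    · exact h.2

theorem disjoint_lowerBounds (ho : IsOpen I) : Disjoint (lowerBounds I) I :=
  Set.disjoint_left.2 fun _ hx hxI =>
    absurd (mem_lowerBounds_iff_le_leftEnd.1 hx) (not_le.2 (leftEnd_lt ho hxI))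

theorem compl_upperBounds_eq (hI : OrdConnected I) (ho : IsOpen I) (hne : I.Nonempty) :
    (upperBounds I)ᶜ = lowerBounds I ∪ I := by
  ext x
  constructor
  · intro hx
    obtain h | h | h := mem_or_lowerBounds_or_upperBounds hI x
    · exact Or.inr h
    · exact Or.inl h
    · exact absurd h hx
  · rw [mem_compl_iff, mem_upperBounds_iff_rightEnd_le, not_le]
    rintro (h | h)
    · obtain ⟨y, hy⟩ := hne
      exact (EReal.coe_le_coe_iff.2 (h hy)).trans_lt (lt_rightEnd ho hy)
    · exact lt_rightEnd ho h

end Components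

/-! ### The sets of strict inequality -/

theorem tendsto_measure_Iic_nhdsLT (κ : Measure ℝ) [IsFiniteMeasure κ] (t : ℝ) :
    Tendsto (fun r => κ (Iic r)) (𝓝[<] t) (𝓝 (κ (Iio t))) := by
  refine tendsto_of_tendsto_of_tendsto_of_le_of_le' (tendsto_measure_Iio_nhdsLT κ t)
    tendsto_const_nhds (Eventually.of_forall fun r => measure_mono Iio_subset_Iic_self) ?_
  filter_upwards [self_mem_nhdsWithin] with r hr using measure_mono (Iic_subset_Iio.2 hr)

theorem tendsto_measure_Iic_nhdsGT (κ : Measure ℝ) [IsFiniteMeasure κ] (t : ℝ) :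
    Tendsto (fun r => κ (Iic r)) (𝓝[>] t) (𝓝 (κ (Iic t))) := by
  have h := (tendsto_measure_Ioc_nhdsGT κ t).const_add (κ (Iic t))
  rw [add_zero] at h
  refine tendsto_of_tendsto_of_tendsto_of_le_of_le' tendsto_const_nhds h ?_ ?_
  · filter_upwards [self_mem_nhdsWithin] with r hr
    exact measure_mono (Iic_subset_Iic.2 (le_of_lt hr))
  · filter_upwards [self_mem_nhdsWithin] with r hr
    rw [← Iic_union_Ioc_eq_Iic (le_of_lt hr)]
    exact measure_union_le _ _

section PosSet

variable {μ ν : Measure ℝ} [IsFiniteMeasure μ] [IsFiniteMeasure ν]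

/-- F^+ and F^- have the same one-sided limits at t, namely F^-(t) from the left and F^+(t) from the
right. Two strict inequalities at t thus spread to a neighbourhood; `c = 0` gives openness of E^+,
positive `c` a locally uniform gap. -/
theorem eventually_add_lt {c : ℝ≥0∞} {t : ℝ} (h : c + ν (Iic t) < μ (Iic t))
    (h' : c + ν (Iio t) < μ (Iio t)) :
    ∀ᶠ x in 𝓝 t, c + ν (Iic x) < μ (Iic x) ∧ c + ν (Iio x) < μ (Iio x) := by
  rw [← nhdsNE_sup_pure, ← nhdsLT_sup_nhdsGT, eventually_sup, eventually_sup]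
  refine ⟨⟨?_, ?_⟩, eventually_pure.2 ⟨h, h'⟩⟩
  · exact (((tendsto_measure_Iic_nhdsLT ν t).const_add c).eventually_lt
      (tendsto_measure_Iic_nhdsLT μ t) h').and
      (((tendsto_measure_Iio_nhdsLT ν t).const_add c).eventually_lt
      (tendsto_measure_Iio_nhdsLT μ t) h')
  · exact (((tendsto_measure_Iic_nhdsGT ν t).const_add c).eventually_lt
      (tendsto_measure_Iic_nhdsGT μ t) h).and
      (((tendsto_measure_Iio_nhdsGT ν t).const_add c).eventually_lt
      (tendsto_measure_Iio_nhdsGT μ t) h)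

variable (μ ν) in
theorem isOpen_posSet : IsOpen (posSet μ ν) := by
  rw [isOpen_iff_mem_nhds]
  intro t ht
  have := eventually_add_lt (c := 0) (by simpa using ht.1) (by simpa using ht.2)
  simp only [zero_add] at this
  exact this

theorem disjoint_posSet_negSet (μ ν : Measure ℝ) : Disjoint (posSet μ ν) (negSet μ ν) :=
  Set.disjoint_left.2 fun _ h h' => lt_asymm h.1 h'.1

variable {I : Set ℝ}

/-- Compactness of `Icc s t` turns the local gaps into a single one. -/
theorem isFlowInterval_of_mem_components (hI : I ∈ components (posSet μ ν)) :
    IsFlowInterval μ ν I where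
  ordConnected := components_ordConnected hI
  isOpen := components_isOpen (isOpen_posSet μ ν) hI
  nonempty := components_nonempty hI
  exists_le s hs t ht := by
    refine isCompact_Icc.induction_on (p := fun S => ∃ d₀ > 0, ∀ x ∈ S,
      ENNReal.ofReal d₀ + ν (Iio x) ≤ μ (Iio x)) ⟨1, one_pos, by simp⟩ ?_ ?_ ?_
    · rintro S T hST ⟨d, hd, h⟩
      exact ⟨d, hd, fun x hx => h x (hST hx)⟩
    · rintro S T ⟨d, hd, h⟩ ⟨d', hd', h'⟩
      refine ⟨min d d', lt_min hd hd', ?_⟩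
      rintro x (hx | hx)
      · exact le_trans (by gcongr; exact min_le_left _ _) (h x hx)
      · exact le_trans (by gcongr; exact min_le_right _ _) (h' x hx)
    · intro x hx
      have hx' := components_subset hI ((components_ordConnected hI).out hs ht hx)
      obtain ⟨r, hr0, hr⟩ := ENNReal.lt_iff_exists_real_btwn.1
        (lt_min (tsub_pos_of_lt hx'.1) (tsub_pos_of_lt hx'.2))
      have hr1 := lt_tsub_iff_right.1 (hr.2.trans_le (min_le_left _ _))
      have hr2 := lt_tsub_iff_right.1 (hr.2.trans_le (min_le_right _ _))
      refine ⟨_, mem_nhdsWithin_of_mem_nhds (eventually_add_lt hr1 hr2), r,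
        ENNReal.ofReal_pos.1 hr.1, fun y hy => hy.2.le⟩

theorem measure_lowerBounds_le (hI : I ∈ components (posSet μ ν)) :
    ν (lowerBounds I) ≤ μ (lowerBounds I) := by
  have ho := components_isOpen (isOpen_posSet μ ν) hI
  obtain ⟨-, h⟩ | ⟨a, ha, h⟩ := leftEnd_eq_bot_or (components_nonempty hI) <;> rw [h]
  · simp
  · refine le_of_tendsto_of_tendsto (tendsto_measure_Iio_nhdsGT ν a)
      (tendsto_measure_Iio_nhdsGT μ a) ?_
    filter_upwards [eventually_mem_nhdsGT (components_ordConnected hI) ho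
      (components_nonempty hI) ha] with t ht using (components_subset hI ht).2.le

theorem measure_compl_upperBounds_le (hmass : μ univ = ν univ)
    (hI : I ∈ components (posSet μ ν)) : ν (upperBounds I)ᶜ ≤ μ (upperBounds I)ᶜ := by
  have ho := components_isOpen (isOpen_posSet μ ν) hI
  obtain ⟨-, h⟩ | ⟨b, hb, h⟩ := rightEnd_eq_top_or (components_nonempty hI) <;> rw [h]
  · simp [hmass]
  · rw [compl_Ici]
    refine le_of_tendsto_of_tendsto (tendsto_measure_Iio_nhdsLT ν b)
      (tendsto_measure_Iio_nhdsLT μ b) ?_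
    filter_upwards [eventually_mem_nhdsLT (components_ordConnected hI) ho
      (components_nonempty hI) hb] with t ht using (components_subset hI ht).2.le

end PosSet

/-! ### The marginals of a component -/

/-- The atom of `μ_k⁺` at the left end point. -/
noncomputable def leftAtom (μ ν : Measure ℝ) (I : Set ℝ) : Measure ℝ :=
  (cdfR μ (leftEnd I) - cdfR ν (leftEnd I)) • Measure.dirac (leftEnd I).toReal

/-- The atom of `ν_k⁺` at the right end point. -/
noncomputable def rightAtom (μ ν : Measure ℝ) (I : Set ℝ) : Measure ℝ :=
  (cdfL μ (rightEnd I) - cdfL ν (rightEnd I)) • Measure.dirac (rightEnd I).toReal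

theorem muPos_eq (μ ν : Measure ℝ) (I : Set ℝ) : muPos μ ν I = leftAtom μ ν I + μ.restrict I := rfl

theorem nuPos_eq (μ ν : Measure ℝ) (I : Set ℝ) : nuPos μ ν I = ν.restrict I + rightAtom μ ν I := rfl

section Atoms

variable {μ ν : Measure ℝ} {I A : Set ℝ}

theorem leftAtom_apply_eq_zero (hne : I.Nonempty) (hA : MeasurableSet A)
    (h : ∀ a : ℝ, leftEnd I = a → a ∉ A) : leftAtom μ ν I A = 0 := by
  rw [leftAtom, Measure.smul_apply, Measure.dirac_apply' _ hA, cdfR_leftEnd, cdfR_leftEnd]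
  obtain ⟨-, h'⟩ | ⟨a, ha, -⟩ := leftEnd_eq_bot_or hne
  · simp [h']
  · simp [ha, h a ha]

theorem leftAtom_apply (hne : I.Nonempty) (hA : MeasurableSet A)
    (h : ∀ a : ℝ, leftEnd I = a → a ∈ A) :
    leftAtom μ ν I A = μ (lowerBounds I) - ν (lowerBounds I) := by
  rw [leftAtom, Measure.smul_apply, Measure.dirac_apply' _ hA, cdfR_leftEnd, cdfR_leftEnd]
  obtain ⟨-, h'⟩ | ⟨a, ha, -⟩ := leftEnd_eq_bot_or hne
  · simp [h']
  · simp [ha, h a ha]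

theorem rightAtom_apply_eq_zero (hmass : μ univ = ν univ) (hne : I.Nonempty)
    (hA : MeasurableSet A) (h : ∀ b : ℝ, rightEnd I = b → b ∉ A) : rightAtom μ ν I A = 0 := by
  rw [rightAtom, Measure.smul_apply, Measure.dirac_apply' _ hA, cdfL_rightEnd, cdfL_rightEnd]
  obtain ⟨-, h'⟩ | ⟨b, hb, -⟩ := rightEnd_eq_top_or hne
  · simp [h', hmass]
  · simp [hb, h b hb]

theorem rightAtom_apply (hmass : μ univ = ν univ) (hne : I.Nonempty)
    (hA : MeasurableSet A) (h : ∀ b : ℝ, rightEnd I = b → b ∈ A) :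
    rightAtom μ ν I A = μ (upperBounds I)ᶜ - ν (upperBounds I)ᶜ := by
  rw [rightAtom, Measure.smul_apply, Measure.dirac_apply' _ hA, cdfL_rightEnd, cdfL_rightEnd]
  obtain ⟨-, h'⟩ | ⟨b, hb, -⟩ := rightEnd_eq_top_or hne
  · simp [h', hmass]
  · simp [hb, h b hb]

variable [IsFiniteMeasure μ] [IsFiniteMeasure ν]

instance : IsFiniteMeasure (leftAtom μ ν I) :=
  Measure.smul_finite _ (ne_top_of_le_ne_top (measure_ne_top μ _) tsub_le_self)

instance : IsFiniteMeasure (rightAtom μ ν I) :=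
  Measure.smul_finite _ (ne_top_of_le_ne_top (measure_ne_top μ _) tsub_le_self)

instance : IsFiniteMeasure (muPos μ ν I) := by
  rw [muPos_eq]; infer_instance

instance : IsFiniteMeasure (nuPos μ ν I) := by
  rw [nuPos_eq]; infer_instance

/-- The atom at the left end is the net flow that enters the component, the atom at the right end
the net flow that leaves it. Both differences of distribution functions are nonnegative as limits
from inside `I`, so the truncated subtractions are exact. -/
theorem componentMarginals_muPos_nuPos (hmass : μ univ = ν univ)
    (hI : I ∈ components (posSet μ ν)) :
    ComponentMarginals μ ν I (muPos μ ν I) (nuPos μ ν I) := by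
  have ho := components_isOpen (isOpen_posSet μ ν) hI
  have hc := components_ordConnected hI
  have hne := components_nonempty hI
  have hIm := ho.measurableSet
  have hLm := measurableSet_lowerBounds hne
  have hL := measure_lowerBounds_le hI
  have hR := measure_compl_upperBounds_le hmass hI
  have hl0 : ∀ A, MeasurableSet A → A ⊆ I → leftAtom μ ν I A = 0 := fun A hA hAI =>
    leftAtom_apply_eq_zero hne hA fun a ha haA =>
      absurd (ha ▸ leftEnd_lt ho (hAI haA)) (lt_irrefl _)
  have hr0 : ∀ A, MeasurableSet A → A ⊆ I → rightAtom μ ν I A = 0 := fun A hA hAI =>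
    rightAtom_apply_eq_zero hmass hne hA fun b hb hbA =>
      absurd (hb ▸ lt_rightEnd ho (hAI hbA)) (lt_irrefl _)
  have hlow : ∀ s ∈ lowerBounds I, Iic s ∩ I = ∅ := fun s hs => by
    rw [← disjoint_iff_inter_eq_empty, Set.disjoint_left]
    exact fun x hx hxI => Set.disjoint_left.1 (disjoint_lowerBounds ho)
      (fun y hy => (mem_Iic.1 hx).trans (hs hy)) hxI
  have hup : ∀ s ∈ upperBounds I, Ici s ∩ I = ∅ := fun s hs => by
    rw [← disjoint_iff_inter_eq_empty, Set.disjoint_left]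
    exact fun x hx hxI => absurd (mem_upperBounds_iff_rightEnd_le.1 hs)
      (not_le.2 ((EReal.coe_le_coe_iff.2 hx).trans_lt (lt_rightEnd ho hxI)))
  have hlr : ∀ a b : ℝ, leftEnd I = a → rightEnd I = b → a < b := fun a b ha hb => by
    obtain ⟨x, hx⟩ := hne
    exact EReal.coe_lt_coe_iff.1 (ha ▸ hb ▸ (leftEnd_lt ho hx).trans (lt_rightEnd ho hx))
  constructor
  · have e1 : muPos μ ν I univ = μ (lowerBounds I) - ν (lowerBounds I) + μ I := by
      rw [muPos_eq, Measure.add_apply, leftAtom_apply hne .univ fun a _ => mem_univ a,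
        Measure.restrict_apply_univ]
    have e2 : nuPos μ ν I univ = ν I + (μ (upperBounds I)ᶜ - ν (upperBounds I)ᶜ) := by
      rw [nuPos_eq, Measure.add_apply, rightAtom_apply hmass hne .univ fun a _ => mem_univ a,
        Measure.restrict_apply_univ]
    have e3 : ∀ κ : Measure ℝ, κ (upperBounds I)ᶜ = κ (lowerBounds I) + κ I := fun κ => by
      rw [compl_upperBounds_eq hc ho hne, measure_union (disjoint_lowerBounds ho) hIm]
    rw [e1, e2]
    refine (ENNReal.add_left_inj (measure_ne_top ν (lowerBounds I))).1 ?_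
    rw [add_right_comm, tsub_add_cancel_of_le hL, add_right_comm, add_comm (ν I), ← e3, ← e3,
      add_tsub_cancel_of_le hR]
  · rw [muPos_eq, Measure.restrict_add, Measure.restrict_restrict hIm, inter_self,
      Measure.restrict_eq_zero.2 (hl0 I hIm Subset.rfl), zero_add]
  · rw [nuPos_eq, Measure.restrict_add, Measure.restrict_restrict hIm, inter_self,
      Measure.restrict_eq_zero.2 (hr0 I hIm Subset.rfl), add_zero]
  · intro s hs
    rw [muPos_eq, Measure.add_apply, Measure.restrict_apply measurableSet_Iio,
      leftAtom_apply_eq_zero hne measurableSet_Iio fun a ha has => ?_, zero_add]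
    · exact measure_mono_null (inter_subset_inter_left _ Iio_subset_Iic_self)
        (by rw [hlow s hs, measure_empty])
    · rw [mem_lowerBounds_iff_le_leftEnd, ha, EReal.coe_le_coe_iff] at hs
      exact absurd hs (not_le.2 has)
  · intro s hs
    rw [muPos_eq, Measure.add_apply, Measure.restrict_apply measurableSet_Ici, hup s hs,
      measure_empty, leftAtom_apply_eq_zero hne measurableSet_Ici fun a ha has => ?_, zero_add]
    obtain ⟨x, hx⟩ := hne
    have h1 := mem_upperBounds_iff_rightEnd_le.1 hs
    have h2 := ((leftEnd_lt ho hx).trans (lt_rightEnd ho hx)).trans_le h1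
    rw [ha, EReal.coe_lt_coe_iff] at h2
    exact absurd h2 (not_lt.2 has)
  · intro s hs
    rw [nuPos_eq, Measure.add_apply, Measure.restrict_apply measurableSet_Iic, hlow s hs,
      measure_empty, rightAtom_apply_eq_zero hmass hne measurableSet_Iic fun b hb hbs => ?_,
      zero_add]
    obtain ⟨x, hx⟩ := hne
    have h1 := mem_lowerBounds_iff_le_leftEnd.1 hs
    have h2 := h1.trans_lt ((leftEnd_lt ho hx).trans (lt_rightEnd ho hx))
    rw [hb, EReal.coe_lt_coe_iff] at h2
    exact absurd h2 (not_lt.2 hbs)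
  · intro s hs
    rw [nuPos_eq, Measure.add_apply, Measure.restrict_apply measurableSet_Ioi,
      rightAtom_apply_eq_zero hmass hne measurableSet_Ioi fun b hb hbs => ?_, add_zero]
    · exact measure_mono_null (inter_subset_inter_left _ Ioi_subset_Ici_self)
        (by rw [hup s hs, measure_empty])
    · rw [mem_upperBounds_iff_rightEnd_le, hb, EReal.coe_le_coe_iff] at hs
      exact absurd hs (not_le.2 hbs)
  · intro t ht
    have e3 : ∀ κ : Measure ℝ, κ (Iio t) = κ (lowerBounds I) + κ (I ∩ Iio t) := fun κ => by
      conv_lhs => rw [Iio_eq_lowerBounds_union hc ho ht]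
      rw [measure_union ((disjoint_lowerBounds ho).mono_right inter_subset_left)
        (hIm.inter measurableSet_Iio)]
    rw [muPos_eq, nuPos_eq, Measure.add_apply, Measure.add_apply,
      Measure.restrict_apply measurableSet_Iio, Measure.restrict_apply measurableSet_Iio,
      leftAtom_apply hne measurableSet_Iio fun a ha => ?_,
      rightAtom_apply_eq_zero hmass hne measurableSet_Iio fun b hb hbt => ?_, e3 μ, e3 ν,
      inter_comm (Iio t), add_zero]
    · rw [← add_assoc, add_right_comm _ _ (ν (lowerBounds I)), tsub_add_cancel_of_le hL]
    · exact absurd (hb ▸ lt_rightEnd ho ht) (not_lt.2 (EReal.coe_le_coe_iff.2 (le_of_lt hbt)))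
    · exact EReal.coe_lt_coe_iff.1 (ha ▸ leftEnd_lt ho ht)

end Atoms

/-! ### Limits of the crossing masses -/

theorem IsStronglyMultiplicative.apply_eq_zero {K : Measure (ℝ × ℝ)}
    (hK : IsStronglyMultiplicative K) {A B : Set ℝ} (hA : MeasurableSet A) (hB : MeasurableSet B)
    (hAB : ∀ x ∈ A, ∀ y ∈ B, y < x) : K (A ×ˢ B) = 0 := by
  obtain ⟨η₁, η₂, -, -, rfl⟩ := hK
  exact restrict_prod_apply_of_lt hA hB hAB

theorem Marg.apply_le_left {m n : Measure ℝ} {K : Measure (ℝ × ℝ)} (hK : K ∈ Marg m n)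
    {A : Set ℝ} (hA : MeasurableSet A) (B : Set ℝ) : K (A ×ˢ B) ≤ m A := by
  rw [← hK.1, Measure.map_apply measurable_fst hA]
  exact measure_mono fun p hp => hp.1

theorem Marg.apply_le_right {m n : Measure ℝ} {K : Measure (ℝ × ℝ)} (hK : K ∈ Marg m n)
    (A : Set ℝ) {B : Set ℝ} (hB : MeasurableSet B) : K (A ×ˢ B) ≤ n B := by
  rw [← hK.2, Measure.map_apply measurable_snd hB]
  exact measure_mono fun p hp => hp.2

section Cross

variable {μ ν : Measure ℝ} [IsFiniteMeasure μ] [IsFiniteMeasure ν] {π : ℝ → Measure (ℝ × ℝ)}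
  {a b : ℝ → ℝ → ℝ≥0} {I : Set ℝ}

/-- The limit flow of the entropic family supplies a strongly multiplicative plan, uniqueness
identifies it with `kellererF`, and its crossing masses are limits by construction. -/
theorem kellererF_spec (h : ∀ ε > 0, EntropicFactors ε μ ν (π ε) (a ε) (b ε))
    (hmass : μ univ = ν univ) (hI : I ∈ components (posSet μ ν)) :
    kellererF (muPos μ ν I) (nuPos μ ν I) ∈ Marg (muPos μ ν I) (nuPos μ ν I) ∧
      IsStronglyMultiplicative (kellererF (muPos μ ν I) (nuPos μ ν I)) ∧
      ∀ s ∈ I, ∀ t ∈ I, s ≤ t → Tendsto (fun ε => π ε (Iio s ×ˢ Ici t)) (𝓝[>] 0)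
        (𝓝 (kellererF (muPos μ ν I) (nuPos μ ν I) (Iio s ×ˢ Ici t))) := by
  have hF := isFlowInterval_of_mem_components hI
  have hc := componentMarginals_muPos_nuPos hmass hI
  obtain ⟨g, f, k, hlim, htend⟩ := exists_limitFlow h hF
  obtain ⟨K, hK, hs, hKc⟩ := hlim.exists_multiplicative hF hmass hc
  have hex : ∃! π : Measure (ℝ × ℝ), π ∈ Marg (muPos μ ν I) (nuPos μ ν I) ∧
      IsStronglyMultiplicative π :=
    ⟨K, ⟨hK, hs⟩, fun K' hK' => hc.eq_of_multiplicative hF hK'.1 hK hK'.2 hs⟩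
  have e : kellererF (muPos μ ν I) (nuPos μ ν I) = K := by
    rw [kellererF, dif_pos hex]
    exact hex.unique hex.choose_spec.1 ⟨hK, hs⟩
  rw [e]
  exact ⟨hK, hs, fun s hsI t htI hst => by rw [hKc s hsI t htI hst]; exact htend s hsI t htI hst⟩

/-- A right end point lies outside E^+. If it is an atom of neither measure, F^+ and F^- agree
there, so F_μ^- ≤ F_ν^- and the atom of ν_k^+ has mass zero. -/
theorem nuPos_Ici_eq_zero (hmass : μ univ = ν univ) (hI : I ∈ components (posSet μ ν)) {t : ℝ}
    (hμt : μ {t} = 0) (hνt : ν {t} = 0) (ht : t ∈ upperBounds I) :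
    nuPos μ ν I (Ici t) = 0 := by
  have hne := components_nonempty hI
  have hat : rightAtom μ ν I {t} = 0 := by
    by_cases hb : rightEnd I = t
    · have htE := notMem_of_rightEnd_eq (isOpen_posSet μ ν) hI hb
      have hIic : ∀ κ : Measure ℝ, κ {t} = 0 → κ (Iic t) = κ (Iio t) := fun κ hκ => by
        rw [← Iio_union_right, measure_union (by simp) (measurableSet_singleton t), hκ, add_zero]
      have hub : (upperBounds I)ᶜ = Iio t := by
        ext x
        rw [mem_compl_iff, mem_upperBounds_iff_rightEnd_le, hb, EReal.coe_le_coe_iff, not_le,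
          mem_Iio]
      rw [rightAtom_apply hmass hne (measurableSet_singleton t) fun c hc => by
        simpa [hb, eq_comm] using hc, hub, tsub_eq_zero_iff_le]
      refine not_lt.1 fun hlt => htE ⟨?_, hlt⟩
      rwa [hIic μ hμt, hIic ν hνt]
    · exact rightAtom_apply_eq_zero hmass hne (measurableSet_singleton t) fun c hc hct =>
        hb (by rw [hc, mem_singleton_iff.1 hct])
  rw [← Ioi_insert, insert_eq]
  refine measure_union_null ?_ ((componentMarginals_muPos_nuPos hmass hI).right_Ioi t ht)
  rw [nuPos_eq, Measure.add_apply, hat, add_zero]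
  exact le_antisymm ((Measure.restrict_apply_le _ _).trans hνt.le) zero_le

/-- Only a component that contains both `s` and `t` transports mass from the left of `s` to the
right of `t`. -/
theorem kellererF_cross_eq_zero (h : ∀ ε > 0, EntropicFactors ε μ ν (π ε) (a ε) (b ε))
    (hmass : μ univ = ν univ) (hI : I ∈ components (posSet μ ν)) {s t : ℝ} (hst : s ≤ t)
    (hμt : μ {t} = 0) (hνt : ν {t} = 0) (hn : ¬(s ∈ I ∧ t ∈ I)) :
    kellererF (muPos μ ν I) (nuPos μ ν I) (Iio s ×ˢ Ici t) = 0 := by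
  obtain ⟨hm, -, -⟩ := kellererF_spec h hmass hI
  have hord := components_ordConnected hI
  have hcase : s ∈ lowerBounds I ∨ t ∈ upperBounds I := by
    obtain h1 | h1 | h1 := mem_or_lowerBounds_or_upperBounds hord s
    · obtain h2 | h2 | h2 := mem_or_lowerBounds_or_upperBounds hord t
      · exact absurd ⟨h1, h2⟩ hn
      · exact Or.inl fun x hx => hst.trans (h2 hx)
      · exact Or.inr h2
    · exact Or.inl h1
    · exact Or.inr fun x hx => (h1 hx).trans hst
  refine le_antisymm ?_ zero_le
  rcases hcase with h1 | h1
  · rw [← (componentMarginals_muPos_nuPos hmass hI).left_Iio s h1]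
    exact Marg.apply_le_left hm measurableSet_Iio _
  · rw [← nuPos_Ici_eq_zero hmass hI hμt hνt h1]
    exact Marg.apply_le_right hm _ measurableSet_Ici

/-- If F_μ^-(r) ≤ F_ν^-(r), the flow through `r` vanishes in the limit. Otherwise F_μ^+(r) ≤
F_ν^+(r), and the limit flow through r' is small as r' decreases to `r`; when `r = t` leaves no room
for r', absence of an atom reduces this to the first case. -/
theorem tendsto_cross_of_notMem (h : ∀ ε > 0, EntropicFactors ε μ ν (π ε) (a ε) (b ε))
    {r s t : ℝ} (hsr : s ≤ r) (hrt : r ≤ t) (hr : r ∉ posSet μ ν)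
    (hμt : μ {t} = 0) (hνt : ν {t} = 0) :
    Tendsto (fun ε => π ε (Iio s ×ˢ Ici t)) (𝓝[>] 0) (𝓝 0) := by
  have hmono : ∀ r', s ≤ r' → r' ≤ t → ∀ ε, π ε (Iio s ×ˢ Ici t) ≤ π ε (Iio r' ×ˢ Ici r') :=
    fun r' h1 h2 ε => measure_mono (prod_mono (Iio_subset_Iio h1) (Ici_subset_Ici.2 h2))
  have hzero : ∀ r', s ≤ r' → r' ≤ t → μ (Iio r') ≤ ν (Iio r') →
      Tendsto (fun ε => π ε (Iio s ×ˢ Ici t)) (𝓝[>] 0) (𝓝 0) := fun r' h1 h2 h3 => by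
    have := tendsto_cross h r'
    rw [tsub_eq_zero_of_le h3] at this
    exact tendsto_of_tendsto_of_tendsto_of_le_of_le tendsto_const_nhds this
      (fun _ => zero_le) (hmono r' h1 h2)
  by_cases h2 : ν (Iio r) < μ (Iio r)
  · have h1 : μ (Iic r) ≤ ν (Iic r) := not_lt.1 fun h1 => hr ⟨h1, h2⟩
    rcases eq_or_lt_of_le hrt with rfl | hlt
    · have hIic : ∀ κ : Measure ℝ, κ {r} = 0 → κ (Iic r) = κ (Iio r) := fun κ hκ => by
        rw [← Iio_union_right, measure_union (by simp) (measurableSet_singleton r), hκ, add_zero]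
      rw [hIic μ hμt, hIic ν hνt] at h1
      exact hzero r hsr le_rfl h1
    · have hD : Tendsto (fun r' => μ (Iio r') - ν (Iio r')) (𝓝[>] r) (𝓝 0) := by
        have := ENNReal.Tendsto.sub (tendsto_measure_Iio_nhdsGT μ r)
          (tendsto_measure_Iio_nhdsGT ν r) (Or.inl (measure_ne_top _ _))
        rwa [tsub_eq_zero_of_le h1] at this
      rw [ENNReal.tendsto_nhds_zero]
      intro δ hδ
      obtain ⟨r', hr', hlt', hle'⟩ := ((hD.eventually (gt_mem_nhds hδ)).and
        (Ioo_mem_nhdsGT hlt)).exists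
      filter_upwards [(tendsto_cross h r').eventually (gt_mem_nhds hr')] with ε hε
      exact (hmono r' (hsr.trans hlt'.le) hle'.le ε).trans hε.le
  · exact hzero r hsr hrt (not_lt.1 h2)

/-- The small-noise limit of the mass that crosses an interval from left to right. -/
theorem tendsto_cross_sum_kellererF (h : ∀ ε > 0, EntropicFactors ε μ ν (π ε) (a ε) (b ε))
    (hmass : μ univ = ν univ) {s t : ℝ} (hst : s ≤ t) (hμt : μ {t} = 0) (hνt : ν {t} = 0) :
    Tendsto (fun ε => π ε (Iio s ×ˢ Ici t)) (𝓝[>] 0)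
      (𝓝 ((Measure.sum fun I : components (posSet μ ν) => kellererF (muPos μ ν I) (nuPos μ ν I))
        (Iio s ×ˢ Ici t))) := by
  rw [Measure.sum_apply _ (measurableSet_Iio.prod measurableSet_Ici)]
  by_cases hsub : Icc s t ⊆ posSet μ ν
  · have hs : s ∈ posSet μ ν := hsub (left_mem_Icc.2 hst)
    set I := connectedComponentIn (posSet μ ν) s with hIdef
    have hI : I ∈ components (posSet μ ν) := ⟨s, hs, rfl⟩
    have hsI : s ∈ I := mem_connectedComponentIn hs
    have htI : t ∈ I := components_maximal hI ordConnected_Icc hsub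
      ⟨s, left_mem_Icc.2 hst, hsI⟩ (right_mem_Icc.2 hst)
    rw [tsum_eq_single (⟨I, hI⟩ : components (posSet μ ν)) fun J hJ =>
      kellererF_cross_eq_zero h hmass J.2 hst hμt hνt fun hn =>
        Set.disjoint_left.1 (components_disjoint J.2 hI fun e => hJ (Subtype.ext e)) hn.1 hsI]
    exact (kellererF_spec h hmass hI).2.2 s hsI t htI hst
  · obtain ⟨r, hr, hrE⟩ := not_subset.1 hsub
    rw [ENNReal.tsum_eq_zero.2 fun J => kellererF_cross_eq_zero h hmass J.2 hst hμt hνt fun hn =>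
      hrE (components_subset J.2 ((components_ordConnected J.2).out hn.1 hn.2 hr))]
    exact tendsto_cross_of_notMem h hr.1 hr.2 hrE hμt hνt

theorem sum_kellererF_reverse_eq_zero (h : ∀ ε > 0, EntropicFactors ε μ ν (π ε) (a ε) (b ε))
    (hmass : μ univ = ν univ) {s t : ℝ} (hst : s ≤ t) :
    (Measure.sum fun I : components (posSet μ ν) => kellererF (muPos μ ν I) (nuPos μ ν I))
      (Ici t ×ˢ Iio s) = 0 := by
  rw [Measure.sum_apply _ (measurableSet_Ici.prod measurableSet_Iio)]
  exact ENNReal.tsum_eq_zero.2 fun I => (kellererF_spec h hmass I.2).2.1.apply_eq_zero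
    measurableSet_Ici measurableSet_Iio fun x hx y hy =>
      (mem_Iio.1 hy).trans_le (hst.trans (mem_Ici.1 hx))

end Cross

/-! ### The first marginal of the generalized Kellerer plan -/

section FirstMarginal

variable {μ ν : Measure ℝ}

theorem countable_boundaryPts (μ ν : Measure ℝ) [IsFiniteMeasure μ] [IsFiniteMeasure ν] :
    (boundaryPts μ ν).Countable := by
  -- By definition `negSet μ ν`, `nuNeg μ ν` and `muNeg μ ν` are `posSet ν μ`, `muPos ν μ` and
  -- `nuPos ν μ`, so statements on positive components transfer to negative ones.
  have hC : (components (posSet μ ν) ∪ components (negSet μ ν)).Countable :=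
    (countable_components (isOpen_posSet μ ν)).union (countable_components (isOpen_posSet ν μ))
  refine ((hC.image fun I => (leftEnd I).toReal).union
    (hC.image fun I => (rightEnd I).toReal)).mono ?_
  rintro x ⟨I, hI, hx | hx⟩
  · exact Or.inl ⟨I, hI, by simp [hx]⟩
  · exact Or.inr ⟨I, hI, by simp [hx]⟩

theorem boundaryPts_comm (μ ν : Measure ℝ) : boundaryPts μ ν = boundaryPts ν μ := by
  unfold boundaryPts
  rw [union_comm]
  rfl

theorem posSet_disjoint_boundaryPts (μ ν : Measure ℝ) [IsFiniteMeasure μ] [IsFiniteMeasure ν] :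
    Disjoint (posSet μ ν) (boundaryPts μ ν) := by
  refine Set.disjoint_left.2 fun x hx hB => ?_
  obtain ⟨I, hI | hI, hend⟩ := hB
  · rcases hend with he | he
    · exact notMem_of_leftEnd_eq (isOpen_posSet μ ν) hI he hx
    · exact notMem_of_rightEnd_eq (isOpen_posSet μ ν) hI he hx
  · have hord := components_ordConnected hI
    have ho := components_isOpen (isOpen_posSet ν μ) hI
    have hnhds := (isOpen_posSet μ ν).mem_nhds hx
    rcases hend with he | he
    · obtain ⟨y, hy, hy'⟩ := ((eventually_mem_nhdsGT hord ho (components_nonempty hI) he).and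
        (mem_nhdsWithin_of_mem_nhds hnhds)).exists
      exact Set.disjoint_left.1 (disjoint_posSet_negSet μ ν) hy' (components_subset hI hy)
    · obtain ⟨y, hy, hy'⟩ := ((eventually_mem_nhdsLT hord ho (components_nonempty hI) he).and
        (mem_nhdsWithin_of_mem_nhds hnhds)).exists
      exact Set.disjoint_left.1 (disjoint_posSet_negSet μ ν) hy' (components_subset hI hy)

theorem negSet_disjoint_boundaryPts (μ ν : Measure ℝ) [IsFiniteMeasure μ] [IsFiniteMeasure ν] :
    Disjoint (negSet μ ν) (boundaryPts μ ν) := by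
  rw [boundaryPts_comm]
  exact posSet_disjoint_boundaryPts ν μ

theorem tsum_measure_inter_components {E : Set ℝ} (hE : IsOpen E) (κ : Measure ℝ) {A : Set ℝ}
    (hA : MeasurableSet A) : ∑' I : components E, κ (A ∩ I) = κ (A ∩ E) := by
  have := (countable_components hE).to_subtype
  rw [← measure_iUnion (fun I J h => ?_) fun I =>
    hA.inter (components_isOpen hE I.2).measurableSet]
  · congr 1
    ext x
    simp only [mem_iUnion, mem_inter_iff, Subtype.exists, exists_and_left, exists_prop]
    refine and_congr_right fun _ => ⟨?_, fun hx => ⟨_, ⟨x, hx, rfl⟩, mem_connectedComponentIn hx⟩⟩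
    rintro ⟨I, hI, hx⟩
    exact components_subset hI hx
  · exact (components_disjoint I.2 J.2 fun e => h (Subtype.ext e)).mono inter_subset_right
      inter_subset_right

theorem leftAtom_apply_eq_zero_of_disjoint {I : Set ℝ} (hI : I ∈ components (posSet μ ν))
    {A : Set ℝ} (hA : MeasurableSet A) (hAB : Disjoint A (boundaryPts μ ν)) :
    leftAtom μ ν I A = 0 :=
  leftAtom_apply_eq_zero (components_nonempty hI) hA fun _ ha haA =>
    Set.disjoint_left.1 hAB haA ⟨I, Or.inl hI, Or.inl ha⟩

theorem rightAtom_apply_eq_zero_of_disjoint (hmass : μ univ = ν univ) {I : Set ℝ}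
    (hI : I ∈ components (negSet μ ν)) {A : Set ℝ} (hA : MeasurableSet A)
    (hAB : Disjoint A (boundaryPts μ ν)) : rightAtom ν μ I A = 0 :=
  rightAtom_apply_eq_zero hmass.symm (components_nonempty hI) hA fun _ ha haA =>
    Set.disjoint_left.1 hAB haA ⟨I, Or.inr hI, Or.inr ha⟩

variable [IsFiniteMeasure μ] [IsFiniteMeasure ν]

theorem muPosTotal_apply {A : Set ℝ} (hA : MeasurableSet A) :
    muPosTotal μ ν A = ∑' I : components (posSet μ ν), leftAtom μ ν I A + μ (A ∩ posSet μ ν) := by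
  rw [muPosTotal, Measure.sum_apply _ hA, ← tsum_measure_inter_components (isOpen_posSet μ ν) μ hA,
    ← ENNReal.tsum_add]
  exact tsum_congr fun I => by rw [muPos_eq, Measure.add_apply, Measure.restrict_apply hA]

theorem muNegTotal_apply {A : Set ℝ} (hA : MeasurableSet A) :
    muNegTotal μ ν A = ∑' I : components (negSet μ ν), rightAtom ν μ I A + μ (A ∩ negSet μ ν) := by
  rw [muNegTotal, Measure.sum_apply _ hA,
    ← tsum_measure_inter_components (E := negSet μ ν) (isOpen_posSet ν μ) μ hA, add_comm,
    ← ENNReal.tsum_add]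
  exact tsum_congr fun I => by
    rw [← Measure.restrict_apply hA, ← Measure.add_apply]; rfl

/-- Two components with the same left end would overlap just to its right, so at most one atom
contributes. -/
theorem muPosTotal_singleton_le {x : ℝ} (hx : x ∉ posSet μ ν) :
    muPosTotal μ ν {x} ≤ μ (Iic x) - ν (Iic x) := by
  have hxE : {x} ∩ posSet μ ν = ∅ := by simpa using hx
  rw [muPosTotal_apply (measurableSet_singleton x), hxE, measure_empty, add_zero]
  by_cases hex : ∃ I : components (posSet μ ν), leftEnd (I : Set ℝ) = x
  · obtain ⟨I, hI⟩ := hex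
    have hatom : leftAtom μ ν I {x} = μ (Iic x) - ν (Iic x) := by
      rw [leftAtom_apply (components_nonempty I.2) (measurableSet_singleton x) fun a ha => by
        simpa [hI, eq_comm] using ha]
      have : lowerBounds (I : Set ℝ) = Iic x := by
        ext y; rw [mem_lowerBounds_iff_le_leftEnd, hI, EReal.coe_le_coe_iff, mem_Iic]
      rw [this]
    rw [tsum_eq_single I fun J hJ => ?_, hatom]
    refine leftAtom_apply_eq_zero (components_nonempty J.2) (measurableSet_singleton x)
      fun a ha hax => ?_
    rw [mem_singleton_iff.1 hax] at ha
    obtain ⟨y, hy, hy'⟩ := ((eventually_mem_nhdsGT (components_ordConnected I.2)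
      (components_isOpen (isOpen_posSet μ ν) I.2) (components_nonempty I.2) hI).and
      (eventually_mem_nhdsGT (components_ordConnected J.2)
      (components_isOpen (isOpen_posSet μ ν) J.2) (components_nonempty J.2) ha)).exists
    exact Set.disjoint_left.1 (components_disjoint J.2 I.2 fun e => hJ (Subtype.ext e)) hy' hy
  · rw [ENNReal.tsum_eq_zero.2 fun J => leftAtom_apply_eq_zero (components_nonempty J.2)
      (measurableSet_singleton x) fun a ha hax => hex ⟨J, by rw [ha, mem_singleton_iff.1 hax]⟩]
    exact zero_le

theorem muNegTotal_singleton_le (hmass : μ univ = ν univ) {x : ℝ} (hx : x ∉ negSet μ ν) :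
    muNegTotal μ ν {x} ≤ ν (Iio x) - μ (Iio x) := by
  have hxE : {x} ∩ negSet μ ν = ∅ := by simpa using hx
  rw [muNegTotal_apply (measurableSet_singleton x), hxE, measure_empty, add_zero]
  have ho : IsOpen (negSet μ ν) := isOpen_posSet ν μ
  by_cases hex : ∃ I : components (negSet μ ν), rightEnd (I : Set ℝ) = x
  · obtain ⟨I, hI⟩ := hex
    have hatom : rightAtom ν μ I {x} = ν (Iio x) - μ (Iio x) := by
      rw [rightAtom_apply hmass.symm (components_nonempty I.2) (measurableSet_singleton x)
        fun a ha => by simpa [hI, eq_comm] using ha]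
      have : (upperBounds (I : Set ℝ))ᶜ = Iio x := by
        ext y
        rw [mem_compl_iff, mem_upperBounds_iff_rightEnd_le, hI, EReal.coe_le_coe_iff, not_le,
          mem_Iio]
      rw [this]
    rw [tsum_eq_single I fun J hJ => ?_, hatom]
    refine rightAtom_apply_eq_zero hmass.symm (components_nonempty J.2) (measurableSet_singleton x)
      fun a ha hax => ?_
    rw [mem_singleton_iff.1 hax] at ha
    obtain ⟨y, hy, hy'⟩ := ((eventually_mem_nhdsLT (components_ordConnected I.2)
      (components_isOpen ho I.2) (components_nonempty I.2) hI).and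
      (eventually_mem_nhdsLT (components_ordConnected J.2)
      (components_isOpen ho J.2) (components_nonempty J.2) ha)).exists
    exact Set.disjoint_left.1 (components_disjoint J.2 I.2 fun e => hJ (Subtype.ext e)) hy' hy
  · rw [ENNReal.tsum_eq_zero.2 fun J => rightAtom_apply_eq_zero hmass.symm
      (components_nonempty J.2) (measurableSet_singleton x)
      fun a ha hax => hex ⟨J, by rw [ha, mem_singleton_iff.1 hax]⟩]
    exact zero_le

/-- What the components take from the atom of `μ` at a point outside of `E⁺ ∪ E⁻`. -/
theorem muPosTotal_add_muNegTotal_singleton_le (hmass : μ univ = ν univ) {x : ℝ}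
    (hx : x ∉ posSet μ ν) (hx' : x ∉ negSet μ ν) :
    muPosTotal μ ν {x} + muNegTotal μ ν {x} ≤ μ {x} := by
  refine (add_le_add (muPosTotal_singleton_le hx) (muNegTotal_singleton_le hmass hx')).trans ?_
  have hIic : ∀ κ : Measure ℝ, κ (Iic x) = κ (Iio x) + κ {x} := fun κ => by
    rw [← Iio_union_right, measure_union (by simp) (measurableSet_singleton x)]
  have h1 : ν (Iio x) < μ (Iio x) → μ (Iic x) ≤ ν (Iic x) := fun h => not_lt.1 fun h' => hx ⟨h', h⟩
  have h2 : μ (Iio x) < ν (Iio x) → ν (Iic x) ≤ μ (Iic x) := fun h => not_lt.1 fun h' => hx' ⟨h', h⟩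
  -- In the first case x ∉ E^- forces F_ν^+(x) ≤ F_μ^+(x), and the two atoms add up to μ({x}) -
  -- ν({x}). In the last case x ∉ E^+ makes both vanish.
  rcases lt_trichotomy (μ (Iio x)) (ν (Iio x)) with h | h | h
  · rw [← ENNReal.add_le_add_iff_left (a := μ (Iio x) + ν (Iic x)) (by finiteness)]
    calc μ (Iio x) + ν (Iic x) + (μ (Iic x) - ν (Iic x) + (ν (Iio x) - μ (Iio x)))
        = (μ (Iic x) - ν (Iic x) + ν (Iic x)) + (ν (Iio x) - μ (Iio x) + μ (Iio x)) := by ring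
      _ = μ (Iic x) + ν (Iio x) := by
        rw [tsub_add_cancel_of_le (h2 h), tsub_add_cancel_of_le h.le]
      _ ≤ μ (Iic x) + ν (Iic x) := by gcongr; exact Iio_subset_Iic_self
      _ = _ := by rw [hIic μ]; ring
  · rw [h, tsub_self, add_zero, tsub_le_iff_right, hIic, hIic, h, add_comm (μ {x})]
    gcongr
    exact le_self_add
  · rw [tsub_eq_zero_of_le (h1 h), tsub_eq_zero_of_le h.le, zero_add]
    exact zero_le

theorem muPosTotal_add_muNegTotal_add_muEq_apply (hmass : μ univ = ν univ) {A : Set ℝ}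
    (hA : MeasurableSet A) (hAB : Disjoint A (boundaryPts μ ν)) :
    (muPosTotal μ ν + muNegTotal μ ν + muEq μ ν) A = μ A := by
  have h1 : MeasurableSet (posSet μ ν) := (isOpen_posSet μ ν).measurableSet
  have h2 : MeasurableSet (negSet μ ν) := (isOpen_posSet ν μ).measurableSet
  have hsum : (Measure.sum fun x : boundaryPts μ ν =>
      (μ {(x : ℝ)} - muPosTotal μ ν {(x : ℝ)} - muNegTotal μ ν {(x : ℝ)}) •
        Measure.dirac (x : ℝ)) A = 0 := by
    rw [Measure.sum_apply _ hA]
    refine ENNReal.tsum_eq_zero.2 fun x => ?_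
    rw [Measure.smul_apply, Measure.dirac_apply' _ hA,
      indicator_of_notMem (Set.disjoint_right.1 hAB x.2), smul_zero]
  have hset : A ∩ ((boundaryPts μ ν)ᶜ ∩ eqSet μ ν) = (A \ posSet μ ν) \ negSet μ ν := by
    ext x
    simp only [eqSet, mem_inter_iff, mem_compl_iff, mem_union, not_or, Set.mem_sdiff]
    exact ⟨fun h => ⟨⟨h.1, h.2.2.1⟩, h.2.2.2⟩,
      fun h => ⟨h.1.1, Set.disjoint_left.1 hAB h.1.1, h.1.2, h.2⟩⟩
  have hset' : A ∩ negSet μ ν = (A \ posSet μ ν) ∩ negSet μ ν := by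
    ext x
    refine ⟨fun h => ⟨⟨h.1, fun hp => ?_⟩, h.2⟩, fun h => ⟨h.1.1, h.2⟩⟩
    exact Set.disjoint_left.1 (disjoint_posSet_negSet μ ν) hp h.2
  rw [Measure.add_apply, Measure.add_apply, muEq, Measure.add_apply, hsum, add_zero,
    Measure.restrict_apply hA, muPosTotal_apply hA, muNegTotal_apply hA,
    ENNReal.tsum_eq_zero.2 fun I => leftAtom_apply_eq_zero_of_disjoint I.2 hA hAB,
    ENNReal.tsum_eq_zero.2 fun I => rightAtom_apply_eq_zero_of_disjoint hmass I.2 hA hAB,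
    zero_add, zero_add, hset, hset', add_assoc, measure_inter_add_sdiff _ h2,
    measure_inter_add_sdiff _ h1]

theorem muPosTotal_add_muNegTotal_add_muEq_singleton (hmass : μ univ = ν univ) {x : ℝ}
    (hx : x ∈ boundaryPts μ ν) :
    (muPosTotal μ ν + muNegTotal μ ν + muEq μ ν) {x} = μ {x} := by
  have hle := muPosTotal_add_muNegTotal_singleton_le hmass
    (Set.disjoint_right.1 (posSet_disjoint_boundaryPts μ ν) hx)
    (Set.disjoint_right.1 (negSet_disjoint_boundaryPts μ ν) hx)
  have hsum : (Measure.sum fun x : boundaryPts μ ν =>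
      (μ {(x : ℝ)} - muPosTotal μ ν {(x : ℝ)} - muNegTotal μ ν {(x : ℝ)}) •
        Measure.dirac (x : ℝ)) {x} = μ {x} - muPosTotal μ ν {x} - muNegTotal μ ν {x} := by
    rw [Measure.sum_apply _ (measurableSet_singleton x), tsum_eq_single ⟨x, hx⟩ fun y hy => ?_]
    · simp
    · have : (y : ℝ) ≠ x := fun e => hy (Subtype.ext e)
      simp [this]
  rw [Measure.add_apply, Measure.add_apply, muEq, Measure.add_apply, hsum,
    Measure.restrict_apply (measurableSet_singleton x),
    show {x} ∩ ((boundaryPts μ ν)ᶜ ∩ eqSet μ ν) = ∅ by simp [hx], measure_empty, zero_add,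
    tsub_tsub, add_tsub_cancel_of_le hle]

/-- Since B is countable, it suffices to compare the measures off B and at each point of B. There
the truncated subtractions in `muEq` are exact, by `muPosTotal_add_muNegTotal_singleton_le`. -/
theorem muPosTotal_add_muNegTotal_add_muEq (hmass : μ univ = ν univ) :
    muPosTotal μ ν + muNegTotal μ ν + muEq μ ν = μ := by
  have hB := countable_boundaryPts μ ν
  ext A hA
  have hsplit : ∀ κ : Measure ℝ,
      κ A = ∑' x : ↥(A ∩ boundaryPts μ ν), κ {(x : ℝ)} + κ (A \ boundaryPts μ ν) := fun κ => by
    rw [← measure_biUnion (f := fun x : ℝ => {x}) (hB.mono inter_subset_right)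
      (fun x _ y _ h => disjoint_singleton.2 h) fun x _ => measurableSet_singleton x,
      biUnion_of_singleton,
      measure_inter_add_sdiff _ hB.measurableSet]
  rw [hsplit, hsplit μ, muPosTotal_add_muNegTotal_add_muEq_apply hmass
    (hA.diff hB.measurableSet) disjoint_sdiff_left]
  congr 1
  exact tsum_congr fun x => muPosTotal_add_muNegTotal_add_muEq_singleton hmass x.2.2

end FirstMarginal

/-! ### Convergence of the entropic plans -/

section Quadrants

variable {μ : Measure ℝ} [IsFiniteMeasure μ] {P : Measure (ℝ × ℝ)}

theorem apply_Iio_prod_Ici_add (s t : ℝ) :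
    P (Iio s ×ˢ Iio t) + P (Iio s ×ˢ Ici t) = P.map Prod.fst (Iio s) := by
  rw [Measure.map_apply measurable_fst measurableSet_Iio, ← prod_univ, ← Iio_union_Ici (a := t),
    prod_union, measure_union _ (measurableSet_Iio.prod measurableSet_Ici)]
  exact Set.disjoint_left.2 fun p hp hp' => absurd (mem_Iio.1 hp.2) (not_lt.2 hp'.2)

theorem apply_quadrant_eq_cross (hP : P.map Prod.fst = μ) (s t : ℝ) :
    P (Iio s ×ˢ Iio t) = μ (Iio s) - P (Iio s ×ˢ Ici t) := by
  have h := apply_Iio_prod_Ici_add (P := P) s t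
  rw [hP] at h
  exact ENNReal.eq_sub_of_add_eq
    (ne_top_of_le_ne_top (measure_ne_top μ (Iio s)) (h ▸ le_add_self)) h

/-- This serves `t ≤ s`: the second marginal of `Iio t` is rewritten by conservation of mass at `t`,
so that only the first marginal and crossing masses occur. -/
theorem apply_quadrant_eq_reverse_cross (hP : P.map Prod.fst = μ) (s t : ℝ) :
    P (Iio s ×ˢ Iio t) =
      μ (Iio t) - P (Iio t ×ˢ Ici t) + P (Ici t ×ˢ Iio t) - P (Ici s ×ˢ Iio t) := by
  have hfin : P univ ≠ ∞ := by
    rw [← preimage_univ (f := Prod.fst), ← Measure.map_apply measurable_fst .univ, hP]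
    exact measure_ne_top _ _
  have hsplit : ∀ r : ℝ, P (Iio r ×ˢ Iio t) + P (Ici r ×ˢ Iio t) = P (univ ×ˢ Iio t) := fun r => by
    rw [← Iio_union_Ici (a := r), union_prod,
      measure_union _ (measurableSet_Ici.prod measurableSet_Iio)]
    exact Set.disjoint_left.2 fun p hp hp' => absurd (mem_Iio.1 hp.1) (not_lt.2 hp'.1)
  rw [← apply_quadrant_eq_cross hP, hsplit t]
  exact ENNReal.eq_sub_of_add_eq (ne_top_of_le_ne_top hfin (measure_mono (subset_univ _)))
    (hsplit s)

end Quadrants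

theorem map_swap_prod (P : Measure (ℝ × ℝ)) {A B : Set ℝ} (hA : MeasurableSet A)
    (hB : MeasurableSet B) : P.map Prod.swap (A ×ˢ B) = P (B ×ˢ A) := by
  rw [Measure.map_apply measurable_swap (hA.prod hB), preimage_swap_prod]

/-- The diagonal part does not charge a product of disjoint sets; it enters the argument only
through the first marginal. -/
theorem kellererPlan_apply {μ ν : Measure ℝ} (A B : Set ℝ) (hA : MeasurableSet A)
    (hB : MeasurableSet B) (hAB : Disjoint A B) : kellererPlan μ ν (A ×ˢ B) =
      (Measure.sum fun I : components (posSet μ ν) => kellererF (muPos μ ν I) (nuPos μ ν I))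
        (A ×ˢ B) +
      (Measure.sum fun I : components (posSet ν μ) => kellererF (muPos ν μ I) (nuPos ν μ I))
        (B ×ˢ A) := by
  have h1 : (muEq μ ν).map (fun x => (x, x)) (A ×ˢ B) = 0 := by
    rw [Measure.map_apply (by fun_prop) (hA.prod hB)]
    convert measure_empty (μ := muEq μ ν)
    ext x
    simpa using fun hx => Set.disjoint_left.1 hAB hx
  rw [kellererPlan, Measure.add_apply, Measure.add_apply, h1, add_zero,
    ← Measure.map_sum measurable_swap.aemeasurable, map_swap_prod _ hA hB]
  rfl

section Plan

variable {μ ν : Measure ℝ} [IsFiniteMeasure μ] [IsFiniteMeasure ν] {π : ℝ → Measure (ℝ × ℝ)}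
  {a b : ℝ → ℝ → ℝ≥0}

/-- This yields finiteness of the plan, its total mass, and the passage from crossing masses to
quadrants. Negative components are handled by the swapped entropic plans. -/
theorem map_fst_kellererPlan (h : ∀ ε > 0, EntropicFactors ε μ ν (π ε) (a ε) (b ε))
    (hmass : μ univ = ν univ) : (kellererPlan μ ν).map Prod.fst = μ := by
  have h' : ∀ ε > 0, EntropicFactors ε ν μ ((π ε).map Prod.swap) (b ε) (a ε) :=
    fun ε hε => (h ε hε).swap
  rw [kellererPlan, Measure.map_add _ _ measurable_fst, Measure.map_add _ _ measurable_fst,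
    Measure.map_sum measurable_fst.aemeasurable, Measure.map_sum measurable_fst.aemeasurable,
    Measure.map_map measurable_fst (by fun_prop)]
  conv_rhs => rw [← muPosTotal_add_muNegTotal_add_muEq hmass]
  congr 1
  · congr 1
    · rw [muPosTotal]
      congr 1
      funext I
      exact (kellererF_spec h hmass I.2).1.1
    · rw [muNegTotal]
      congr 1
      funext I
      rw [Measure.map_map measurable_fst measurable_swap]
      exact (kellererF_spec h' hmass.symm I.2).1.2
  · exact Measure.map_id

theorem isFiniteMeasure_of_map_fst {P : Measure (ℝ × ℝ)} (hP : P.map Prod.fst = μ) :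
    IsFiniteMeasure P := by
  refine ⟨?_⟩
  rw [← preimage_univ (f := Prod.fst), ← Measure.map_apply measurable_fst .univ, hP]
  exact measure_lt_top _ _

theorem tendsto_cross_kellererPlan (h : ∀ ε > 0, EntropicFactors ε μ ν (π ε) (a ε) (b ε))
    (hmass : μ univ = ν univ) {s t : ℝ} (hst : s ≤ t) (hμt : μ {t} = 0) (hνt : ν {t} = 0) :
    Tendsto (fun ε => π ε (Iio s ×ˢ Ici t)) (𝓝[>] 0)
      (𝓝 (kellererPlan μ ν (Iio s ×ˢ Ici t))) := by
  have h' : ∀ ε > 0, EntropicFactors ε ν μ ((π ε).map Prod.swap) (b ε) (a ε) :=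
    fun ε hε => (h ε hε).swap
  rw [kellererPlan_apply _ _ measurableSet_Iio measurableSet_Ici
    (Set.disjoint_left.2 fun x hx hx' => absurd (mem_Iio.1 hx) (not_lt.2 (hst.trans hx'))),
    sum_kellererF_reverse_eq_zero h' hmass.symm hst, add_zero]
  exact tendsto_cross_sum_kellererF h hmass hst hμt hνt

theorem tendsto_reverse_cross_kellererPlan
    (h : ∀ ε > 0, EntropicFactors ε μ ν (π ε) (a ε) (b ε))
    (hmass : μ univ = ν univ) {s t : ℝ} (hst : s ≤ t) (hμt : μ {t} = 0) (hνt : ν {t} = 0) :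
    Tendsto (fun ε => π ε (Ici t ×ˢ Iio s)) (𝓝[>] 0)
      (𝓝 (kellererPlan μ ν (Ici t ×ˢ Iio s))) := by
  have h' : ∀ ε > 0, EntropicFactors ε ν μ ((π ε).map Prod.swap) (b ε) (a ε) :=
    fun ε hε => (h ε hε).swap
  have key := tendsto_cross_sum_kellererF h' hmass.symm hst hνt hμt
  simp only [map_swap_prod _ measurableSet_Iio measurableSet_Ici] at key
  rw [kellererPlan_apply _ _ measurableSet_Ici measurableSet_Iio
    (Set.disjoint_right.2 fun x hx hx' => absurd (mem_Iio.1 hx) (not_lt.2 (hst.trans hx'))),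
    sum_kellererF_reverse_eq_zero h hmass hst, zero_add]
  exact key

theorem tendsto_quadrant_kellererPlan (h : ∀ ε > 0, EntropicFactors ε μ ν (π ε) (a ε) (b ε))
    (hmass : μ univ = ν univ) {s t : ℝ} (hs : (μ + ν) {s} = 0) (ht : (μ + ν) {t} = 0) :
    Tendsto (fun ε => π ε (Iio s ×ˢ Iio t)) (𝓝[>] 0)
      (𝓝 (kellererPlan μ ν (Iio s ×ˢ Iio t))) := by
  have hK := map_fst_kellererPlan h hmass
  have hfin := isFiniteMeasure_of_map_fst hK
  rw [Measure.add_apply, add_eq_zero] at hs ht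
  rcases le_total s t with hst | hts
  · rw [apply_quadrant_eq_cross hK]
    refine (ENNReal.Tendsto.sub tendsto_const_nhds
      (tendsto_cross_kellererPlan h hmass hst ht.1 ht.2) (Or.inl (measure_ne_top _ _))).congr' ?_
    filter_upwards [self_mem_nhdsWithin] with ε hε
    rw [apply_quadrant_eq_cross (h ε hε).marg.1]
  · rw [apply_quadrant_eq_reverse_cross hK]
    refine (ENNReal.Tendsto.sub ((ENNReal.Tendsto.sub tendsto_const_nhds
      (tendsto_cross_kellererPlan h hmass le_rfl ht.1 ht.2) (Or.inl (measure_ne_top _ _))).add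
      (tendsto_reverse_cross_kellererPlan h hmass le_rfl ht.1 ht.2))
      (tendsto_reverse_cross_kellererPlan h hmass hts hs.1 hs.2)
      (Or.inr (measure_ne_top _ _))).congr' ?_
    filter_upwards [self_mem_nhdsWithin] with ε hε
    rw [apply_quadrant_eq_reverse_cross (h ε hε).marg.1]

end Plan

end EntropicLine

theorem theorem3 (μ ν : Measure ℝ) [IsFiniteMeasure μ] [IsFiniteMeasure ν]
    (hmass : μ univ = ν univ)
    (hpos : ∀ I ∈ EntropicLine.components (EntropicLine.posSet μ ν),
      Measure.MutuallySingular (EntropicLine.muPos μ ν I) (EntropicLine.nuPos μ ν I))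
    (hneg : ∀ I ∈ EntropicLine.components (EntropicLine.negSet μ ν),
      Measure.MutuallySingular (EntropicLine.muNeg μ ν I) (EntropicLine.nuNeg μ ν I))
    (π : ℝ → FiniteMeasure (ℝ × ℝ))
    (hπ : ∀ ε : ℝ, 0 < ε →
      EntropicLine.IsCyclicallyInvariant ε μ ν (π ε : Measure (ℝ × ℝ))) :
    ∃ K : FiniteMeasure (ℝ × ℝ),
      (K : Measure (ℝ × ℝ)) = EntropicLine.kellererPlan μ ν ∧
        Tendsto π (𝓝[>] (0 : ℝ)) (𝓝 K) := by
  choose! a b hab using fun (ε : ℝ) (hε : 0 < ε) => (hπ ε hε).exists_entropicFactors hε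
  have h : ∀ ε > 0, EntropicLine.EntropicFactors ε μ ν (π ε : Measure (ℝ × ℝ)) (a ε) (b ε) := hab
  have hK := EntropicLine.map_fst_kellererPlan (π := fun ε => (π ε : Measure (ℝ × ℝ))) h hmass
  have hfst : ∀ P : Measure (ℝ × ℝ), P univ = P.map Prod.fst univ := fun P => by
    rw [Measure.map_apply measurable_fst .univ, preimage_univ]
  refine ⟨⟨EntropicLine.kellererPlan μ ν, EntropicLine.isFiniteMeasure_of_map_fst hK⟩, rfl, ?_⟩
  -- Corners avoid the countably many atoms of `μ + ν`, where crossing masses need not converge to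
  -- those of the plan.
  refine EntropicLine.tendsto_finiteMeasure_of_quadrants
    (EntropicLine.dense_setOf_measure_singleton_eq_zero (μ + ν)) ?_ fun s hs t ht =>
    EntropicLine.tendsto_quadrant_kellererPlan (π := fun ε => (π ε : Measure (ℝ × ℝ)))
      h hmass hs ht
  filter_upwards [self_mem_nhdsWithin] with ε hε
  rw [hfst, (h ε hε).marg.1, FiniteMeasure.toMeasure_mk, hfst, hK]
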